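/- Let $K=(K,+,\cdot,0,1)$ be a commutative, non-trivial ($0\ne1$) and positive semiring (positive: $a,b\neq 0$ implies $ab\ne0$, and $a+b=0$ implies $a=b=0$). $K$ is used either without an order, or as an ordered semiring with a fixed partial order $\le$ such that $0\le 1$, addition is monotone, and multiplication by elements $c\ge 0$ is monotone. The statement below holds in both cases. Let $K^*$ be the set of finite strings over $K$. **Logic.** Let $\mathrm{Prop}$ be a countably infinite set of propositions, named by binary strings. Formulas are given by $\varphi ::= p\mid \neg p\mid c\mid \varphi=\varphi\mid(\varphi\wedge\varphi)\mid(\varphi\vee\varphi)$ with $p\in\mathrm{Prop}$, $c\in K$, and additionally $\varphi\le\varphi$ if $K$ is ordered. For an assignment $s:\{p,\neg p\mid p\in\mathrm{Prop}\}\to K$, the value $[\![\varphi]\!]_s\in K$ interprets literals by $s$, constants by themselves, $\wedge$ by $\cdot$, $\vee$ by $+$, and $\varphi\circ\psi$ (for $\circ\in\{=,\le\}$) by $1$ if $[\![\varphi]\!]_s\circ[\![\psi]\!]_s$ and by $0$ otherwise. Formulas are encoded injectively as strings over $K$: they are written in postfix notation, each constant $c\in K$ stands for itself, and all other information (symbols,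 names of propositions) is written as self-delimiting binary strings over $\{0,1\}\subseteq K$. Let $\mathrm{SAT}_K^{=}\subseteq K^*$ be the set of codes of formulas $\varphi$ for which there is an assignment $s$ with $[\![\varphi]\!]_s\neq0$. **Machines.** A $\mathrm{BSS}_K$ machine is a finite connected directed graph of nodes with one input node (the start node) and one output node. It acts on states $x\in K^{\mathbb Z}$. A computation node performs one operation $x_i:=x_j+x_k$, $x_i:=x_j\cdot x_k$ or $x_i:=c$ with fixed $i,j,k\in\mathbb Z$, $c\in K$. A branch node tests $x_1\le x_2$ if $K$ is ordered, and $x_1=x_2$ otherwise. A shift node shifts the state by one position to the left or to the right. The computation halts at the output node. On input $(x_1,\dots,x_n)$ the initial state is $(\dots,0,1^n,0\,.\,x_1,\dots,x_n,0,\dots)$, where the coordinate following the dot is the first one. On input $(x_1,\dots,x_n)$ with guess $(x'_1,\dots,x'_m)$ it is $(\dots,0,1^m,0,1^n,0\,.\,x_1,\dots,x_n,x'_1,\dots,x'_m,0,\dots)$. The output of a halting computation is the string of the first $\ell$ positive coordinates, where $\ell$ is the number of consecutive ones at coordinates $-1,-2,\dots$. **Complexity.** A language $L\subseteq K^*$ is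 in $\mathsf{NP}_K$ if there are a $\mathrm{BSS}_K$ machine $M$ and a polynomial $p$ such that for every input $\bar x\in K^*$ and every guess $\bar x'\in K^*$ the machine $M$ halts after at most $p(|\bar x|)$ steps, and for every $\bar x\in K^*$ we have $\bar x\in L$ if and only if for some guess $\bar x'\in K^*$ the output of $M$ on $(\bar x,\bar x')$ is a single nonzero element of $K$. For $P,Q\subseteq K^*$ write $P\le Q$ if there is a function $f:K^*\to K^*$, computed by a $\mathrm{BSS}_K$ machine in a number of steps polynomial in the length of the input, such that $\bar x\in P\iff f(\bar x)\in Q$ for all $\bar x\in K^*$. A language $L$ is $\mathsf{NP}_K$-complete if $L\in\mathsf{NP}_K$ and $L'\le L$ for all $L'\in\mathsf{NP}_K$. **Theorem.** $\mathrm{SAT}_K^{=}$ is $\mathsf{NP}_K$-complete. -/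

import Mathlib

universe u

namespace CookK

/-! ## Semirings -/

/-- A semiring is positive if it has no divisors of zero and a sum vanishes only if both
summands do. -/
def IsPositive (K : Type u) [Semiring K] : Prop :=
  (∀ a b : K, a ≠ 0 → b ≠ 0 → a * b ≠ 0) ∧ (∀ a b : K, a + b = 0 → a = 0 ∧ b = 0)

/-- A partial order that makes `K` an ordered semiring: `0 ≤ 1`, addition is monotone, and
multiplication by elements `0 ≤ c` (on either side) is monotone. -/
structure SemiringOrder (K : Type u) [Semiring K] where
  order : PartialOrder K
  isOrderedRing : IsOrderedRing K

/-- The order relation of an ordered semiring. -/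
def SemiringOrder.Le {K : Type u} [Semiring K] (o : SemiringOrder K) (a b : K) : Prop :=
  o.order.le a b

/-! Everything below depends on a parameter `ord : Option (SemiringOrder K)`. The value `none`
means that `K` is used as a semiring without order, the value `some o` means that `K` is used as an
ordered semiring with the order `o`. -/

/-! ## Propositional logic over `K` -/

/-- The countably infinite set of propositions; its elements are named by binary strings. -/
abbrev Proposition : Type := List Bool

/-- Propositions and negated propositions. -/
inductive Literal : Type
  | pos (p : Proposition)
  | neg (p : Proposition)

/-- Formulas of propositional logic over `K` with formula (in)equalities and constants from `K`.
Comparisons `φ ≤ ψ` are available only if `K` is ordered. -/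
inductive Formula {K : Type u} [Semiring K] (ord : Option (SemiringOrder K)) : Type u
  | lit (l : Literal)
  | const (c : K)
  | eq (φ ψ : Formula ord)
  | le (h : ord.isSome) (φ ψ : Formula ord)
  | and (φ ψ : Formula ord)
  | or (φ ψ : Formula ord)

open Classical in
/-- The value of a formula under an assignment of elements of `K` to all literals; the values of
`p` and `¬p` are unrelated. -/
noncomputable def Formula.eval {K : Type u} [Semiring K] {ord : Option (SemiringOrder K)}
    (s : Literal → K) : Formula ord → K
  | .lit l => s l
  | .const c => c
  | .eq φ ψ => if φ.eval s = ψ.eval s then 1 else 0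
  | .le h φ ψ => if (ord.get h).Le (φ.eval s) (ψ.eval s) then 1 else 0
  | .and φ ψ => φ.eval s * ψ.eval s
  | .or φ ψ => φ.eval s + ψ.eval s

/-- A formula is satisfiable if some assignment gives it a nonzero value. -/
def Formula.Satisfiable {K : Type u} [Semiring K] {ord : Option (SemiringOrder K)}
    (φ : Formula ord) : Prop :=
  ∃ s : Literal → K, φ.eval s ≠ 0

/-! ## Encoding of formulas as strings over `K`

Formulas are written in postfix notation. Every symbol starts with a tag of three bits; constants
from `K` stand for themselves, and a proposition `b₁ … bₖ` is written `1 b₁ 1 b₂ … 1 bₖ 0`. -/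

/-- A bit as an element of `K`. -/
def bit (K : Type u) [Semiring K] (b : Bool) : K := if b then 1 else 0

/-- The self-delimiting code of a proposition. -/
def encodeProposition (K : Type u) [Semiring K] (p : Proposition) : List K :=
  p.flatMap (fun b => [1, bit K b]) ++ [0]

/-- The code of a literal. -/
def encodeLiteral (K : Type u) [Semiring K] : Literal → List K
  | .pos p => [0, 0, 0] ++ encodeProposition K p
  | .neg p => [0, 0, 1] ++ encodeProposition K p

/-- The code of a formula. -/
def Formula.encode {K : Type u} [Semiring K] {ord : Option (SemiringOrder K)} :
    Formula ord → List K
  | .lit l => encodeLiteral K l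
  | .const c => [0, 1, 0, c]
  | .eq φ ψ => φ.encode ++ ψ.encode ++ [0, 1, 1]
  | .le _ φ ψ => φ.encode ++ ψ.encode ++ [1, 0, 0]
  | .and φ ψ => φ.encode ++ ψ.encode ++ [1, 0, 1]
  | .or φ ψ => φ.encode ++ ψ.encode ++ [1, 1, 0]

/-- The satisfiability problem, as a language of strings over `K`. -/
def SAT {K : Type u} [Semiring K] (ord : Option (SemiringOrder K)) : Set (List K) :=
  {w | ∃ φ : Formula ord, φ.encode = w ∧ φ.Satisfiable}

/-! ## BSS machines over `K` -/

/-- The state space of bi-infinite sequences over `K`. -/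
abbrev State (K : Type u) : Type u := ℤ → K

/-- What a node of a machine with node set `Q` does, together with its next nodes. The computation
nodes are `add i j k`, which sets `xᵢ := xⱼ + xₖ`, `mul i j k`, which sets `xᵢ := xⱼ * xₖ`, and
`const i c`, which sets `xᵢ := c`. -/
inductive Instr (K : Type u) (Q : Type) : Type u
  | input (next : Q)
  | output
  | add (i j k : ℤ) (next : Q)
  | mul (i j k : ℤ) (next : Q)
  | const (i : ℤ) (c : K) (next : Q)
  | branch (nextMinus nextPlus : Q)
  | shiftLeft (next : Q)
  | shiftRight (next : Q)

/-- The next nodes named by an instruction. -/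
def Instr.successors {K : Type u} {Q : Type} : Instr K Q → Set Q
  | .input q => {q}
  | .output => ∅
  | .add _ _ _ q => {q}
  | .mul _ _ _ q => {q}
  | .const _ _ q => {q}
  | .branch q q' => {q, q'}
  | .shiftLeft q => {q}
  | .shiftRight q => {q}

/-- A BSS machine over `K`: a finite connected directed graph of nodes with exactly one input node
and exactly one output node. -/
structure Machine (K : Type u) where
  Node : Type
  finite : Finite Node
  instr : Node → Instr K Node
  inputNode : Node
  outputNode : Node
  input_iff : ∀ q, (∃ q', instr q = .input q') ↔ q = inputNode
  output_iff : ∀ q, instr q = .output ↔ q = outputNode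
  connected : ∀ q q', Relation.EqvGen (fun a b => b ∈ (instr a).successors) q q'

/-- The comparison made at a branch node: `≤` if `K` is ordered, and `=` otherwise. -/
def BranchTest {K : Type u} [Semiring K] : Option (SemiringOrder K) → K → K → Prop
  | none, a, b => a = b
  | some o, a, b => o.Le a b

namespace Machine

open Classical in
/-- One computation step on configurations. The input node only passes control to its next node,
since the input mapping has already produced the initial state. The output node halts, so
configurations at the output node stay unchanged. -/
noncomputable def step {K : Type u} [Semiring K] (ord : Option (SemiringOrder K)) (M : Machine K)
    (c : M.Node × State K) : M.Node × State K :=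
  match M.instr c.1 with
  | .input q => (q, c.2)
  | .output => c
  | .add i j k q => (q, Function.update c.2 i (c.2 j + c.2 k))
  | .mul i j k q => (q, Function.update c.2 i (c.2 j * c.2 k))
  | .const i a q => (q, Function.update c.2 i a)
  | .branch q q' => (if BranchTest ord (c.2 1) (c.2 2) then q else q', c.2)
  | .shiftLeft q => (q, fun z => c.2 (z + 1))
  | .shiftRight q => (q, fun z => c.2 (z - 1))

/-- The configuration after `t` steps, started at the input node in the state `x`. -/
noncomputable def run {K : Type u} [Semiring K] (ord : Option (SemiringOrder K)) (M : Machine K)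
    (x : State K) (t : ℕ) : M.Node × State K :=
  (M.step ord)^[t] (M.inputNode, x)

/-- The computation started in the state `x` reaches the output node after at most `T` steps. -/
def HaltsWithin {K : Type u} [Semiring K] (ord : Option (SemiringOrder K)) (M : Machine K)
    (x : State K) (T : ℕ) : Prop :=
  ∃ t ≤ T, (M.run ord x t).1 = M.outputNode

/-- The graph of the output mapping: `y` consists of the first `ℓ` positive coordinates of `x`,
where `ℓ` is the number of consecutive ones at the coordinates `-1, -2, …`. -/
def ReadsOut {K : Type u} [Semiring K] (x : State K) (y : List K) : Prop :=
  (∀ i : ℕ, i < y.length → x (-((i : ℤ) + 1)) = 1) ∧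
  x (-((y.length : ℤ) + 1)) ≠ 1 ∧
  ∀ i : Fin y.length, y.get i = x ((i : ℤ) + 1)

/-- The computation started in the state `x` halts with the output `y`. -/
def Outputs {K : Type u} [Semiring K] (ord : Option (SemiringOrder K)) (M : Machine K)
    (x : State K) (y : List K) : Prop :=
  ∃ t, (M.run ord x t).1 = M.outputNode ∧ ReadsOut (M.run ord x t).2 y

end Machine

/-- The input mapping, which sends `x` of length `n` to the state `(…, 0, 1ⁿ, 0 . x, 0, …)`. -/
def inputState {K : Type u} [Semiring K] (x : List K) : State K := fun z =>
  if 1 ≤ z then x.getD (z - 1).toNat 0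
  else if -(x.length : ℤ) ≤ z ∧ z ≤ -1 then 1
  else 0

/-- The modified input mapping for an input `x` of length `n` and a guess `x'` of length `m`,
which produces the state `(…, 0, 1ᵐ, 0, 1ⁿ, 0 . x, x', 0, …)`. -/
def guessState {K : Type u} [Semiring K] (x x' : List K) : State K := fun z =>
  if 1 ≤ z then (x ++ x').getD (z - 1).toNat 0
  else if -(x.length : ℤ) ≤ z ∧ z ≤ -1 then 1
  else if -((x.length : ℤ) + 1 + x'.length) ≤ z ∧ z ≤ -((x.length : ℤ) + 2) then 1
  else 0

/-! ## Complexity -/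

/-- The class `NP` over `K`. The running time, for every guess, is bounded by a polynomial in the
length of the input alone. A computation accepts if its output is a single nonzero element. -/
def NP {K : Type u} [Semiring K] (ord : Option (SemiringOrder K)) : Set (Set (List K)) :=
  {L | ∃ (M : Machine K) (p : Polynomial ℕ),
    (∀ x x' : List K, M.HaltsWithin ord (guessState x x') (p.eval x.length)) ∧
    ∀ x : List K, x ∈ L ↔
      ∃ (x' : List K) (y : K), M.Outputs ord (guessState x x') [y] ∧ y ≠ 0}

/-- Functions computable in polynomial time by a BSS machine over `K`. -/
def PolyTimeComputable {K : Type u} [Semiring K] (ord : Option (SemiringOrder K))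
    (f : List K → List K) : Prop :=
  ∃ (M : Machine K) (p : Polynomial ℕ), ∀ x : List K,
    M.HaltsWithin ord (inputState x) (p.eval x.length) ∧ M.Outputs ord (inputState x) (f x)

/-- Polynomial-time many-one reducibility. -/
def Reduces {K : Type u} [Semiring K] (ord : Option (SemiringOrder K))
    (P Q : Set (List K)) : Prop :=
  ∃ f : List K → List K, PolyTimeComputable ord f ∧ ∀ x, x ∈ P ↔ f x ∈ Q

/-- Completeness for `NP` over `K` under polynomial-time many-one reductions. -/
def NPComplete {K : Type u} [Semiring K] (ord : Option (SemiringOrder K))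
    (L : Set (List K)) : Prop :=
  L ∈ NP ord ∧ ∀ L' ∈ NP ord, Reduces ord L' L

end CookK

/-!
Both halves of the theorem need programs for machines whose only memory is one bi-infinite tape
with fixed addresses near the origin. They are written in a small structured language, `Cmd`, and
compiled to machines. On top of it the tape is divided into thirteen interleaved tracks, and every
track is used as a stack of elements of `K` (`Rep`). Control flow depends on cells that hold a bit:
for such a cell `x`, both branch tests, `1 = x` and `1 ≤ x`, tell whether `x` is one, since `0 ≤ 1`
and `0 ≠ 1`. The specification `Does ord P σ σ' t` says that the program `P` turns the stacks `σ`
into the stacks `σ'` by at most `t` stack operations. Since the addresses of a machine are fixed,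
pushing and popping move the remaining elements of a stack along the tape, which costs time linear
in the sizes of the stacks. Hence polynomially many stack operations yield a machine with polynomial
running time: `mem_NP_of_does` for membership in `NP` and `polyTimeComputable_of_does` for
computable functions. A machine has to stop within a time bounded in terms of the input, whatever
the guess is, so only as many elements of the guess as the input has are loaded. This is enough
because a formula has fewer occurrences of literals than its code has symbols.

Membership. The verifier reads the code of a formula token by token and evaluates it on a stack of
values, as usual for postfix notation. The guess lists the values of the occurrences of the
literals. The verifier keeps a dictionary of the literals met so far, together with their values,
and rejects if two occurrences of a literal have different values, or if the input is not the code
of a formula. So an accepted guess comes from an assignment that gives the formula a nonzero value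
(`stepTokens_sound`), and every assignment gives a guess for which the verifier computes the value
of the formula (`stepTokens_complete`). This half needs no property of `K` but its being a
non-trivial semiring (`sat_mem_NP`).

Hardness. Let `M` decide a language within time `T` and let `x` be an input. The tableau of a
computation has a variable for the content of every cell near the origin at every time `t ≤ T`, and
a variable for the truth value of "the machine is at the node `q` at the time `t`". The content of a
cell after one step is the sum, over the nodes `q`, of the truth value of `q` times the new content
that the instruction at `q` prescribes, which is a sum, a product, a constant, or the content of
the cell or of a neighbour. Since the truth values are zeros and ones, exactly one of them being
one, this equation describes the step correctly over any semiring. The result of a branch is the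
value of a formula `φ ≤ ψ` or `φ = ψ`, and its complement is the value of the equation between this
formula and `0`. The initial configuration for the input `x` and an arbitrary guess is described by
saying that the cells for the unary code of the length of the guess form a block of ones followed
by zeros, and that the guess vanishes outside of its length. Information moves by at most one cell
per step, so a window that shrinks by one cell at every step suffices, and the guess beyond the
window is irrelevant. The conjunction of these constraints is a product, and a product is nonzero
if and only if all factors are, since `K` has no divisors of zero; this is where positivity is
used. So the conjunction is satisfiable if and only if `M` accepts `x` with some guess
(`exists_holds_tableau`). Its code is produced by nested loops over counters, with the names of the
variables in unary (`emittable_tableau`).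
-/

set_option linter.unusedSectionVars false

namespace CookK

/-! ### Structured programs -/

/-- Structured programs for a machine with one head on a bi-infinite tape. Cells are addressed
relative to the head. `ite` and `loop` look at the branch test on the cells `1` and `2`; `loop b P`
repeats `P` as long as the truth value of the test is `b`. -/
inductive Cmd (K : Type u) : Type u
  | add (i j k : ℤ)
  | mul (i j k : ℤ)
  | const (i : ℤ) (c : K)
  | left
  | right
  | seq (P Q : Cmd K)
  | ite (P Q : Cmd K)
  | loop (b : Bool) (P : Cmd K)

infixr:60 " ;; " => Cmd.seq

section
variable {K : Type u} [Semiring K] (ord : Option (SemiringOrder K))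

/-- `Exec ord P a h a' h' t`: started on the tape `a` with head position `h`, the program `P` ends
after `t` steps on the tape `a'` with head position `h'`. -/
inductive Exec : Cmd K → (ℤ → K) → ℤ → (ℤ → K) → ℤ → ℕ → Prop
  | add (i j k : ℤ) (a : ℤ → K) (h : ℤ) :
      Exec (.add i j k) a h (Function.update a (h + i) (a (h + j) + a (h + k))) h 1
  | mul (i j k : ℤ) (a : ℤ → K) (h : ℤ) :
      Exec (.mul i j k) a h (Function.update a (h + i) (a (h + j) * a (h + k))) h 1
  | const (i : ℤ) (c : K) (a : ℤ → K) (h : ℤ) :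
      Exec (.const i c) a h (Function.update a (h + i) c) h 1
  | left (a : ℤ → K) (h : ℤ) : Exec .left a h a (h - 1) 1
  | right (a : ℤ → K) (h : ℤ) : Exec .right a h a (h + 1) 1
  | seq {P Q : Cmd K} {a a' a'' : ℤ → K} {h h' h'' : ℤ} {t t' : ℕ} :
      Exec P a h a' h' t → Exec Q a' h' a'' h'' t' → Exec (P ;; Q) a h a'' h'' (t + t')
  | ite_true {P Q : Cmd K} {a a' : ℤ → K} {h h' : ℤ} {t : ℕ} :
      BranchTest ord (a (h + 1)) (a (h + 2)) → Exec P a h a' h' t →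
      Exec (.ite P Q) a h a' h' (t + 1)
  | ite_false {P Q : Cmd K} {a a' : ℤ → K} {h h' : ℤ} {t : ℕ} :
      ¬ BranchTest ord (a (h + 1)) (a (h + 2)) → Exec Q a h a' h' t →
      Exec (.ite P Q) a h a' h' (t + 1)
  | loop_done {b : Bool} {P : Cmd K} {a : ℤ → K} {h : ℤ} :
      ¬ (BranchTest ord (a (h + 1)) (a (h + 2)) ↔ b = true) → Exec (.loop b P) a h a h 1
  | loop_step {b : Bool} {P : Cmd K} {a a' a'' : ℤ → K} {h h' h'' : ℤ} {t t' : ℕ} :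
      (BranchTest ord (a (h + 1)) (a (h + 2)) ↔ b = true) → Exec P a h a' h' t →
      Exec (.loop b P) a' h' a'' h'' t' → Exec (.loop b P) a h a'' h'' (t + t' + 1)

end

/-! ### Compiling structured programs to machines -/

namespace Cmd

variable {K : Type u}

/-- The nodes of the flow graph of a program, without an exit node. -/
def Node : Cmd K → Type
  | seq P Q => P.Node ⊕ Q.Node
  | ite P Q => Option (P.Node ⊕ Q.Node)
  | loop _ P => Option P.Node
  | _ => Unit

/-- The node at which a program starts. -/
def entry : (P : Cmd K) → P.Node
  | add _ _ _ => ()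
  | mul _ _ _ => ()
  | const _ _ => ()
  | left => ()
  | right => ()
  | seq P _ => Sum.inl P.entry
  | ite _ _ => (none : Option _)
  | loop _ _ => (none : Option _)

/-- The instructions of the flow graph of a program, embedded by `f` into a larger graph in which
control passes to the node `e` when the program ends. -/
def instr {L : Type} : (P : Cmd K) → (P.Node → L) → L → P.Node → Instr K L
  | add i j k, _, e, _ => .add i j k e
  | mul i j k, _, e, _ => .mul i j k e
  | const i c, _, e, _ => .const i c e
  | left, _, e, _ => .shiftRight e
  | right, _, e, _ => .shiftLeft e
  | seq P Q, f, e, n =>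
      match n with
      | .inl m => P.instr (fun x => f (.inl x)) (f (.inr Q.entry)) m
      | .inr m => Q.instr (fun x => f (.inr x)) e m
  | ite P Q, f, e, n =>
      match n with
      | none => .branch (f (some (.inl P.entry))) (f (some (.inr Q.entry)))
      | some (.inl m) => P.instr (fun x => f (some (.inl x))) e m
      | some (.inr m) => Q.instr (fun x => f (some (.inr x))) e m
  | loop b P, f, e, n =>
      match n with
      | none => .branch (if b then f (some P.entry) else e) (if b then e else f (some P.entry))
      | some m => P.instr (fun x => f (some x)) (f none) m

theorem finite_node : ∀ P : Cmd K, Finite P.Node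
  | add _ _ _ => inferInstanceAs (Finite Unit)
  | mul _ _ _ => inferInstanceAs (Finite Unit)
  | const _ _ => inferInstanceAs (Finite Unit)
  | left => inferInstanceAs (Finite Unit)
  | right => inferInstanceAs (Finite Unit)
  | seq P Q => by
      have := P.finite_node
      have := Q.finite_node
      exact inferInstanceAs (Finite (P.Node ⊕ Q.Node))
  | ite P Q => by
      have := P.finite_node
      have := Q.finite_node
      exact inferInstanceAs (Finite (Option (P.Node ⊕ Q.Node)))
  | loop _ P => by
      have := P.finite_node
      exact inferInstanceAs (Finite (Option P.Node))

theorem instr_ne_input {L : Type} : ∀ (P : Cmd K) (f : P.Node → L) (e : L) (n : P.Node) (q : L),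
    P.instr f e n ≠ .input q := by
  intro P
  induction P with
  | seq P Q hP hQ => rintro f e (m | m) q; exacts [hP _ _ _ _, hQ _ _ _ _]
  | ite P Q hP hQ => rintro f e (_ | m | m) q; exacts [nofun, hP _ _ _ _, hQ _ _ _ _]
  | loop b P hP => rintro f e (_ | m) q; exacts [nofun, hP _ _ _ _]
  | _ => exact fun f e n q => nofun

theorem instr_ne_output {L : Type} : ∀ (P : Cmd K) (f : P.Node → L) (e : L) (n : P.Node),
    P.instr f e n ≠ .output := by
  intro P
  induction P with
  | seq P Q hP hQ => rintro f e (m | m); exacts [hP _ _ _, hQ _ _ _]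
  | ite P Q hP hQ => rintro f e (_ | m | m); exacts [nofun, hP _ _ _, hQ _ _ _]
  | loop b P hP => rintro f e (_ | m); exacts [nofun, hP _ _ _]
  | _ => exact fun f e n => nofun

open Relation in
/-- Every node of a flow graph is connected to the exit node. -/
theorem eqvGen_exit {L : Type} (J : L → Instr K L) : ∀ (P : Cmd K) (f : P.Node → L) (e : L),
    (∀ n, J (f n) = P.instr f e n) →
    ∀ n, EqvGen (fun a b => b ∈ (J a).successors) (f n) e := by
  intro P
  induction P with
  | seq P Q hP hQ =>
    rintro f e hJ
    have h2 : ∀ m, EqvGen (fun a b => b ∈ (J a).successors) (f (.inr m)) e :=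
      hQ (fun x => f (.inr x)) e (fun n => hJ (.inr n))
    rintro (m | m)
    · exact (hP (fun x => f (.inl x)) _ (fun n => hJ (.inl n)) m).trans _ _ _ (h2 _)
    · exact h2 m
  | ite P Q hP hQ =>
    rintro f e hJ
    have h1 := hP (fun x => f (some (.inl x))) e (fun n => hJ (some (.inl n)))
    have h2 := hQ (fun x => f (some (.inr x))) e (fun n => hJ (some (.inr n)))
    rintro (_ | m | m)
    · refine .trans _ _ _ (.rel _ _ ?_) (h1 P.entry)
      have := hJ none
      simp only [instr] at this
      simp [this, Instr.successors]
    · exact h1 m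
    · exact h2 m
  | loop b P hP =>
    rintro f e hJ
    have h0 : EqvGen (fun a b => b ∈ (J a).successors) (f none) e := by
      refine .rel _ _ ?_
      have := hJ none
      simp only [instr] at this
      cases b <;> simp [this, Instr.successors]
    have h1 := hP (fun x => f (some x)) (f none) (fun n => hJ (some n))
    rintro (_ | m)
    · exact h0
    · exact (h1 m).trans _ _ _ h0
  | _ =>
    intro f e hJ n
    refine .rel _ _ ?_
    simp [hJ n, instr, Instr.successors]

/-- The instructions of the machine that runs `P` between its input node `none` and its output
node `some none`. -/
def machineInstr (P : Cmd K) : Option (Option P.Node) → Instr K (Option (Option P.Node))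
  | none => .input (some (some P.entry))
  | some none => .output
  | some (some n) => P.instr (fun x => some (some x)) (some none) n

/-- The machine that runs a structured program. -/
def toMachine (P : Cmd K) : Machine K where
  Node := Option (Option P.Node)
  finite := by
    have := P.finite_node
    infer_instance
  instr := P.machineInstr
  inputNode := none
  outputNode := some none
  input_iff := by
    rintro (_ | _ | n)
    · simp [machineInstr]
    · simp [machineInstr]
    · simp [machineInstr, instr_ne_input]
  output_iff := by
    rintro (_ | _ | n)
    · simp [machineInstr]
    · simp [machineInstr]
    · simp [machineInstr, instr_ne_output]
  connected := by
    have key : ∀ q,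
        Relation.EqvGen (fun a b => b ∈ (P.machineInstr a).successors) q (some none) := by
      have h := eqvGen_exit P.machineInstr P (fun x => some (some x)) (some none) (fun n => rfl)
      rintro (_ | _ | n)
      · exact .trans _ _ _ (.rel _ _ (by simp [machineInstr, Instr.successors])) (h P.entry)
      · exact .refl _
      · exact h n
    exact fun q q' => (key q).trans _ _ _ ((key q').symm _ _)

end Cmd

section
variable {K : Type u} [Semiring K] {ord : Option (SemiringOrder K)}

/-- The state that a machine sees when its head is at position `h` of the tape `a`. -/
def view (a : ℤ → K) (h : ℤ) : State K := fun z => a (h + z)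

theorem view_update (a : ℤ → K) (h i : ℤ) (c : K) :
    view (Function.update a (h + i) c) h = Function.update (view a h) i c := by
  funext z
  simp [view, Function.update_apply]

theorem Exec.iterate_step {M : Machine K} {P : Cmd K} {a a' : ℤ → K} {h h' : ℤ} {t : ℕ}
    (H : Exec ord P a h a' h' t) : ∀ (f : P.Node → M.Node) (e : M.Node),
    (∀ n, M.instr (f n) = P.instr f e n) →
    (M.step ord)^[t] (f P.entry, view a h) = (e, view a' h') := by
  induction H with
  | add i j k a h =>
    intro f e hf
    simp [Machine.step, hf, Cmd.instr, view_update]; rfl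
  | mul i j k a h =>
    intro f e hf
    simp [Machine.step, hf, Cmd.instr, view_update]; rfl
  | const i c a h =>
    intro f e hf
    simp [Machine.step, hf, Cmd.instr, view_update]
  | left a h =>
    intro f e hf
    simp [Machine.step, hf, Cmd.instr]
    funext z; simp only [view]; congr 1; ring
  | right a h =>
    intro f e hf
    simp [Machine.step, hf, Cmd.instr]
    funext z; simp only [view]; congr 1; ring
  | @seq P Q a a' a'' h h' h'' t t' _ _ h1 h2 =>
    intro f e hf
    rw [add_comm t t', Function.iterate_add_apply]
    have e1 := h1 (fun x => f (.inl x)) (f (.inr Q.entry)) (fun n => hf (.inl n))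
    have e2 := h2 (fun x => f (.inr x)) e (fun n => hf (.inr n))
    simp only [Cmd.entry] at e1 e2 ⊢
    rw [e1, e2]
  | @ite_true P Q a a' h h' t hb _ h1 =>
    intro f e hf
    rw [Function.iterate_succ_apply]
    have e1 := h1 (fun x => f (some (.inl x))) e (fun n => hf (some (.inl n)))
    have e0 := hf none
    simp only [Cmd.instr] at e0
    rw [← e1]
    congr 1
    simp only [Cmd.entry, Machine.step, e0]
    simp [view, hb]
  | @ite_false P Q a a' h h' t hb _ h1 =>
    intro f e hf
    rw [Function.iterate_succ_apply]
    have e1 := h1 (fun x => f (some (.inr x))) e (fun n => hf (some (.inr n)))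
    have e0 := hf none
    simp only [Cmd.instr] at e0
    rw [← e1]
    congr 1
    simp only [Cmd.entry, Machine.step, e0]
    simp [view, hb]
  | @loop_done b P a h hb =>
    intro f e hf
    have e0 := hf none
    simp only [Cmd.instr] at e0
    simp only [Function.iterate_one, Cmd.entry, Machine.step, e0]
    cases b <;> simp [view] at hb ⊢ <;> simp [hb]
  | @loop_step b P a a' a'' h h' h'' t t' hb _ _ h1 h2 =>
    intro f e hf
    rw [Function.iterate_succ_apply, add_comm t t', Function.iterate_add_apply]
    have e1 := h1 (fun x => f (some x)) (f none) (fun n => hf (some n))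
    have e2 := h2 f e hf
    have e0 := hf none
    simp only [Cmd.instr] at e0
    rw [← e2]
    congr 1
    change _ = (f none, _)
    rw [← e1]
    congr 1
    simp only [Cmd.entry, Machine.step, e0]
    cases b <;> simp [view] at hb ⊢ <;> simp [hb]

theorem Exec.run_toMachine {P : Cmd K} {a a' : ℤ → K} {h' : ℤ} {t : ℕ}
    (H : Exec ord P a 0 a' h' t) :
    P.toMachine.run ord a (t + 1) = (P.toMachine.outputNode, view a' h') := by
  unfold Machine.run
  rw [Function.iterate_succ_apply]
  have e := H.iterate_step (M := P.toMachine) (fun x => some (some x)) (some none) (fun n => rfl)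
  have hv : view a 0 = a := by funext z; simp [view]
  rw [hv] at e
  rw [show P.toMachine.outputNode = some none from rfl, ← e]
  congr 1

end

theorem Machine.step_output {K : Type u} [Semiring K] {ord : Option (SemiringOrder K)}
    {M : Machine K} {c : M.Node × State K} (hc : c.1 = M.outputNode) : M.step ord c = c := by
  unfold Machine.step
  rw [(M.output_iff c.1).2 hc]

theorem Machine.run_eq_of_halted {K : Type u} [Semiring K] {ord : Option (SemiringOrder K)}
    {M : Machine K} {x : State K} {t t' : ℕ} (ht : (M.run ord x t).1 = M.outputNode)
    (h : t ≤ t') : M.run ord x t' = M.run ord x t := by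
  induction t', h using Nat.le_induction with
  | base => rfl
  | succ k _ ih =>
    rw [← ih] at ht ⊢
    unfold Machine.run at ht ⊢
    rw [Function.iterate_succ_apply', Machine.step_output ht]

/-- The output of a computation does not depend on the time at which it is read. -/
theorem Machine.outputs_iff_of_halted {K : Type u} [Semiring K] {ord : Option (SemiringOrder K)}
    {M : Machine K} {x : State K} {t : ℕ} (ht : (M.run ord x t).1 = M.outputNode) (y : List K) :
    M.Outputs ord x y ↔ ReadsOut (M.run ord x t).2 y := by
  constructor
  · rintro ⟨t', h1, h2⟩
    rcases le_total t t' with h | h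
    · rwa [Machine.run_eq_of_halted ht h] at h2
    · rwa [Machine.run_eq_of_halted h1 h]
  · exact fun h => ⟨t, ht, h⟩

/-! ### Straight-line code and loops -/

section
variable {K : Type u} [Semiring K]

/-- Programs without branches and loops. -/
def Cmd.IsStraight : Cmd K → Prop
  | .seq P Q => P.IsStraight ∧ Q.IsStraight
  | .ite _ _ => False
  | .loop _ _ => False
  | _ => True

/-- The final tape and head position of a program without branches and loops. -/
def Cmd.evalS : Cmd K → (ℤ → K) → ℤ → (ℤ → K) × ℤ
  | .add i j k, a, h => (Function.update a (h + i) (a (h + j) + a (h + k)), h)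
  | .mul i j k, a, h => (Function.update a (h + i) (a (h + j) * a (h + k)), h)
  | .const i c, a, h => (Function.update a (h + i) c, h)
  | .left, a, h => (a, h - 1)
  | .right, a, h => (a, h + 1)
  | .seq P Q, a, h => Q.evalS (P.evalS a h).1 (P.evalS a h).2
  | _, a, h => (a, h)

/-- The number of steps of a program without branches and loops. -/
def Cmd.length : Cmd K → ℕ
  | .seq P Q => P.length + Q.length
  | _ => 1

/-- `Exec` with an upper bound on the number of steps. -/
def Runs (ord : Option (SemiringOrder K)) (P : Cmd K) (a : ℤ → K) (h : ℤ) (a' : ℤ → K) (h' : ℤ)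
    (T : ℕ) : Prop :=
  ∃ t ≤ T, Exec ord P a h a' h' t

variable {ord : Option (SemiringOrder K)} {P Q : Cmd K} {a a' a'' : ℤ → K} {h h' h'' : ℤ}
  {t t' : ℕ}

theorem Runs.mono (H : Runs ord P a h a' h' t) (ht : t ≤ t') : Runs ord P a h a' h' t' :=
  let ⟨s, hs, e⟩ := H; ⟨s, hs.trans ht, e⟩

theorem Runs.seq (H : Runs ord P a h a' h' t) (H' : Runs ord Q a' h' a'' h'' t') :
    Runs ord (P ;; Q) a h a'' h'' (t + t') :=
  let ⟨_, hs, e⟩ := H; let ⟨_, hs', e'⟩ := H'; ⟨_, add_le_add hs hs', e.seq e'⟩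

theorem Runs.seq_inv (H : Runs ord (P ;; Q) a h a'' h'' t) :
    ∃ a' h' s s', s + s' ≤ t ∧ Runs ord P a h a' h' s ∧ Runs ord Q a' h' a'' h'' s' := by
  obtain ⟨s, hs, e⟩ := H
  cases e with
  | seq e1 e2 => exact ⟨_, _, _, _, hs, ⟨_, le_rfl, e1⟩, ⟨_, le_rfl, e2⟩⟩

theorem Runs.ite_true (hb : BranchTest ord (a (h + 1)) (a (h + 2))) (H : Runs ord P a h a' h' t) :
    Runs ord (.ite P Q) a h a' h' (t + 1) :=
  let ⟨_, hs, e⟩ := H; ⟨_, Nat.succ_le_succ hs, .ite_true hb e⟩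

theorem Runs.ite_false (hb : ¬ BranchTest ord (a (h + 1)) (a (h + 2)))
    (H : Runs ord Q a h a' h' t) : Runs ord (.ite P Q) a h a' h' (t + 1) :=
  let ⟨_, hs, e⟩ := H; ⟨_, Nat.succ_le_succ hs, .ite_false hb e⟩

theorem Runs.loop_done {b : Bool} (hb : ¬ (BranchTest ord (a (h + 1)) (a (h + 2)) ↔ b = true)) :
    Runs ord (.loop b P) a h a h 1 :=
  ⟨_, le_rfl, .loop_done hb⟩

theorem Runs.loop_step {b : Bool} (hb : BranchTest ord (a (h + 1)) (a (h + 2)) ↔ b = true)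
    (H : Runs ord P a h a' h' t) (H' : Runs ord (.loop b P) a' h' a'' h'' t') :
    Runs ord (.loop b P) a h a'' h'' (t + t' + 1) :=
  let ⟨_, hs, e⟩ := H; let ⟨_, hs', e'⟩ := H'
  ⟨_, Nat.succ_le_succ (add_le_add hs hs'), .loop_step hb e e'⟩

theorem Runs.loop_seq_done {b : Bool}
    (hb : ¬ (BranchTest ord (a (h + 1)) (a (h + 2)) ↔ b = true))
    (H : Runs ord Q a h a' h' t) : Runs ord (.loop b P ;; Q) a h a' h' (t + 1) :=
  ((Runs.loop_done hb).seq H).mono (by omega)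

theorem Runs.loop_seq_step {b : Bool} (hb : BranchTest ord (a (h + 1)) (a (h + 2)) ↔ b = true)
    (H : Runs ord P a h a' h' t) (H' : Runs ord (.loop b P ;; Q) a' h' a'' h'' t') :
    Runs ord (.loop b P ;; Q) a h a'' h'' (t + t' + 1) := by
  obtain ⟨_, _, _, _, hs, h1, h2⟩ := H'.seq_inv
  exact ((Runs.loop_step hb H h1).seq h2).mono (by omega)

theorem Cmd.IsStraight.exec : ∀ {P : Cmd K}, P.IsStraight → ∀ (a : ℤ → K) (h : ℤ),
    Exec ord P a h (P.evalS a h).1 (P.evalS a h).2 P.length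
  | .add i j k, _, a, h => .add i j k a h
  | .mul i j k, _, a, h => .mul i j k a h
  | .const i c, _, a, h => .const i c a h
  | .left, _, a, h => .left a h
  | .right, _, a, h => .right a h
  | .seq _ _, hs, a, h => (hs.1.exec a h).seq (hs.2.exec _ _)
  | .ite _ _, hs, _, _ => hs.elim
  | .loop _ _, hs, _, _ => hs.elim

theorem Runs.straight (hP : P.IsStraight) (ha : (P.evalS a h).1 = a') (hh : (P.evalS a h).2 = h')
    (ht : P.length ≤ t) : Runs ord P a h a' h' t :=
  ⟨_, ht, by rw [← ha, ← hh]; exact hP.exec a h⟩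

/-- Move the head by `n` cells to the left. -/
def moveLeft : ℕ → Cmd K
  | 0 => .left ;; .right
  | n + 1 => .left ;; moveLeft n

/-- Move the head by `n` cells to the right. -/
def moveRight : ℕ → Cmd K
  | 0 => .left ;; .right
  | n + 1 => .right ;; moveRight n

@[simp] theorem isStraight_moveLeft (n : ℕ) : (moveLeft n : Cmd K).IsStraight := by
  induction n with
  | zero => simp [moveLeft, Cmd.IsStraight]
  | succ n ih => exact ⟨trivial, ih⟩

@[simp] theorem isStraight_moveRight (n : ℕ) : (moveRight n : Cmd K).IsStraight := by
  induction n with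
  | zero => simp [moveRight, Cmd.IsStraight]
  | succ n ih => exact ⟨trivial, ih⟩

@[simp] theorem length_moveLeft (n : ℕ) : (moveLeft n : Cmd K).length = n + 2 := by
  induction n with
  | zero => rfl
  | succ n ih => simp only [moveLeft, Cmd.length, ih]; omega

@[simp] theorem length_moveRight (n : ℕ) : (moveRight n : Cmd K).length = n + 2 := by
  induction n with
  | zero => rfl
  | succ n ih => simp only [moveRight, Cmd.length, ih]; omega

@[simp] theorem evalS_moveLeft (n : ℕ) (a : ℤ → K) (h : ℤ) :
    (moveLeft n : Cmd K).evalS a h = (a, h - n) := by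
  induction n generalizing h with
  | zero => simp [moveLeft, Cmd.evalS]
  | succ n ih => simp only [moveLeft, Cmd.evalS, ih]; congr 1; push_cast; ring

@[simp] theorem evalS_moveRight (n : ℕ) (a : ℤ → K) (h : ℤ) :
    (moveRight n : Cmd K).evalS a h = (a, h + n) := by
  induction n generalizing h with
  | zero => simp [moveRight, Cmd.evalS]
  | succ n ih => simp only [moveRight, Cmd.evalS, ih]; congr 1; push_cast; ring

/-- Copy the cell `j` to the cell `i`, for `i ≠ j`. -/
def copyCell (i j : ℤ) : Cmd K := .const i 0 ;; .add i i j

@[simp] theorem isStraight_copyCell (i j : ℤ) : (copyCell i j : Cmd K).IsStraight :=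
  ⟨trivial, trivial⟩

@[simp] theorem length_copyCell (i j : ℤ) : (copyCell i j : Cmd K).length = 2 := rfl

theorem evalS_copyCell {i j : ℤ} (hij : j ≠ i) (a : ℤ → K) (h : ℤ) :
    (copyCell i j : Cmd K).evalS a h = (Function.update a (h + i) (a (h + j)), h) := by
  simp [copyCell, Cmd.evalS, Function.update_of_ne, hij]

end

section
variable {K : Type u} [Semiring K] [Nontrivial K] (ord : Option (SemiringOrder K))

theorem branchTest_self (c : K) : BranchTest ord c c := by
  cases ord with
  | none => rfl
  | some o => exact o.order.le_refl c

theorem SemiringOrder.zero_le_one (o : SemiringOrder K) : o.Le (0 : K) 1 := by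
  let _ := o.order
  have := o.isOrderedRing
  exact (_root_.zero_le_one : (0 : K) ≤ 1)

theorem SemiringOrder.le_antisymm (o : SemiringOrder K) {a b : K} (h : o.Le a b) (h' : o.Le b a) :
    a = b :=
  o.order.le_antisymm a b h h'

theorem not_branchTest_one_zero : ¬ BranchTest ord (1 : K) 0 := by
  cases ord with
  | none => exact one_ne_zero
  | some o => exact fun h => one_ne_zero (o.le_antisymm h o.zero_le_one)

end

/-! ### Stacks on the tape -/

/-- Names of the stacks. -/
abbrev Reg : Type := Fin 13

/-- The contents of all stacks, each listed from the top. -/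
abbrev Store (K : Type u) : Type u := Reg → List K

/-- The offset within a block of the cell that tells whether the block holds an element of the
stack `r`. -/
def flagCell (r : Reg) : ℤ := 6 + 2 * (r.val : ℤ)

/-- The offset within a block of the cell that holds an element of the stack `r`. -/
def valueCell (r : Reg) : ℤ := 7 + 2 * (r.val : ℤ)

section
variable {K : Type u} [Semiring K]

/-- The stack `r` with contents `l` is stored on the tape `a`, in the blocks of 32 cells that end at
the cell `h + 32` and extend to the left. The flag cell of the block after the last one is `0`; the
contents of all other cells do not matter. -/
def Track (a : ℤ → K) (r : Reg) : ℤ → List K → Prop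
  | h, [] => a (h + flagCell r) = 0
  | h, c :: l => a (h + flagCell r) = 1 ∧ a (h + valueCell r) = c ∧ Track a r (h - 32) l

theorem Track.congr {a a' : ℤ → K} {r : Reg} : ∀ {l : List K} {h : ℤ}, Track a r h l →
    (∀ z ≤ h + 32, (z - h) % 32 = flagCell r ∨ (z - h) % 32 = valueCell r → a' z = a z) →
    Track a' r h l
  | [], h, H, e => by
      have := r.isLt
      simp only [Track, flagCell, valueCell] at *
      rw [e _ (by omega) (by omega), H]
  | c :: l, h, H, e => by
      have hr := r.isLt
      simp only [Track] at *
      refine ⟨?_, ?_, H.2.2.congr fun z hz hz' => e z (by omega) (by omega)⟩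
      · rw [e _ (by simp only [flagCell]; omega) (by simp only [flagCell]; omega), H.1]
      · rw [e _ (by simp only [valueCell]; omega) (by simp only [valueCell]; omega), H.2.1]

/-- The store `σ` is represented on the tape `a` with head position `h`. The cell `3` of the block
at the head is `1`, which serves to find the way back to this block. -/
def Rep (σ : Store K) (a : ℤ → K) (h : ℤ) : Prop :=
  a (h + 3) = 1 ∧ ∀ r, Track a r h (σ r)

/-- Return from the blocks on the left to the block that is marked by `1` in its cell `3`. -/
def goHome : Cmd K :=
  copyCell 1 3 ;; .const 2 0 ;; .loop true (moveRight 32 ;; copyCell 1 3 ;; .const 2 0)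

/-- Push the element in the cell `4` onto the stack `r`, by moving all elements of the stack by one
block. -/
def pushCarry (r : Reg) : Cmd K :=
  (.const 1 1 ;; copyCell 2 (flagCell r)) ;;
  (.loop true ((copyCell 5 (valueCell r) ;; copyCell (valueCell r) 4 ;; copyCell (4 - 32) 5 ;;
      .const (3 - 32) 0 ;; moveLeft 32) ;; .const 1 1 ;; copyCell 2 (flagCell r)) ;;
    copyCell (valueCell r) 4 ;; .const (flagCell r) 1 ;; .const (flagCell r - 32) 0) ;;
  goHome

/-- Pop an element from the nonempty stack `r`, by moving all other elements of the stack by one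
block. -/
def popReg (r : Reg) : Cmd K :=
  (.const 1 1 ;; copyCell 2 (flagCell r - 32)) ;;
  (.loop true ((copyCell (valueCell r) (valueCell r - 32) ;; .const (3 - 32) 0 ;; moveLeft 32) ;;
      .const 1 1 ;; copyCell 2 (flagCell r - 32)) ;;
    .const (flagCell r) 0) ;;
  goHome

end

section
variable {K : Type u} [Semiring K] [Nontrivial K] {ord : Option (SemiringOrder K)}

theorem runs_goHome_loop : ∀ (n : ℕ) (a : ℤ → K) (h : ℤ), a (h + 3) = 1 →
    (∀ b : ℕ, 1 ≤ b → b ≤ n → a (h - 32 * b + 3) = 0) →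
    a (h - 32 * n + 1) = a (h - 32 * n + 3) → a (h - 32 * n + 2) = 0 →
    ∃ a', Runs ord (.loop true (moveRight 32 ;; copyCell 1 3 ;; .const 2 0))
        a (h - 32 * n) a' h (40 * n + 1) ∧
      ∀ z, (z - h) % 32 ≠ 1 → (z - h) % 32 ≠ 2 → a' z = a z := by
  intro n
  induction n with
  | zero =>
    intro a h h3 _ h1 h2
    refine ⟨a, ?_, fun _ _ _ => rfl⟩
    simp only [Nat.cast_zero, mul_zero, sub_zero, zero_add] at *
    refine Runs.loop_done ?_
    rw [h1, h3, h2]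
    simp [not_branchTest_one_zero]
  | succ n ih =>
    intro a h h3 hb h1 h2
    set g := h - 32 * ((n + 1 : ℕ) : ℤ) with hg
    set a1 := Function.update (Function.update a (g + 32 + 1) (a (g + 32 + 3))) (g + 32 + 2) 0
      with ha1
    have hfr : ∀ z, (z - h) % 32 ≠ 1 → (z - h) % 32 ≠ 2 → a1 z = a z := by
      intro z hz1 hz2
      rw [ha1, Function.update_of_ne (by omega), Function.update_of_ne (by omega)]
    have hg' : g + 32 = h - 32 * (n : ℤ) := by push_cast at hg; omega
    obtain ⟨a', hr, hf⟩ := ih a1 h (by rw [hfr _ (by omega) (by omega), h3])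
      (fun b hb1 hb2 => by rw [hfr _ (by omega) (by omega), hb b hb1 (by omega)])
      (by rw [← hg', hfr (g + 32 + 3) (by omega) (by omega), ha1]; simp)
      (by rw [← hg', ha1]; simp)
    refine ⟨a', ?_, fun z hz1 hz2 => by rw [hf z hz1 hz2, hfr z hz1 hz2]⟩
    refine (Runs.loop_step (a' := a1) (h' := g + 32) (t := 37) ?_ ?_ (hg' ▸ hr)).mono (by omega)
    · rw [h1, h2, hb (n + 1) (by omega) le_rfl]
      simp [branchTest_self]
    · refine Runs.straight (by simp [Cmd.IsStraight]) ?_ ?_ (by simp [Cmd.length])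
      · simp [Cmd.evalS, evalS_copyCell, ha1]
      · simp [Cmd.evalS, evalS_copyCell]

theorem runs_goHome {n : ℕ} {a : ℤ → K} {h : ℤ} (h3 : a (h + 3) = 1)
    (hb : ∀ b : ℕ, 1 ≤ b → b ≤ n → a (h - 32 * b + 3) = 0) :
    ∃ a', Runs ord goHome a (h - 32 * n) a' h (40 * n + 4) ∧
      ∀ z, (z - h) % 32 ≠ 1 → (z - h) % 32 ≠ 2 → a' z = a z := by
  set g := h - 32 * (n : ℤ) with hg
  set a1 := Function.update (Function.update a (g + 1) (a (g + 3))) (g + 2) 0 with ha1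
  have hfr : ∀ z, (z - h) % 32 ≠ 1 → (z - h) % 32 ≠ 2 → a1 z = a z := by
    intro z hz1 hz2
    rw [ha1, Function.update_of_ne (by omega), Function.update_of_ne (by omega)]
  obtain ⟨a', hr, hf⟩ := runs_goHome_loop (ord := ord) n a1 h
    (by rw [hfr _ (by omega) (by omega), h3])
    (fun b hb1 hb2 => by rw [hfr _ (by omega) (by omega), hb b hb1 hb2])
    (by rw [← hg, hfr (g + 3) (by omega) (by omega), ha1]; simp)
    (by rw [← hg, ha1]; simp)
  refine ⟨a', ?_, fun z hz1 hz2 => by rw [hf z hz1 hz2, hfr z hz1 hz2]⟩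
  have h1 : Runs ord (copyCell 1 3 ;; .const 2 0) a g a1 g 3 :=
    Runs.straight (by simp [Cmd.IsStraight]) (by simp [Cmd.evalS, evalS_copyCell, ha1])
      (by simp [Cmd.evalS, evalS_copyCell]) (by simp [Cmd.length])
  obtain ⟨_, _, s, s', hs, e1, e2⟩ := h1.seq_inv
  exact (e1.seq (e2.seq hr)).mono (by omega)

theorem runs_pushCarry_loop (r : Reg) : ∀ (l : List K) (a : ℤ → K) (h : ℤ), Track a r h l →
    a (h + 1) = 1 → a (h + 2) = a (h + flagCell r) →
    ∃ a', Runs ord (.loop true ((copyCell 5 (valueCell r) ;; copyCell (valueCell r) 4 ;;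
          copyCell (4 - 32) 5 ;; .const (3 - 32) 0 ;; moveLeft 32) ;;
          .const 1 1 ;; copyCell 2 (flagCell r)) ;;
        copyCell (valueCell r) 4 ;; .const (flagCell r) 1 ;; .const (flagCell r - 32) 0)
        a h a' (h - 32 * l.length) (50 * l.length + 5) ∧
      Track a' r h (a (h + 4) :: l) ∧
      (∀ z, (z - h) % 32 = 0 ∨ 6 ≤ (z - h) % 32 → (z - h) % 32 ≠ flagCell r →
        (z - h) % 32 ≠ valueCell r → a' z = a z) ∧
      (∀ z, h + 32 < z → a' z = a z) ∧
      a' (h + 3) = a (h + 3) ∧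
      ∀ b : ℕ, 1 ≤ b → b ≤ l.length → a' (h - 32 * b + 3) = 0 := by
  have hr := r.isLt
  have hF : flagCell r = 6 + 2 * (r.val : ℤ) := rfl
  have hV : valueCell r = 7 + 2 * (r.val : ℤ) := rfl
  intro l
  induction l with
  | nil =>
    intro a h hT h1 h2
    simp only [Track] at hT
    set a' := Function.update (Function.update (Function.update a (h + valueCell r) (a (h + 4)))
      (h + flagCell r) 1) (h + (flagCell r - 32)) 0 with ha'
    refine ⟨a', ?_, ?_, ?_, ?_, ?_, ?_⟩
    · refine (Runs.loop_seq_done (t := 4) ?_ ?_).mono (by simp)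
      · rw [h1, h2, hT]
        simp [not_branchTest_one_zero]
      · refine Runs.straight (by simp [Cmd.IsStraight]) ?_ ?_ (by simp [Cmd.length])
        all_goals
          simp only [Cmd.evalS]
          rw [evalS_copyCell (by omega)]
        · simp
    · refine ⟨?_, ?_, ?_⟩
      · rw [ha', Function.update_of_ne (by omega), Function.update_self]
      · rw [ha', Function.update_of_ne (by omega), Function.update_of_ne (by omega),
          Function.update_self]
      · change a' (h - 32 + flagCell r) = 0
        rw [ha', show h - 32 + flagCell r = h + (flagCell r - 32) by ring, Function.update_self]
    · intro z hz1 hz2 hz3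
      rw [ha', Function.update_of_ne (by omega), Function.update_of_ne (by omega),
        Function.update_of_ne (by omega)]
    · intro z hz1
      rw [ha', Function.update_of_ne (by omega), Function.update_of_ne (by omega),
        Function.update_of_ne (by omega)]
    · simp only [flagCell, valueCell] at *
      rw [ha', Function.update_of_ne (by omega), Function.update_of_ne (by omega),
        Function.update_of_ne (by omega)]
    · intro b h1 h2
      simp at h2
      omega
  | cons c l ih =>
    intro a h hT h1 h2
    simp only [Track] at hT
    obtain ⟨hT1, hT2, hT3⟩ := hT
    set body : Cmd K := (copyCell 5 (valueCell r) ;; copyCell (valueCell r) 4 ;;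
          copyCell (4 - 32) 5 ;; .const (3 - 32) 0 ;; moveLeft 32) ;;
          .const 1 1 ;; copyCell 2 (flagCell r) with hbody
    have hS : body.IsStraight := by simp [hbody, Cmd.IsStraight]
    have hE : (body.evalS a h).2 = h - 32 := by
      simp only [hbody, Cmd.evalS]
      rw [evalS_copyCell (by omega)]
      simp only
      rw [evalS_copyCell (by omega)]
      simp only
      rw [evalS_copyCell (by omega)]
      simp only [evalS_moveLeft]
      rw [evalS_copyCell (by omega)]
      rfl
    set a1 := (body.evalS a h).1 with ha1
    have hA : ∀ z, a1 z = if z = h - 32 + 2 then a (h - 32 + flagCell r) else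
        if z = h - 32 + 1 then 1 else if z = h - 32 + 3 then 0 else
        if z = h - 32 + 4 then c else if z = h + valueCell r then a (h + 4) else
        if z = h + 5 then c else a z := by
      intro z
      simp only [ha1, hbody, Cmd.evalS]
      rw [evalS_copyCell (by omega)]
      simp only
      rw [evalS_copyCell (by omega)]
      simp only
      rw [evalS_copyCell (by omega)]
      simp only [evalS_moveLeft]
      rw [evalS_copyCell (by omega)]
      simp only [Function.update_apply]
      rw [hT2]
      push_cast
      split_ifs <;> first | rfl | omega
    have hT' : Track a1 r (h - 32) l := hT3.congr fun z hz hz' => by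
      rw [hA]
      rw [if_neg, if_neg, if_neg, if_neg, if_neg, if_neg] <;> omega
    obtain ⟨a', hr', hk1, hk2, hk3, hk4, hk5⟩ := ih a1 (h - 32) hT' (by rw [hA]; simp) (by
      rw [hA, hA]
      rw [if_pos rfl, if_neg (by omega), if_neg (by omega), if_neg (by omega), if_neg (by omega),
        if_neg (by omega), if_neg (by omega)])
    refine ⟨a', ?_, ?_, ?_, ?_, ?_, ?_⟩
    · refine (Runs.loop_seq_step (a' := a1) (h' := h - 32) (t := 49) ?_
        (Runs.straight hS ha1.symm hE ?_) (?_ : Runs ord _ _ _ _ _ (50 * l.length + 5))).mono ?_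
      · rw [h1, h2, hT1]; simp [branchTest_self]
      · simp [hbody, Cmd.length]
      · convert hr' using 1
        simp only [List.length_cons]; push_cast; ring
      · simp only [List.length_cons]; omega
    · simp only [Track] at hk1 ⊢
      have e4 : a1 (h - 32 + 4) = c := by rw [hA]; simp
      refine ⟨?_, ?_, ?_, ?_, hk1.2.2⟩
      · rw [hk3 _ (by omega), hA]
        rw [if_neg, if_neg, if_neg, if_neg, if_neg, if_neg] <;> first | exact hT1 | omega
      · rw [hk3 _ (by omega), hA]
        rw [if_neg, if_neg, if_neg, if_neg, if_pos rfl] <;> omega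
      · exact hk1.1
      · rw [hk1.2.1, e4]
    · intro z hz1 hz2 hz3
      rw [hk2 z (by omega) (by omega) (by omega), hA]
      rw [if_neg, if_neg, if_neg, if_neg, if_neg, if_neg] <;> omega
    · intro z hz
      rw [hk3 z (by omega), hA]
      rw [if_neg, if_neg, if_neg, if_neg, if_neg, if_neg] <;> omega
    · rw [hk3 _ (by omega), hA]
      rw [if_neg, if_neg, if_neg, if_neg, if_neg, if_neg] <;> omega
    · intro b hb1 hb2
      rcases Nat.eq_or_lt_of_le hb1 with rfl | hb
      · push_cast
        rw [hk4, hA, if_neg (by omega), if_neg (by omega), if_pos rfl]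
      · have := hk5 (b - 1) (by omega) (by simp only [List.length_cons] at hb2; omega)
        rw [← this]; congr 1; omega

theorem runs_popReg_loop (r : Reg) : ∀ (l : List K) (c : K) (a : ℤ → K) (h : ℤ),
    Track a r h (c :: l) →
    a (h + 1) = 1 → a (h + 2) = a (h - 32 + flagCell r) →
    ∃ a', Runs ord (.loop true ((copyCell (valueCell r) (valueCell r - 32) ;; .const (3 - 32) 0 ;;
          moveLeft 32) ;; .const 1 1 ;; copyCell 2 (flagCell r - 32)) ;; .const (flagCell r) 0)
        a h a' (h - 32 * l.length) (50 * l.length + 5) ∧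
      Track a' r h l ∧
      (∀ z, (z - h) % 32 = 0 ∨ 6 ≤ (z - h) % 32 → (z - h) % 32 ≠ flagCell r →
        (z - h) % 32 ≠ valueCell r → a' z = a z) ∧
      (∀ z, h + 32 < z → a' z = a z) ∧
      a' (h + 3) = a (h + 3) ∧
      ∀ b : ℕ, 1 ≤ b → b ≤ l.length → a' (h - 32 * b + 3) = 0 := by
  have hr := r.isLt
  have hF : flagCell r = 6 + 2 * (r.val : ℤ) := rfl
  have hV : valueCell r = 7 + 2 * (r.val : ℤ) := rfl
  intro l
  induction l with
  | nil =>
    intro c a h hT h1 h2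
    simp only [Track] at hT
    obtain ⟨hT1, hT2, hT3⟩ := hT
    set a' := Function.update a (h + flagCell r) 0 with ha'
    refine ⟨a', ?_, ?_, ?_, ?_, ?_, ?_⟩
    · refine (Runs.loop_seq_done (t := 1) ?_ ?_).mono (by simp)
      · rw [h1, h2, hT3]
        simp [not_branchTest_one_zero]
      · refine Runs.straight (by simp [Cmd.IsStraight]) ?_ ?_ (by simp [Cmd.length])
        all_goals simp [Cmd.evalS, ha']
    · simp [Track, ha']
    · intro z hz1 hz2 hz3
      rw [ha', Function.update_of_ne (by omega)]
    · intro z hz1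
      rw [ha', Function.update_of_ne (by omega)]
    · simp only [flagCell, valueCell] at *
      rw [ha', Function.update_of_ne (by omega)]
    · intro b h1 h2
      simp at h2
      omega
  | cons d l ih =>
    intro c a h hT h1 h2
    simp only [Track] at hT
    obtain ⟨hT1, hT2, hT3, hT4, hT5⟩ := hT
    set body : Cmd K := (copyCell (valueCell r) (valueCell r - 32) ;; .const (3 - 32) 0 ;;
          moveLeft 32) ;; .const 1 1 ;; copyCell 2 (flagCell r - 32) with hbody
    have hS : body.IsStraight := by simp [hbody, Cmd.IsStraight]
    have hE : (body.evalS a h).2 = h - 32 := by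
      simp only [hbody, Cmd.evalS]
      rw [evalS_copyCell (by omega)]
      simp only [evalS_moveLeft]
      rw [evalS_copyCell (by omega)]
      rfl
    set a1 := (body.evalS a h).1 with ha1
    have hA : ∀ z, a1 z = if z = h - 32 + 2 then a (h - 32 - 32 + flagCell r) else
        if z = h - 32 + 1 then 1 else if z = h - 32 + 3 then 0 else
        if z = h + valueCell r then d else a z := by
      intro z
      simp only [ha1, hbody, Cmd.evalS]
      rw [evalS_copyCell (by omega)]
      simp only [evalS_moveLeft]
      rw [evalS_copyCell (by omega)]
      simp only [Function.update_apply]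
      rw [show h + (valueCell r - 32) = h - 32 + valueCell r by ring, hT4]
      push_cast
      rw [show h - 32 + (flagCell r - 32) = h - 32 - 32 + flagCell r by ring]
      split_ifs <;> first | rfl | omega
    have hT' : Track a1 r (h - 32) (d :: l) := by
      have : Track a r (h - 32) (d :: l) := ⟨hT3, hT4, hT5⟩
      refine this.congr fun z hz hz' => ?_
      rw [hA]
      rw [if_neg, if_neg, if_neg, if_neg] <;> omega
    obtain ⟨a', hr', hk1, hk2, hk3, hk4, hk5⟩ := ih d a1 (h - 32) hT' (by rw [hA]; simp) (by
      rw [hA, hA]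
      rw [if_pos rfl, if_neg (by omega), if_neg (by omega), if_neg (by omega), if_neg (by omega)])
    refine ⟨a', ?_, ?_, ?_, ?_, ?_, ?_⟩
    · refine (Runs.loop_seq_step (a' := a1) (h' := h - 32) (t := 49) ?_
        (Runs.straight hS ha1.symm hE ?_) (?_ : Runs ord _ _ _ _ _ (50 * l.length + 5))).mono ?_
      · rw [h1, h2, hT3]; simp [branchTest_self]
      · simp [hbody, Cmd.length]
      · convert hr' using 1
        simp only [List.length_cons]; push_cast; ring
      · simp only [List.length_cons]; omega
    · simp only [Track]
      refine ⟨?_, ?_, hk1⟩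
      · rw [hk3 _ (by omega), hA]
        rw [if_neg, if_neg, if_neg, if_neg] <;> first | exact hT1 | omega
      · rw [hk3 _ (by omega), hA]
        rw [if_neg, if_neg, if_neg, if_pos rfl] <;> omega
    · intro z hz1 hz2 hz3
      rw [hk2 z (by omega) (by omega) (by omega), hA]
      rw [if_neg, if_neg, if_neg, if_neg] <;> omega
    · intro z hz
      rw [hk3 z (by omega), hA]
      rw [if_neg, if_neg, if_neg, if_neg] <;> omega
    · rw [hk3 _ (by omega), hA]
      rw [if_neg, if_neg, if_neg, if_neg] <;> omega
    · intro b hb1 hb2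
      rcases Nat.eq_or_lt_of_le hb1 with rfl | hb
      · push_cast
        rw [hk4, hA, if_neg (by omega), if_neg (by omega), if_pos rfl]
      · have := hk5 (b - 1) (by omega) (by simp only [List.length_cons] at hb2; omega)
        rw [← this]; congr 1; omega

theorem runs_pushCarry {σ : Store K} {a : ℤ → K} {h : ℤ} (H : Rep σ a h) (r : Reg) :
    ∃ a', Runs ord (pushCarry r) a h a' h (100 * (σ r).length + 20) ∧
      Rep (Function.update σ r (a (h + 4) :: σ r)) a' h := by
  have hrlt := r.isLt
  have hF : flagCell r = 6 + 2 * (r.val : ℤ) := rfl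
  have hV : valueCell r = 7 + 2 * (r.val : ℤ) := rfl
  set a1 := Function.update (Function.update a (h + 1) 1) (h + 2) (a (h + flagCell r)) with ha1
  have hfr : ∀ z, z ≠ h + 1 → z ≠ h + 2 → a1 z = a z := by
    intro z hz1 hz2
    rw [ha1, Function.update_of_ne hz2, Function.update_of_ne hz1]
  have R1 : Runs ord (.const 1 1 ;; copyCell 2 (flagCell r)) a h a1 h 3 := by
    refine Runs.straight (by simp [Cmd.IsStraight]) ?_ ?_ (by simp [Cmd.length]) <;>
      simp only [Cmd.evalS] <;> rw [evalS_copyCell (by omega)]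
    rw [Function.update_of_ne (by omega)]
  obtain ⟨a2, R2, k1, k2, k3, k4, k5⟩ := runs_pushCarry_loop (ord := ord) r (σ r) a1 h
    ((H.2 r).congr fun z _ hz' => hfr z (by omega)
      (by omega))
    (by simp [ha1]) (by
      rw [hfr (h + flagCell r) (by omega) (by omega)]
      simp [ha1])
  obtain ⟨a3, R3, k6⟩ := runs_goHome (ord := ord) (n := (σ r).length) (a := a2) (h := h)
    (by rw [k4, hfr _ (by omega) (by omega), H.1]) k5
  refine ⟨a3, (R1.seq (R2.seq R3)).mono (by omega), ?_, fun r' => ?_⟩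
  · rw [k6 _ (by omega) (by omega), k4, hfr _ (by omega) (by omega), H.1]
  · have hr'lt := r'.isLt
    have hF' : flagCell r' = 6 + 2 * (r'.val : ℤ) := rfl
    have hV' : valueCell r' = 7 + 2 * (r'.val : ℤ) := rfl
    by_cases hrr : r' = r
    · subst hrr
      rw [Function.update_self]
      rw [hfr _ (by omega) (by omega)] at k1
      exact k1.congr fun z _ hz' => k6 z (by omega)
        (by omega)
    · rw [Function.update_of_ne hrr]
      have : r'.val ≠ r.val := fun h => hrr (Fin.ext h)
      refine (H.2 r').congr fun z _ hz' => ?_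
      rw [k6 _ (by omega) (by omega), k2 _ (by omega) (by omega) (by omega),
        hfr _ (by omega) (by omega)]

theorem runs_popReg {σ : Store K} {a : ℤ → K} {h : ℤ} (H : Rep σ a h) {r : Reg} {c : K}
    {l : List K} (hl : σ r = c :: l) :
    ∃ a', Runs ord (popReg r) a h a' h (100 * (σ r).length + 20) ∧
      Rep (Function.update σ r l) a' h := by
  have hrlt := r.isLt
  have hF : flagCell r = 6 + 2 * (r.val : ℤ) := rfl
  have hV : valueCell r = 7 + 2 * (r.val : ℤ) := rfl
  set a1 := Function.update (Function.update a (h + 1) 1) (h + 2) (a (h - 32 + flagCell r)) with ha1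
  have hfr : ∀ z, z ≠ h + 1 → z ≠ h + 2 → a1 z = a z := by
    intro z hz1 hz2
    rw [ha1, Function.update_of_ne hz2, Function.update_of_ne hz1]
  have R1 : Runs ord (.const 1 1 ;; copyCell 2 (flagCell r - 32)) a h a1 h 3 := by
    refine Runs.straight (by simp [Cmd.IsStraight]) ?_ ?_ (by simp [Cmd.length]) <;>
      simp only [Cmd.evalS] <;> rw [evalS_copyCell (by omega)]
    rw [Function.update_of_ne (by omega), ha1,
      show h - 32 + flagCell r = h + (flagCell r - 32) by ring]
  have HT := H.2 r
  rw [hl] at HT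
  obtain ⟨a2, R2, k1, k2, k3, k4, k5⟩ := runs_popReg_loop (ord := ord) r l c a1 h
    (HT.congr fun z _ hz' => hfr z (by omega)
      (by omega))
    (by simp [ha1]) (by
      rw [hfr (h - 32 + flagCell r) (by omega) (by omega)]
      simp [ha1])
  obtain ⟨a3, R3, k6⟩ := runs_goHome (ord := ord) (n := l.length) (a := a2) (h := h)
    (by rw [k4, hfr _ (by omega) (by omega), H.1]) k5
  refine ⟨a3, (R1.seq (R2.seq R3)).mono (by rw [hl, List.length_cons]; omega), ?_, fun r' => ?_⟩
  · rw [k6 _ (by omega) (by omega), k4, hfr _ (by omega) (by omega), H.1]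
  · have hr'lt := r'.isLt
    have hF' : flagCell r' = 6 + 2 * (r'.val : ℤ) := rfl
    have hV' : valueCell r' = 7 + 2 * (r'.val : ℤ) := rfl
    by_cases hrr : r' = r
    · subst hrr
      rw [Function.update_self]
      exact k1.congr fun z _ hz' => k6 z (by omega)
        (by omega)
    · rw [Function.update_of_ne hrr]
      have : r'.val ≠ r.val := fun h => hrr (Fin.ext h)
      refine (H.2 r').congr fun z _ hz' => ?_
      rw [k6 _ (by omega) (by omega), k2 _ (by omega) (by omega) (by omega),
        hfr _ (by omega) (by omega)]

end

/-! ### Programs on stacks -/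

section
variable {K : Type u} [Semiring K]

/-- The program `P` turns the store `σ` into the store `σ'` at the cost `t`. The cost counts
elementary stack operations, so it bounds the growth of all stacks; an elementary operation takes
time linear in the size of the stacks. -/
def Does (ord : Option (SemiringOrder K)) (P : Cmd K) (σ σ' : Store K) (t : ℕ) : Prop :=
  (∀ r, (σ' r).length ≤ (σ r).length + t) ∧
  ∀ N, (∀ r, (σ r).length + t ≤ N) → ∀ a h, Rep σ a h →
    ∃ a', Runs ord P a h a' h (1000 * t * (N + 1)) ∧ Rep σ' a' h

/-- Push the constant `c` onto the stack `r`. -/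
def push (r : Reg) (c : K) : Cmd K := .const 4 c ;; pushCarry r

/-- Push the top of the stack `s` onto the stack `r`. -/
def pushTop (r s : Reg) : Cmd K := copyCell 4 (valueCell s) ;; pushCarry r

/-- Add the top of the stack `s` to the top of the stack `r`. -/
def addTop (r s : Reg) : Cmd K := .add (valueCell r) (valueCell r) (valueCell s)

/-- Multiply the top of the stack `r` by the top of the stack `s`. -/
def mulTop (r s : Reg) : Cmd K := .mul (valueCell r) (valueCell r) (valueCell s)

/-- Prepare the branch test for whether the stack `r` is nonempty. -/
def testNonempty (r : Reg) : Cmd K := .const 1 1 ;; copyCell 2 (flagCell r)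

/-- Do `P` if the stack `r` is empty and `Q` otherwise. -/
def ifEmpty (r : Reg) (P Q : Cmd K) : Cmd K := testNonempty r ;; .ite Q P

/-- Repeat `P` while the stack `r` is nonempty. -/
def whileNonempty (r : Reg) (P : Cmd K) : Cmd K :=
  testNonempty r ;; .loop true (P ;; testNonempty r)

/-- Do `P` if the tops of the stacks `r` and `s` pass the branch test and `Q` otherwise. -/
def ifTest (r s : Reg) (P Q : Cmd K) : Cmd K :=
  (copyCell 1 (valueCell r) ;; copyCell 2 (valueCell s)) ;; .ite P Q

/-- Do `P` if the tops of the stacks `r` and `s` are equal and `Q` otherwise. -/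
def ifEq (r s : Reg) (P Q : Cmd K) : Cmd K := ifTest r s (ifTest s r P Q) Q

/-- Do nothing. -/
def skip : Cmd K := .left ;; .right

theorem Rep.congr {σ : Store K} {a a' : ℤ → K} {h : ℤ} (H : Rep σ a h)
    (e : ∀ z, z ≠ h + 1 → z ≠ h + 2 → z ≠ h + 4 → a' z = a z) : Rep σ a' h := by
  refine ⟨by rw [e _ (by omega) (by omega) (by omega), H.1],
    fun r => (H.2 r).congr fun z _ hz => ?_⟩
  have := r.isLt
  have hF : flagCell r = 6 + 2 * (r.val : ℤ) := rfl
  have hV : valueCell r = 7 + 2 * (r.val : ℤ) := rfl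
  exact e z (by omega) (by omega) (by omega)

theorem Rep.value {σ : Store K} {a : ℤ → K} {h : ℤ} (H : Rep σ a h) {r : Reg} {c : K} {l : List K}
    (hr : σ r = c :: l) : a (h + valueCell r) = c := by
  have := H.2 r
  rw [hr] at this
  exact this.2.1

/-- Overwriting the top of a stack. -/
theorem Rep.update_value {σ : Store K} {a : ℤ → K} {h : ℤ} (H : Rep σ a h) {r : Reg} {c : K}
    {l : List K} (hr : σ r = c :: l) (d : K) :
    Rep (Function.update σ r (d :: l)) (Function.update a (h + valueCell r) d) h := by
  have hlt := r.isLt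
  have hF : flagCell r = 6 + 2 * (r.val : ℤ) := rfl
  have hV : valueCell r = 7 + 2 * (r.val : ℤ) := rfl
  refine ⟨by rw [Function.update_of_ne (by omega), H.1], fun r' => ?_⟩
  have hlt' := r'.isLt
  have hF' : flagCell r' = 6 + 2 * (r'.val : ℤ) := rfl
  have hV' : valueCell r' = 7 + 2 * (r'.val : ℤ) := rfl
  by_cases hrr : r' = r
  · subst hrr
    have := H.2 r'
    rw [hr] at this
    rw [Function.update_self]
    refine ⟨by rw [Function.update_of_ne (by omega), this.1], Function.update_self _ _ _,
      this.2.2.congr fun z hz hz' => Function.update_of_ne (by omega) _ _⟩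
  · have : r'.val ≠ r.val := fun h => hrr (Fin.ext h)
    rw [Function.update_of_ne hrr]
    exact (H.2 r').congr fun z _ hz' => Function.update_of_ne (by omega) _ _

variable {ord : Option (SemiringOrder K)} {P Q : Cmd K} {σ σ' σ'' : Store K} {t t' : ℕ}

theorem Does.mono (H : Does ord P σ σ' t) (ht : t ≤ t') : Does ord P σ σ' t' := by
  refine ⟨fun r => (H.1 r).trans (by omega), fun N hN a h hR => ?_⟩
  obtain ⟨a', h1, h2⟩ := H.2 N (fun r => (by have := hN r; omega)) a h hR
  exact ⟨a', h1.mono (by gcongr), h2⟩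

theorem Does.seq (H : Does ord P σ σ' t) (H' : Does ord Q σ' σ'' t') :
    Does ord (P ;; Q) σ σ'' (t + t') := by
  refine ⟨fun r => (H'.1 r).trans (by have := H.1 r; omega), fun N hN a h hR => ?_⟩
  obtain ⟨a', h1, h2⟩ := H.2 N (fun r => (by have := hN r; omega)) a h hR
  obtain ⟨a'', h3, h4⟩ := H'.2 N (fun r => (by have := hN r; have := H.1 r; omega)) a' h h2
  exact ⟨a'', (h1.seq h3).mono (by ring_nf; rfl), h4⟩

theorem Does.congr (H : Does ord P σ σ' t) (e : σ' = σ'') : Does ord P σ σ'' t := e ▸ H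

theorem does_skip (σ : Store K) : Does ord skip σ σ 1 := by
  refine ⟨fun r => by omega, fun N hN a h hR => ⟨a, ?_, hR⟩⟩
  exact Runs.straight (by simp [skip, Cmd.IsStraight]) (by simp [skip, Cmd.evalS])
    (by simp [skip, Cmd.evalS]) (by simp [skip, Cmd.length]; omega)

theorem does_addTop {r s : Reg} {c d : K} {l m : List K} (hr : σ r = c :: l) (hs : σ s = d :: m) :
    Does ord (addTop r s) σ (Function.update σ r ((c + d) :: l)) 1 := by
  refine ⟨fun r' => ?_, fun N hN a h hR => ⟨_, ?_, hR.update_value hr _⟩⟩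
  · by_cases h : r' = r
    · subst h; simp [hr]
    · simp [Function.update_of_ne h]
  · refine Runs.straight (by simp [addTop, Cmd.IsStraight]) ?_
      (by simp [addTop, Cmd.evalS]) (by simp [addTop, Cmd.length]; omega)
    simp [addTop, Cmd.evalS, hR.value hr, hR.value hs]

theorem does_mulTop {r s : Reg} {c d : K} {l m : List K} (hr : σ r = c :: l) (hs : σ s = d :: m) :
    Does ord (mulTop r s) σ (Function.update σ r ((c * d) :: l)) 1 := by
  refine ⟨fun r' => ?_, fun N hN a h hR => ⟨_, ?_, hR.update_value hr _⟩⟩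
  · by_cases h : r' = r
    · subst h; simp [hr]
    · simp [Function.update_of_ne h]
  · refine Runs.straight (by simp [mulTop, Cmd.IsStraight]) ?_
      (by simp [mulTop, Cmd.evalS]) (by simp [mulTop, Cmd.length]; omega)
    simp [mulTop, Cmd.evalS, hR.value hr, hR.value hs]

end

section
variable {K : Type u} [Semiring K] [Nontrivial K] {ord : Option (SemiringOrder K)} {P Q : Cmd K}
  {σ σ' σ'' : Store K} {t t' : ℕ}

theorem Does.of_pushCarry {r : Reg} {c : K} {P : Cmd K} (hP : P.IsStraight) (hl : P.length ≤ 2)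
    (he : ∀ a h, Rep σ a h → P.evalS a h = (Function.update a (h + 4) c, h)) :
    Does ord (P ;; pushCarry r) σ (Function.update σ r (c :: σ r)) 1 := by
  refine ⟨fun r' => ?_, fun N hN a h hR => ?_⟩
  · by_cases h : r' = r
    · subst h; simp
    · simp [Function.update_of_ne h]
  · have hR' : Rep σ (Function.update a (h + 4) c) h :=
      hR.congr fun z _ _ h4 => Function.update_of_ne h4 _ _
    obtain ⟨a', h1, h2⟩ := runs_pushCarry (ord := ord) hR' r
    rw [Function.update_self] at h2
    have h0 : Runs ord P a h (Function.update a (h + 4) c) h 2 :=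
      Runs.straight hP (by rw [he a h hR]) (by rw [he a h hR]) hl
    exact ⟨a', (h0.seq h1).mono (by have := hN r; omega), h2⟩

theorem does_push (σ : Store K) (r : Reg) (c : K) :
    Does ord (push r c) σ (Function.update σ r (c :: σ r)) 1 :=
  Does.of_pushCarry trivial (by simp [Cmd.length]) fun _ _ _ => rfl

theorem does_pushTop (r : Reg) {s : Reg} {c : K} {l : List K} (hs : σ s = c :: l) :
    Does ord (pushTop r s) σ (Function.update σ r (c :: σ r)) 1 := by
  refine Does.of_pushCarry (by simp) (by simp) fun a h hR => ?_
  have hV : valueCell s = 7 + 2 * (s.val : ℤ) := rfl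
  rw [evalS_copyCell (by omega), hR.value hs]

theorem does_popReg {r : Reg} {c : K} {l : List K} (hr : σ r = c :: l) :
    Does ord (popReg r) σ (Function.update σ r l) 1 := by
  refine ⟨fun r' => ?_, fun N hN a h hR => ?_⟩
  · by_cases h : r' = r
    · subst h; simp [hr]; omega
    · simp [Function.update_of_ne h]
  · obtain ⟨a', h1, h2⟩ := runs_popReg (ord := ord) hR hr
    exact ⟨a', h1.mono (by have := hN r; omega), h2⟩

theorem runs_testNonempty {a : ℤ → K} {h : ℤ} (H : Rep σ a h) (r : Reg) :
    ∃ a', Runs ord (testNonempty r) a h a' h 3 ∧ Rep σ a' h ∧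
      (BranchTest ord (a' (h + 1)) (a' (h + 2)) ↔ σ r ≠ []) := by
  have hlt := r.isLt
  have hF : flagCell r = 6 + 2 * (r.val : ℤ) := rfl
  refine ⟨Function.update (Function.update a (h + 1) 1) (h + 2) (a (h + flagCell r)), ?_, ?_, ?_⟩
  · refine Runs.straight (by simp [testNonempty, Cmd.IsStraight]) ?_ ?_
      (by simp [testNonempty, Cmd.length]) <;>
    simp only [testNonempty, Cmd.evalS] <;> rw [evalS_copyCell (by omega)]
    rw [Function.update_of_ne (by omega)]
  · exact H.congr fun z h1 h2 _ => by rw [Function.update_of_ne h2, Function.update_of_ne h1]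
  · have hT := H.2 r
    rw [Function.update_self, Function.update_of_ne (by omega), Function.update_self]
    cases hs : σ r with
    | nil =>
      rw [hs] at hT
      rw [show a (h + flagCell r) = 0 from hT]
      simp [not_branchTest_one_zero]
    | cons c l =>
      rw [hs] at hT
      rw [hT.1]
      simp [branchTest_self]

theorem does_ifEmpty_pos {r : Reg} (hr : σ r = []) (H : Does ord P σ σ' t) :
    Does ord (ifEmpty r P Q) σ σ' (t + 1) := by
  refine ⟨fun r => (H.1 r).trans (by omega), fun N hN a h hR => ?_⟩
  obtain ⟨a1, h1, h2, h3⟩ := runs_testNonempty (ord := ord) hR r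
  obtain ⟨a2, h4, h5⟩ := H.2 N (fun r => (by have := hN r; omega)) a1 h h2
  exact ⟨a2, (h1.seq (h4.ite_false (by simp [h3, hr]))).mono (by ring_nf; omega), h5⟩

theorem does_ifEmpty_neg {r : Reg} (hr : σ r ≠ []) (H : Does ord Q σ σ' t) :
    Does ord (ifEmpty r P Q) σ σ' (t + 1) := by
  refine ⟨fun r => (H.1 r).trans (by omega), fun N hN a h hR => ?_⟩
  obtain ⟨a1, h1, h2, h3⟩ := runs_testNonempty (ord := ord) hR r
  obtain ⟨a2, h4, h5⟩ := H.2 N (fun r => (by have := hN r; omega)) a1 h h2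
  exact ⟨a2, (h1.seq (h4.ite_true (by simp [h3, hr]))).mono (by ring_nf; omega), h5⟩

theorem does_whileNonempty_nil {r : Reg} (hr : σ r = []) :
    Does ord (whileNonempty r P) σ σ 1 := by
  refine ⟨fun r => by omega, fun N hN a h hR => ?_⟩
  obtain ⟨a1, h1, h2, h3⟩ := runs_testNonempty (ord := ord) hR r
  exact ⟨a1, (h1.seq (Runs.loop_done (by simp [h3, hr]))).mono (by omega), h2⟩

theorem does_whileNonempty_cons {r : Reg} (hr : σ r ≠ []) (H : Does ord P σ σ' t)
    (H' : Does ord (whileNonempty r P) σ' σ'' t') :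
    Does ord (whileNonempty r P) σ σ'' (t + t' + 1) := by
  refine ⟨fun r => (H'.1 r).trans (by have := H.1 r; omega), fun N hN a h hR => ?_⟩
  obtain ⟨a1, h1, h2, h3⟩ := runs_testNonempty (ord := ord) hR r
  obtain ⟨a2, h4, h5⟩ := H.2 N (fun r => (by have := hN r; omega)) a1 h h2
  obtain ⟨a3, h6, h7⟩ := H'.2 N (fun r => (by have := hN r; have := H.1 r; omega)) a2 h h5
  obtain ⟨b, g, s, s', hs, e1, e2⟩ := h6.seq_inv
  refine ⟨a3, (h1.seq (Runs.loop_step (by simp [h3, hr]) (h4.seq e1) e2)).mono ?_, h7⟩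
  ring_nf at hs ⊢
  omega

theorem runs_copyTops {a : ℤ → K} {h : ℤ} (H : Rep σ a h) {r s : Reg} {c d : K} {l m : List K}
    (hr : σ r = c :: l) (hs : σ s = d :: m) :
    ∃ a', Runs ord (copyCell 1 (valueCell r) ;; copyCell 2 (valueCell s)) a h a' h 4 ∧ Rep σ a' h ∧
      a' (h + 1) = c ∧ a' (h + 2) = d := by
  have hV : valueCell r = 7 + 2 * (r.val : ℤ) := rfl
  have hV' : valueCell s = 7 + 2 * (s.val : ℤ) := rfl
  refine ⟨Function.update (Function.update a (h + 1) c) (h + 2) d, ?_, ?_, ?_, ?_⟩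
  · refine Runs.straight (by simp [Cmd.IsStraight]) ?_ ?_
      (by simp [Cmd.length]) <;>
    simp only [Cmd.evalS] <;> rw [evalS_copyCell (by omega), evalS_copyCell (by omega)]
    simp only
    rw [Function.update_of_ne (by omega), H.value hr, H.value hs]
  · exact H.congr fun z h1 h2 _ => by rw [Function.update_of_ne h2, Function.update_of_ne h1]
  · rw [Function.update_of_ne (by omega), Function.update_self]
  · rw [Function.update_self]

theorem does_ifTest_pos {r s : Reg} {c d : K} {l m : List K} (hr : σ r = c :: l)
    (hs : σ s = d :: m) (hb : BranchTest ord c d) (H : Does ord P σ σ' t) :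
    Does ord (ifTest r s P Q) σ σ' (t + 1) := by
  refine ⟨fun r => (H.1 r).trans (by omega), fun N hN a h hR => ?_⟩
  obtain ⟨a1, h1, h2, h3, h3'⟩ := runs_copyTops (ord := ord) hR hr hs
  obtain ⟨a2, h4, h5⟩ := H.2 N (fun r => (by have := hN r; omega)) a1 h h2
  exact ⟨a2, (h1.seq (h4.ite_true (by rwa [h3, h3']))).mono (by ring_nf; omega), h5⟩

theorem does_ifTest_neg {r s : Reg} {c d : K} {l m : List K} (hr : σ r = c :: l)
    (hs : σ s = d :: m) (hb : ¬ BranchTest ord c d) (H : Does ord Q σ σ' t) :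
    Does ord (ifTest r s P Q) σ σ' (t + 1) := by
  refine ⟨fun r => (H.1 r).trans (by omega), fun N hN a h hR => ?_⟩
  obtain ⟨a1, h1, h2, h3, h3'⟩ := runs_copyTops (ord := ord) hR hr hs
  obtain ⟨a2, h4, h5⟩ := H.2 N (fun r => (by have := hN r; omega)) a1 h h2
  exact ⟨a2, (h1.seq (h4.ite_false (by rwa [h3, h3']))).mono (by ring_nf; omega), h5⟩

theorem does_ifEq_pos {r s : Reg} {c : K} {l m : List K} (hr : σ r = c :: l)
    (hs : σ s = c :: m) (H : Does ord P σ σ' t) : Does ord (ifEq r s P Q) σ σ' (t + 2) :=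
  does_ifTest_pos hr hs (branchTest_self ord c) (does_ifTest_pos hs hr (branchTest_self ord c) H)

theorem does_ifEq_neg {r s : Reg} {c d : K} {l m : List K} (hr : σ r = c :: l)
    (hs : σ s = d :: m) (hcd : c ≠ d) (H : Does ord Q σ σ' t) :
    Does ord (ifEq r s P Q) σ σ' (t + 2) := by
  by_cases h : BranchTest ord c d
  · refine does_ifTest_pos hr hs h (does_ifTest_neg hs hr (fun h' => hcd ?_) H)
    cases ord with
    | none => exact h
    | some o => exact o.le_antisymm h h'
  · exact (does_ifTest_neg hr hs h H).mono (by omega)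

end

/-! ### Loading the input -/

section
variable {K : Type u} [Semiring K]

/-- Write `c` into the `n` cells `i, i + 1, …`. -/
def fill (i : ℤ) (c : K) : ℕ → Cmd K
  | 0 => skip
  | n + 1 => .const (i + n) c ;; fill i c n

@[simp] theorem isStraight_fill (i : ℤ) (c : K) (n : ℕ) : (fill i c n).IsStraight := by
  induction n with
  | zero => exact ⟨trivial, trivial⟩
  | succ n ih => exact ⟨trivial, ih⟩

@[simp] theorem length_fill (i : ℤ) (c : K) (n : ℕ) : (fill i c n).length = n + 2 := by
  induction n with
  | zero => rfl
  | succ n ih => simp only [fill, Cmd.length, ih]; omega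

theorem evalS_fill (i : ℤ) (c : K) (n : ℕ) (a : ℤ → K) (h : ℤ) :
    (fill i c n).evalS a h = (fun z => if h + i ≤ z ∧ z < h + i + n then c else a z, h) := by
  induction n generalizing a with
  | zero =>
    simp only [fill, skip, Cmd.evalS, sub_add_cancel, Prod.mk.injEq, and_true]
    funext z
    rw [if_neg]
    omega
  | succ n ih =>
    simp only [fill, Cmd.evalS, ih, Prod.mk.injEq, and_true]
    funext z
    simp only [Function.update_apply]
    push_cast
    split_ifs <;> first | rfl | omega

/-- Move to the right through a run of ones, until the cell `1` is the last one of the run. -/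
def walkRight : Cmd K := .loop true .right

/-- Let a zero in the cell `2` travel to the left through a run of ones. -/
def zeroLeft : Cmd K := .loop false (.const 1 0 ;; .const 2 1 ;; .left)

/-- Let the element in the cell `0` travel to the left through a run of ones. The cells `1` and `2`
have to be ones, too. -/
def bubbleLeft : Cmd K :=
  copyCell 2 (-1) ;;
  .loop true (.const 2 1 ;; copyCell (-1) 0 ;; .const 0 1 ;; .left ;; copyCell 2 (-1)) ;;
  .const 2 1

/-- Starting from the run of ones that gives the length `n` of the input, produce a run of
`62 * n + 3` ones. The run is turned over one by one from the right to the left of a separator of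
three zeros, and every time 61 further ones are added at its left end. The 33 cells to the left of
the run are kept zero. -/
def multiplyOnes : Cmd K :=
  moveLeft 2 ;;
  .ite
    (fill (-34) 0 33 ;; fill (-1) 1 3 ;; .left)
    ((.const 1 0 ;; .left) ;; zeroLeft ;;
      (fill (-95) 0 33 ;; fill (-62) 1 62 ;; fill 0 0 3 ;; .const 1 1 ;; copyCell 2 3) ;;
      .loop true
        ((.const 0 1 ;; fill 1 0 3 ;; .left) ;; zeroLeft ;;
          (fill (-59) 1 62 ;; fill (-92) 0 33) ;; walkRight ;;
          (.const 1 0 ;; .right ;; .const 1 1 ;; copyCell 2 3)) ;;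
      fill 0 1 3)

/-- Move the input symbols into blocks of 32 cells. Every symbol travels to the left end of the run
of ones, 31 of which give the space for its block. -/
def makeBlocks : Cmd K :=
  copyCell 2 (-1) ;;
  .loop true
    ((.const 2 1 ;; copyCell 0 4 ;; .const 3 1 ;; .const 4 0) ;; bubbleLeft ;;
      (.const 4 1 ;; copyCell 5 0 ;; fill 6 0 26 ;; moveRight 31) ;; walkRight ;;
      (.left ;; copyCell 2 (-1))) ;;
  (.const 2 1 ;; moveLeft 34 ;; .const 3 1)

/-- Load the input of length `n` and the first `n` elements of the guess onto the stack `0`. -/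
def loadInput : Cmd K := multiplyOnes ;; makeBlocks

end

section
variable {K : Type u} [Semiring K] [Nontrivial K] {ord : Option (SemiringOrder K)}

theorem runs_walkRight : ∀ (k : ℕ) (a : ℤ → K) (h : ℤ),
    (∀ z, h < z → z ≤ h + k + 1 → a z = 1) → a (h + k + 2) = 0 →
    Runs ord walkRight a h a (h + k) (2 * k + 1) := by
  intro k
  induction k with
  | zero =>
    intro a h h1 h2
    simp only [Nat.cast_zero, add_zero] at *
    refine Runs.loop_done ?_
    rw [h1 _ (by omega) (by omega), h2]
    simp [not_branchTest_one_zero]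
  | succ k ih =>
    intro a h h1 h2
    push_cast at *
    have := ih a (h + 1) (fun z hz hz' => h1 z (by omega) (by omega)) (by rw [← h2]; congr 1; ring)
    rw [show h + 1 + k = h + (k + 1 : ℤ) by ring] at this
    refine (Runs.loop_step (a' := a) (h' := h + 1) (t := 1) ?_ ⟨1, le_rfl, .right a h⟩ this).mono
      (by omega)
    rw [h1 _ (by omega) (by omega), h1 _ (by omega) (by omega)]
    simp [branchTest_self]

theorem runs_zeroLeft : ∀ (k : ℕ) (a : ℤ → K) (h : ℤ),
    (∀ z, h + 1 - k < z → z ≤ h + 1 → a z = 1) → a (h + 1 - k) = 0 → a (h + 2) = 0 →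
    Runs ord zeroLeft a h
      (fun z => if z = h + 2 - k then 0 else if h + 2 - k < z ∧ z ≤ h + 2 then 1 else a z)
      (h - k) (4 * k + 1) := by
  intro k
  induction k with
  | zero =>
    intro a h _ h1 h2
    simp only [Nat.cast_zero, sub_zero] at *
    have : (fun z => if z = h + 2 then 0 else if h + 2 < z ∧ z ≤ h + 2 then 1 else a z) = a := by
      funext z
      split_ifs with h3 h4
      · rw [h3, h2]
      · omega
      · rfl
    rw [this]
    refine Runs.loop_done ?_
    rw [h1, h2]
    simp [branchTest_self]
  | succ k ih =>
    intro a h h1 h2 h3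
    push_cast at *
    set a1 := Function.update (Function.update a (h + 1) 0) (h + 2) 1 with ha1
    have hA : ∀ z, a1 z = if z = h + 2 then 1 else if z = h + 1 then 0 else a z := by
      intro z; simp only [ha1, Function.update_apply]
    have := ih a1 (h - 1)
      (fun z hz hz' => by rw [hA, if_neg (by omega), if_neg (by omega), h1 z (by omega) (by omega)])
      (by rw [hA, if_neg (by omega), if_neg (by omega), ← h2]; congr 1; ring)
      (by rw [hA, if_neg (by omega), if_pos (by omega)])
    refine (Runs.loop_step (a' := a1) (h' := h - 1) (t := 3) ?_ ?_
      (?_ : Runs ord zeroLeft _ _ _ _ (4 * k + 1))).mono (by omega)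
    · rw [h1 _ (by omega) (by omega), h3]
      simp [not_branchTest_one_zero]
    · exact Runs.straight (by simp [Cmd.IsStraight]) rfl rfl (by simp [Cmd.length])
    · convert this using 1
      · funext z
        rw [hA]
        split_ifs <;> first | rfl | omega
      · ring

theorem runs_bubbleLeft_loop : ∀ (k : ℕ) (a : ℤ → K) (h : ℤ),
    (∀ z, h - k ≤ z → z < h → a z = 1) → a (h - k - 1) = 0 → a (h + 1) = 1 →
    a (h + 2) = a (h - 1) →
    Runs ord
      (.loop true (.const 2 1 ;; copyCell (-1) 0 ;; .const 0 1 ;; .left ;; copyCell 2 (-1)) ;;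
        .const 2 1) a h
      (fun z => if z = h - k then a h else if h - k < z ∧ z ≤ h + 2 then 1 else a z)
      (h - k) (10 * k + 2) := by
  intro k
  induction k with
  | zero =>
    intro a h _ h1 h2 h3
    simp only [Nat.cast_zero, sub_zero] at *
    refine (Runs.loop_seq_done (t := 1) ?_ ?_).mono (by omega)
    · rw [h3, h2, h1]
      simp [not_branchTest_one_zero]
    · refine Runs.straight trivial (funext fun z => ?_) rfl (by simp [Cmd.length])
      simp only [Cmd.evalS, Function.update_apply]
      split_ifs <;> first | rfl | omega | rw [‹z = h›] | rw [show z = h + 1 by omega, h2]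
  | succ k ih =>
    intro a h h1 h2 h3 h4
    push_cast at *
    set body : Cmd K := .const 2 1 ;; copyCell (-1) 0 ;; .const 0 1 ;; .left ;; copyCell 2 (-1)
      with hb
    set a1 := (body.evalS a h).1 with ha1
    have hA : ∀ z, a1 z = if z = h + 1 then a (h - 2) else if z = h then 1 else
        if z = h - 1 then a h else if z = h + 2 then 1 else a z := by
      intro z
      simp only [ha1, hb, Cmd.evalS]
      rw [evalS_copyCell (by omega)]
      simp only
      rw [evalS_copyCell (by omega)]
      simp only [Function.update_apply]
      rw [show h - 1 + -1 = h - 2 by ring]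
      split_ifs <;> first | rfl | omega | simp
    have hE : (body.evalS a h).2 = h - 1 := by
      simp only [hb, Cmd.evalS]
      rw [evalS_copyCell (by omega)]
      simp only
      rw [evalS_copyCell (by omega)]
    have := ih a1 (h - 1)
      (fun z hz hz' => by
        rw [hA, if_neg (by omega), if_neg (by omega), if_neg (by omega), if_neg (by omega),
          h1 z (by omega) (by omega)])
      (by rw [hA, if_neg (by omega), if_neg (by omega), if_neg (by omega), if_neg (by omega), ← h2]
          congr 1; ring)
      (by rw [hA, if_neg (by omega), if_pos (by omega)])
      (by rw [hA, if_pos (by omega), hA, if_neg (by omega), if_neg (by omega), if_neg (by omega),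
            if_neg (by omega)]; congr 1; ring)
    refine (Runs.loop_seq_step (a' := a1) (h' := h - 1) (t := 8) ?_ ?_
      (?_ : Runs ord _ _ _ _ _ (10 * k + 2))).mono (by omega)
    · rw [h4, h3, h1 _ (by omega) (by omega)]
      simp [branchTest_self]
    · exact Runs.straight (by simp [hb, Cmd.IsStraight]) rfl hE (by simp [hb, Cmd.length])
    · convert this using 1
      · funext z
        rw [hA, hA]
        split_ifs <;> first | rfl | omega
      · ring

theorem runs_bubbleLeft (k : ℕ) (a : ℤ → K) (h : ℤ)
    (h1 : ∀ z, h - k ≤ z → z < h → a z = 1) (h2 : a (h - k - 1) = 0) (h3 : a (h + 1) = 1) :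
    Runs ord bubbleLeft a h
      (fun z => if z = h - k then a h else if h - k < z ∧ z ≤ h + 2 then 1 else a z)
      (h - k) (10 * k + 4) := by
  set a1 := Function.update a (h + 2) (a (h - 1)) with ha1
  have hA : ∀ z, a1 z = if z = h + 2 then a (h - 1) else a z := by
    intro z; simp only [ha1, Function.update_apply]
  have R1 : Runs ord (copyCell 2 (-1)) a h a1 h 2 := by
    refine Runs.straight (by simp) ?_ ?_ (by simp) <;> rw [evalS_copyCell (by omega)]
    rfl
  have R2 := runs_bubbleLeft_loop (ord := ord) k a1 h
    (fun z hz hz' => by rw [hA, if_neg (by omega), h1 z hz hz'])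
    (by rw [hA, if_neg (by omega), h2]) (by rw [hA, if_neg (by omega), h3])
    (by rw [hA, if_pos rfl, hA, if_neg (by omega)])
  have H : Runs ord bubbleLeft a h _ _ (10 * k + 4) := (R1.seq R2).mono (by omega)
  convert H using 1
  funext z
  rw [hA, hA]
  split_ifs <;> first | rfl | omega

theorem runs_multiplyOnes_loop : ∀ (b α : ℕ) (a : ℤ → K) (g : ℤ), g = -3 - b →
    (∀ z, g - α - 33 ≤ z → z < g - α → a z = 0) → (∀ z, g - α ≤ z → z < g → a z = 1) →
    a g = 0 → a (g + 1) = 1 → a (g + 2) = a (g + 3) →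
    (∀ z, g + 3 ≤ z → z < 0 → a z = 1) → a 0 = 0 →
    ∃ a', Runs ord (.loop true
        ((.const 0 1 ;; fill 1 0 3 ;; .left) ;; zeroLeft ;;
          (fill (-59) 1 62 ;; fill (-92) 0 33) ;; walkRight ;;
          (.const 1 0 ;; .right ;; .const 1 1 ;; copyCell 2 3)) ;;
      fill 0 1 3) a g a' (-3) (b * (6 * α + 372 * b + 300) + 10) ∧
      (∀ z, -3 - (α + 62 * b : ℤ) - 33 ≤ z → z < -3 - (α + 62 * b : ℤ) → a' z = 0) ∧
      (∀ z, -3 - (α + 62 * b : ℤ) ≤ z → z < 0 → a' z = 1) ∧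
      (∀ z, 0 ≤ z → a' z = a z) := by
  intro b
  induction b with
  | zero =>
    intro α a g hg h1 h2 h3 h4 h5 h6 h7
    simp only [Nat.cast_zero, sub_zero, mul_zero, add_zero] at *
    subst hg
    have hA : ∀ z, ((fill 0 1 3 : Cmd K).evalS a (-3)).1 z =
        if -3 ≤ z ∧ z < 0 then 1 else a z := by
      intro z
      rw [evalS_fill]
      norm_num
    refine ⟨_, Runs.loop_seq_done (t := 9) ?_ (Runs.straight (by simp) rfl (by rw [evalS_fill])
      (by simp)) |>.mono (by omega), ?_, ?_, ?_⟩
    · rw [h4, h5]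
      norm_num
      rw [h7]
      exact not_branchTest_one_zero _
    · intro z hz hz'
      rw [hA, if_neg (by omega), h1 z (by omega) (by omega)]
    · intro z hz hz'
      rw [hA]
      split_ifs with h
      · rfl
      · exact h2 z (by omega) (by omega)
    · intro z hz
      rw [hA, if_neg (by omega)]
  | succ b ih =>
    intro α a g hg h1 h2 h3 h4 h5 h6 h7
    push_cast at *
    -- turn over one element of the run on the right
    set s1 : Cmd K := .const 0 1 ;; fill 1 0 3 ;; .left with hs1
    have R1 : Runs ord s1 a g (s1.evalS a g).1 (g - 1) 8 :=
      Runs.straight (by simp [hs1, Cmd.IsStraight]) rfl (by simp [hs1, Cmd.evalS, evalS_fill])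
        (by simp [hs1, Cmd.length])
    have hA1 : ∀ z, (s1.evalS a g).1 z = if g + 1 ≤ z ∧ z < g + 4 then 0 else
        if z = g then 1 else a z := by
      intro z
      simp only [hs1, Cmd.evalS, evalS_fill, Function.update_apply]
      split_ifs <;> first | rfl | omega
    generalize (s1.evalS a g).1 = a1 at R1 hA1
    -- let the first of the separating zeros travel to the left end
    have R2 := runs_zeroLeft (ord := ord) (α + 1) a1 (g - 1)
      (fun z hz hz' => by
        push_cast at hz
        rw [hA1, if_neg (by omega)]
        split_ifs
        · rfl
        · exact h2 z (by omega) (by omega))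
      (by push_cast; rw [hA1, if_neg (by omega), if_neg (by omega), h1 _ (by omega) (by omega)])
      (by rw [hA1, if_pos (by omega)])
    have hA2 : ∀ z, (fun z => if z = g - 1 + 2 - ((α + 1 : ℕ) : ℤ) then 0 else
        if g - 1 + 2 - ((α + 1 : ℕ) : ℤ) < z ∧ z ≤ g - 1 + 2 then 1 else a1 z) z =
        if z = g - α then 0 else if g - α < z ∧ z ≤ g + 1 then 1 else a1 z := by
      intro z
      push_cast
      split_ifs <;> first | rfl | omega
    generalize (fun z => if z = g - 1 + 2 - ((α + 1 : ℕ) : ℤ) then (0 : K) else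
        if g - 1 + 2 - ((α + 1 : ℕ) : ℤ) < z ∧ z ≤ g - 1 + 2 then 1 else a1 z) = a2 at R2 hA2
    -- extend the run on the left
    set s3 : Cmd K := fill (-59) 1 62 ;; fill (-92) 0 33 with hs3
    set g3 := g - 1 - ((α + 1 : ℕ) : ℤ) with hg3
    have R3 : Runs ord s3 a2 g3 (s3.evalS a2 g3).1 g3 99 :=
      Runs.straight (by simp [hs3, Cmd.IsStraight]) rfl (by simp [hs3, Cmd.evalS, evalS_fill])
        (by simp [hs3, Cmd.length])
    have hA3 : ∀ z, (s3.evalS a2 g3).1 z = if g - α - 94 ≤ z ∧ z < g - α - 61 then 0 else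
        if g - α - 61 ≤ z ∧ z < g - α + 1 then 1 else a2 z := by
      intro z
      simp only [hs3, Cmd.evalS, evalS_fill, hg3]
      push_cast
      split_ifs <;> first | rfl | omega
    generalize (s3.evalS a2 g3).1 = a3 at R3 hA3
    have R4 := runs_walkRight (ord := ord) (α + 2) a3 g3
      (fun z hz hz' => by
        push_cast at hz' hg3
        rw [hA3, if_neg (by omega)]
        split_ifs
        · rfl
        · rw [hA2, if_neg (by omega), if_pos (by omega)])
      (by push_cast at hg3 ⊢
          rw [hA3, if_neg (by omega), if_neg (by omega), hA2, if_neg (by omega), if_neg (by omega),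
            hA1, if_pos (by omega)])
    have hg4 : g3 + ((α + 2 : ℕ) : ℤ) = g := by push_cast at hg3 ⊢; omega
    rw [hg4] at R4
    set s5 : Cmd K := .const 1 0 ;; .right ;; .const 1 1 ;; copyCell 2 3 with hs5
    have R5 : Runs ord s5 a3 g (s5.evalS a3 g).1 (g + 1) 5 :=
      Runs.straight (by simp [hs5, Cmd.IsStraight]) rfl
        (by simp only [hs5, Cmd.evalS]; rw [evalS_copyCell (by omega)])
        (by simp [hs5, Cmd.length])
    have hA5 : ∀ z, (s5.evalS a3 g).1 z = if z = g + 3 then a3 (g + 4) else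
        if z = g + 2 then 1 else if z = g + 1 then 0 else a3 z := by
      intro z
      simp only [hs5, Cmd.evalS]
      rw [evalS_copyCell (by omega)]
      simp only [Function.update_apply]
      rw [show g + 1 + 3 = g + 4 by ring]
      split_ifs <;> first | rfl | omega
    generalize (s5.evalS a3 g).1 = a5 at R5 hA5
    have far : ∀ z, g + 4 ≤ z → a5 z = a z := by
      intro z hz
      rw [hA5, if_neg (by omega), if_neg (by omega), if_neg (by omega), hA3, if_neg (by omega),
        if_neg (by omega), hA2, if_neg (by omega), if_neg (by omega), hA1, if_neg (by omega),
        if_neg (by omega)]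
    obtain ⟨a', R6, k1, k2, k3⟩ := ih (α + 62) a5 (g + 1) (by omega)
      (fun z hz hz' => by
        push_cast at hz hz'
        rw [hA5, if_neg (by omega), if_neg (by omega), if_neg (by omega), hA3, if_pos (by omega)])
      (fun z hz hz' => by
        push_cast at hz hz'
        rw [hA5, if_neg (by omega), if_neg (by omega), if_neg (by omega), hA3, if_neg (by omega)]
        split_ifs
        · rfl
        · rw [hA2, if_neg (by omega), if_pos (by omega)])
      (by rw [hA5, if_neg (by omega), if_neg (by omega), if_pos (by omega)])
      (by rw [hA5, if_neg (by omega), if_pos (by omega)])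
      (by rw [show g + 1 + 3 = g + 4 by ring, far _ le_rfl, hA5, if_pos (by omega), hA3,
            if_neg (by omega), if_neg (by omega), hA2, if_neg (by omega), if_neg (by omega), hA1,
            if_neg (by omega), if_neg (by omega)])
      (fun z hz hz' => by rw [far z (by omega), h6 z (by omega) hz'])
      (by rw [far 0 (by omega), h7])
    push_cast at k1 k2
    refine ⟨a', ?_, fun z hz hz' => k1 z (by omega) (by omega),
      fun z hz hz' => k2 z (by omega) hz', fun z hz => by rw [k3 z hz, far z (by omega)]⟩
    refine (Runs.loop_seq_step ?_ (R1.seq (R2.seq (R3.seq (R4.seq R5)))) R6).mono ?_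
    · rw [h4, h5, h6 _ (by omega) (by omega)]
      simp [branchTest_self]
    · push_cast
      ring_nf
      nlinarith

theorem runs_multiplyOnes (n : ℕ) (a : ℤ → K) (h1 : ∀ z, -(n : ℤ) ≤ z → z < 0 → a z = 1)
    (h2 : a (-(n : ℤ) - 1) = 0) (h3 : a 0 = 0) :
    ∃ a', Runs ord multiplyOnes a 0 a' (-3) (n * (372 * n + 680) + 500) ∧
      (∀ z, -3 - (62 * n : ℤ) - 33 ≤ z → z < -3 - (62 * n : ℤ) → a' z = 0) ∧
      (∀ z, -3 - (62 * n : ℤ) ≤ z → z < 0 → a' z = 1) ∧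
      (∀ z, 0 ≤ z → a' z = a z) := by
  have R0 : Runs ord (moveLeft 2) a 0 a (-2) 4 :=
    Runs.straight (by simp) (by simp) (by simp) (by simp)
  cases n with
  | zero =>
    simp only [Nat.cast_zero, neg_zero, zero_sub, mul_zero, sub_zero] at *
    set s : Cmd K := fill (-34) 0 33 ;; fill (-1) 1 3 ;; .left with hs
    have R1 : Runs ord s a (-2) (s.evalS a (-2)).1 (-3) 60 :=
      Runs.straight (by simp [hs, Cmd.IsStraight]) rfl (by simp [hs, Cmd.evalS, evalS_fill])
        (by simp [hs, Cmd.length])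
    have hA : ∀ z, (s.evalS a (-2)).1 z = if -3 ≤ z ∧ z < 0 then 1 else
        if -36 ≤ z ∧ z < -3 then 0 else a z := by
      intro z
      simp only [hs, Cmd.evalS, evalS_fill]
      push_cast
      split_ifs <;> rfl
    refine ⟨_, (R0.seq (Runs.ite_true ?_ R1)).mono (by omega), ?_, ?_, ?_⟩
    · norm_num
      rw [h2, h3]
      exact branchTest_self _ _
    · intro z hz hz'
      rw [hA, if_neg (by omega), if_pos (by omega)]
    · intro z hz hz'
      rw [hA, if_pos (by omega)]
    · intro z hz
      rw [hA, if_neg (by omega), if_neg (by omega)]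
  | succ b =>
    push_cast at *
    set s1 : Cmd K := .const 1 0 ;; .left with hs1
    have R1 : Runs ord s1 a (-2) (s1.evalS a (-2)).1 (-3) 2 :=
      Runs.straight (by simp [hs1, Cmd.IsStraight]) rfl rfl (by simp [hs1, Cmd.length])
    have hA1 : ∀ z, (s1.evalS a (-2)).1 z = if z = -1 then 0 else a z := by
      intro z
      simp only [hs1, Cmd.evalS, Function.update_apply]
      norm_num
    generalize (s1.evalS a (-2)).1 = a1 at R1 hA1
    have R2 := runs_zeroLeft (ord := ord) b a1 (-3)
      (fun z hz hz' => by rw [hA1, if_neg (by omega), h1 z (by omega) (by omega)])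
      (by rw [hA1, if_neg (by omega), ← h2]; congr 1; ring) (by rw [hA1, if_pos (by omega)])
    have hA2 : ∀ z, (fun z => if z = -3 + 2 - (b : ℤ) then 0 else
        if -3 + 2 - (b : ℤ) < z ∧ z ≤ -3 + 2 then 1 else a1 z) z =
        if z = -1 - (b : ℤ) then 0 else if -1 - (b : ℤ) < z ∧ z ≤ -1 then 1 else a1 z := by
      intro z
      norm_num
    generalize (fun z => if z = -3 + 2 - (b : ℤ) then (0 : K) else
        if -3 + 2 - (b : ℤ) < z ∧ z ≤ -3 + 2 then 1 else a1 z) = a2 at R2 hA2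
    set g := -3 - (b : ℤ) with hg
    set s3 : Cmd K := fill (-95) 0 33 ;; fill (-62) 1 62 ;; fill 0 0 3 ;; .const 1 1 ;;
      copyCell 2 3 with hs3
    have R3 : Runs ord s3 a2 g (s3.evalS a2 g).1 g 107 :=
      Runs.straight (by simp [hs3, Cmd.IsStraight]) rfl
        (by simp only [hs3, Cmd.evalS, evalS_fill]; rw [evalS_copyCell (by omega)])
        (by simp [hs3, Cmd.length])
    have hA3 : ∀ z, (s3.evalS a2 g).1 z = if z = g + 2 then a2 (g + 3) else if z = g + 1 then 1 else
        if z = g then 0 else if g - 62 ≤ z ∧ z < g then 1 else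
        if g - 95 ≤ z ∧ z < g - 62 then 0 else a2 z := by
      intro z
      simp only [hs3, Cmd.evalS, evalS_fill]
      rw [evalS_copyCell (by omega)]
      simp only [Function.update_apply]
      push_cast
      split_ifs <;> first | rfl | omega
    generalize (s3.evalS a2 g).1 = a3 at R3 hA3
    have far : ∀ z, g + 3 ≤ z → a3 z = a2 z := by
      intro z hz
      rw [hA3, if_neg (by omega), if_neg (by omega), if_neg (by omega), if_neg (by omega),
        if_neg (by omega)]
    have far' : ∀ z, 0 ≤ z → a2 z = a z := by
      intro z hz
      rw [hA2, if_neg (by omega), if_neg (by omega), hA1, if_neg (by omega)]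
    obtain ⟨a', R4, k1, k2, k3⟩ := runs_multiplyOnes_loop (ord := ord) b 62 a3 g hg
      (fun z hz hz' => by
        push_cast at hz hz'
        rw [hA3, if_neg (by omega), if_neg (by omega), if_neg (by omega), if_neg (by omega),
          if_pos (by omega)])
      (fun z hz hz' => by
        push_cast at hz
        rw [hA3, if_neg (by omega), if_neg (by omega), if_neg (by omega), if_pos (by omega)])
      (by rw [hA3, if_neg (by omega), if_neg (by omega), if_pos (by omega)])
      (by rw [hA3, if_neg (by omega), if_pos (by omega)])
      (by rw [far _ le_rfl, hA3, if_pos rfl])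
      (fun z hz hz' => by rw [far z hz, hA2, if_neg (by omega), if_pos (by omega)])
      (by rw [far 0 (by omega), far' 0 le_rfl, h3])
    push_cast at k1 k2
    refine ⟨a', (R0.seq (Runs.ite_false ?_ (R1.seq (R2.seq (R3.seq R4))))).mono ?_,
      fun z hz hz' => k1 z (by omega) (by omega), fun z hz hz' => k2 z (by omega) hz',
      fun z hz => by rw [k3 z hz, far z (by omega), far' z hz]⟩
    · norm_num
      rw [h1 (-1) (by omega) (by omega), h3]
      exact not_branchTest_one_zero _
    · ring_nf
      nlinarith

/-- The list of the cells `1, …, m` of a tape. -/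
def cellList (X : ℤ → K) (m : ℕ) : List K := (List.range m).map fun i : ℕ => X ((i : ℤ) + 1)

theorem runs_makeBlocks_loop (j : ℕ) :
    ∀ (a : ℤ → K) (p : ℤ) (L : List K),
    (∀ z, p - 31 * j ≤ z → z < p + 3 → z ≠ p + 2 → a z = 1) → a (p + 2) = a (p - 1) →
    a (p - 31 * j - 1) = 0 → a (p + 3) = 0 →
    Track a 0 (p - 31 * j - 34) L → (∀ r, r ≠ 0 → Track a r (p - 31 * j - 34) []) →
    ∃ a', Runs ord (.loop true
    ((.const 2 1 ;; copyCell 0 4 ;; .const 3 1 ;; .const 4 0) ;; bubbleLeft ;;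
      (.const 4 1 ;; copyCell 5 0 ;; fill 6 0 26 ;; moveRight 31) ;; walkRight ;;
      (.left ;; copyCell 2 (-1))) ;;
      (.const 2 1 ;; moveLeft 34 ;; .const 3 1)) a p a' (p + j - 34) (j * (400 * j + 500) + 50) ∧
      a' (p + j - 34 + 3) = 1 ∧
      Track a' 0 (p + j - 34) (((List.range j).map fun i : ℕ => a (p + 4 + (i : ℤ))).reverse ++ L) ∧
      ∀ r, r ≠ 0 → Track a' r (p + j - 34) [] := by
  induction j with
  | zero =>
    intro a p L h1 h2 h3 h4 hT hT'
    simp only [Nat.cast_zero, mul_zero, sub_zero, add_zero] at *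
    set s : Cmd K := .const 2 1 ;; moveLeft 34 ;; .const 3 1 with hs
    have R1 : Runs ord s a p (s.evalS a p).1 (p - 34) 40 :=
      Runs.straight (by simp [hs, Cmd.IsStraight]) rfl (by simp [hs, Cmd.evalS])
        (by simp [hs, Cmd.length])
    have hA : ∀ z, (s.evalS a p).1 z = if z = p - 31 then 1 else if z = p + 2 then 1 else a z := by
      intro z
      simp only [hs, Cmd.evalS, evalS_moveLeft, Function.update_apply]
      push_cast
      split_ifs <;> first | rfl | omega
    have hT1 : ∀ r l, Track a r (p - 34) l → Track (s.evalS a p).1 r (p - 34) l := by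
      intro r l hl
      refine hl.congr fun z hz hz' => ?_
      have := r.isLt
      have hF : flagCell r = 6 + 2 * (r.val : ℤ) := rfl
      have hV : valueCell r = 7 + 2 * (r.val : ℤ) := rfl
      rw [hA, if_neg (by omega), if_neg (by omega)]
    refine ⟨_, (Runs.loop_seq_done ?_ R1).mono (by omega), ?_, ?_, fun r hr => hT1 r _ (hT' r hr)⟩
    · rw [h2, h3, h1 _ (by omega) (by omega) (by omega)]
      simp [not_branchTest_one_zero]
    · rw [hA, if_pos (by omega)]
    · simpa using hT1 _ _ hT
  | succ j ih =>
    intro a p L h1 h2 h3 h4 hT hT'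
    push_cast at *
    set x := a (p + 4) with hx
    set s1 : Cmd K := .const 2 1 ;; copyCell 0 4 ;; .const 3 1 ;; .const 4 0 with hs1
    have R1 : Runs ord s1 a p (s1.evalS a p).1 p 5 :=
      Runs.straight (by simp [hs1, Cmd.IsStraight]) rfl
        (by simp only [hs1, Cmd.evalS]; rw [evalS_copyCell (by omega)]) (by simp [hs1, Cmd.length])
    have hA1 : ∀ z, (s1.evalS a p).1 z = if z = p + 4 then 0 else if z = p then x else
        if z = p + 2 ∨ z = p + 3 then 1 else a z := by
      intro z
      simp only [hs1, Cmd.evalS]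
      rw [evalS_copyCell (by omega)]
      simp only [Function.update_apply]
      rw [if_neg (by omega : ¬ (p + 4 = p + 2))]
      split_ifs <;> first | rfl | omega
    generalize (s1.evalS a p).1 = a1 at R1 hA1
    have R2 := runs_bubbleLeft (ord := ord) (31 * (j + 1)) a1 p
      (fun z hz hz' => by
        push_cast at hz
        rw [hA1, if_neg (by omega), if_neg (by omega)]
        split_ifs
        · rfl
        · exact h1 z (by omega) (by omega) (by omega))
      (by push_cast; rw [hA1, if_neg (by omega), if_neg (by omega), if_neg (by omega), h3])
      (by rw [hA1, if_neg (by omega), if_neg (by omega), if_neg (by omega),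
            h1 _ (by omega) (by omega) (by omega)])
    set d := p - 31 * ((j : ℤ) + 1) - 1 with hd
    have hA2 : ∀ z, (fun z => if z = p - ((31 * (j + 1) : ℕ) : ℤ) then a1 p else
        if p - ((31 * (j + 1) : ℕ) : ℤ) < z ∧ z ≤ p + 2 then 1 else a1 z) z =
        if z = d + 1 then x else if d + 1 < z ∧ z ≤ p + 2 then 1 else a1 z := by
      intro z
      push_cast
      rw [show a1 p = x by rw [hA1, if_neg (by omega), if_pos rfl]]
      split_ifs <;> first | rfl | omega
    generalize (fun z => if z = p - ((31 * (j + 1) : ℕ) : ℤ) then a1 p else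
        if p - ((31 * (j + 1) : ℕ) : ℤ) < z ∧ z ≤ p + 2 then 1 else a1 z) = a2 at R2 hA2
    have hd2 : p - ((31 * (j + 1) : ℕ) : ℤ) = d + 1 := by push_cast; omega
    rw [hd2] at R2
    -- shape the block
    set s3 : Cmd K := .const 4 1 ;; copyCell 5 0 ;; fill 6 0 26 ;; moveRight 31 with hs3
    have R3 : Runs ord s3 a2 (d + 1) (s3.evalS a2 (d + 1)).1 (d + 32) 64 :=
      Runs.straight (by simp [hs3, Cmd.IsStraight]) rfl
        (by simp only [hs3, Cmd.evalS]
            rw [evalS_copyCell (by omega)]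
            simp only [evalS_fill, evalS_moveRight]
            push_cast; ring)
        (by simp [hs3, Cmd.length])
    have hA3 : ∀ z, (s3.evalS a2 (d + 1)).1 z = if d + 7 ≤ z ∧ z ≤ d + 32 then 0 else
        if z = d + 6 then x else if z = d + 5 then 1 else a2 z := by
      intro z
      have e0 : a2 (d + 1) = x := by rw [hA2, if_pos rfl]
      simp only [hs3, Cmd.evalS]
      rw [evalS_copyCell (by omega)]
      simp only [evalS_fill, evalS_moveRight, Function.update_apply]
      rw [if_neg (by omega : ¬ (d + 1 + 0 = d + 1 + 4)), add_zero, e0]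
      push_cast
      split_ifs <;> first | rfl | omega
    generalize (s3.evalS a2 (d + 1)).1 = a3 at R3 hA3
    have R4 := runs_walkRight (ord := ord) (31 * j + 2) a3 (d + 32)
      (fun z hz hz' => by
        push_cast at hz'
        rw [hA3, if_neg (by omega), if_neg (by omega), if_neg (by omega), hA2, if_neg (by omega)]
        split_ifs
        · rfl
        · rw [hA1, if_neg (by omega), if_neg (by omega), if_pos (by omega)])
      (by push_cast
          rw [hA3, if_neg (by omega), if_neg (by omega), if_neg (by omega), hA2, if_neg (by omega),
            if_neg (by omega), hA1, if_pos (by omega)])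
    rw [show d + 32 + ((31 * j + 2 : ℕ) : ℤ) = p + 2 by push_cast; omega] at R4
    have R5 : Runs ord (.left ;; copyCell 2 (-1)) a3 (p + 2)
        (Function.update a3 (p + 3) (a3 p)) (p + 1) 3 := by
      refine Runs.straight (by simp [Cmd.IsStraight]) ?_ ?_ (by simp [Cmd.length]) <;>
        simp only [Cmd.evalS] <;> rw [evalS_copyCell (by omega)]
      · rw [show p + 2 - 1 + 2 = p + 3 by ring, show p + 2 - 1 + -1 = p by ring]
      · ring
    have hA5 : ∀ z, Function.update a3 (p + 3) (a3 p) z = if z = p + 3 then a3 p else a3 z :=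
      fun z => Function.update_apply _ _ _ _
    generalize Function.update a3 (p + 3) (a3 p) = a5 at R5 hA5
    have far : ∀ z, p + 5 ≤ z → a5 z = a z := by
      intro z hz
      rw [hA5, if_neg (by omega), hA3, if_neg (by omega), if_neg (by omega), if_neg (by omega), hA2,
        if_neg (by omega), if_neg (by omega), hA1, if_neg (by omega), if_neg (by omega),
        if_neg (by omega)]
    have near : ∀ z, z < d → a5 z = a z := by
      intro z hz
      rw [hA5, if_neg (by omega), hA3, if_neg (by omega), if_neg (by omega), if_neg (by omega), hA2,
        if_neg (by omega), if_neg (by omega), hA1, if_neg (by omega), if_neg (by omega),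
        if_neg (by omega)]
    have hblk : ∀ z, d + 5 ≤ z → z ≤ d + 32 → a5 z = if z = d + 6 then x else
        if z = d + 5 then 1 else 0 := by
      intro z hz hz'
      rw [hA5, if_neg (by omega), hA3]
      split_ifs <;> first | rfl | omega
    have hT1 : ∀ r l, Track a r (d - 33) l → Track a5 r (d - 33) l := by
      intro r l hl
      refine hl.congr fun z hz hz' => near z (by omega)
    have hd3 : p + 1 - 31 * (j : ℤ) - 34 = d - 1 := by omega
    have hd4 : p - 31 * ((j : ℤ) + 1) - 34 = d - 33 := by omega
    rw [hd4] at hT hT'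
    obtain ⟨a', R6, k1, k2, k3⟩ := ih a5 (p + 1) (x :: L)
      (fun z hz hz' hz'' => by
        rw [hA5, if_neg (by omega), hA3, if_neg (by omega), if_neg (by omega), if_neg (by omega),
          hA2, if_neg (by omega)]
        split_ifs
        · rfl
        · rw [hA1, if_neg (by omega), if_neg (by omega), if_pos (by omega)])
      (by rw [hA5, if_pos (by omega), hA5, if_neg (by omega)]; congr 1; ring)
      (by rw [hblk _ (by omega) (by omega), if_neg (by omega), if_neg (by omega)])
      (by rw [hA5, if_neg (by omega), hA3, if_neg (by omega), if_neg (by omega), if_neg (by omega),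
            hA2, if_neg (by omega), if_neg (by omega), hA1, if_pos (by omega)])
      (by
        rw [hd3]
        refine ⟨?_, ?_, ?_⟩
        · have hF : flagCell 0 = 6 := rfl
          rw [hblk _ (by omega) (by omega), if_neg (by omega), if_pos (by omega)]
        · have hV : valueCell 0 = 7 := rfl
          rw [hblk _ (by omega) (by omega), if_pos (by omega)]
        · rw [show d - 1 - 32 = d - 33 by ring]
          exact hT1 _ _ hT)
      (fun r hr => by
        have := r.isLt
        have h0 : r.val ≠ 0 := fun h => hr (Fin.ext h)
        have hF : flagCell r = 6 + 2 * (r.val : ℤ) := rfl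
        rw [hd3]
        change a5 (d - 1 + flagCell r) = 0
        rw [hblk _ (by omega) (by omega), if_neg (by omega), if_neg (by omega)])
    have hh : p + 1 + (j : ℤ) - 34 = p + ((j : ℤ) + 1) - 34 := by ring
    rw [hh] at R6 k1 k2 k3
    refine ⟨a', (Runs.loop_seq_step ?_ (R1.seq (R2.seq (R3.seq (R4.seq R5)))) R6).mono ?_, k1, ?_,
      k3⟩
    · rw [h2, h1 (p + 1) (by omega) (by omega) (by omega), h1 _ (by omega) (by omega) (by omega)]
      simp [branchTest_self]
    · ring_nf
      nlinarith
    · convert k2 using 1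
      rw [List.range_succ_eq_map, List.map_cons, List.reverse_cons, List.append_assoc]
      simp only [List.map_map, Nat.cast_zero, add_zero, List.singleton_append, ← hx]
      congr 2
      refine List.map_congr_left fun i _ => ?_
      simp only [Function.comp]
      rw [far _ (by omega)]
      congr 1
      push_cast; ring

/-- The store with the contents `l` of the stack `0` and all other stacks empty. -/
def initStore (l : List K) : Store K := fun r => if r = 0 then l else []

theorem runs_loadInput (n : ℕ) (a : ℤ → K) (h1 : ∀ z, -(n : ℤ) ≤ z → z < 0 → a z = 1)
    (h2 : a (-(n : ℤ) - 1) = 0) (h3 : a 0 = 0) :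
    ∃ a' h, Runs ord loadInput a 0 a' h (3000 * (n + 1) ^ 2) ∧
      Rep (initStore (cellList a (2 * n)).reverse) a' h := by
  obtain ⟨a1, R1, k1, k2, k3⟩ := runs_multiplyOnes (ord := ord) n a h1 h2 h3
  have R2 : Runs ord (copyCell 2 (-1)) a1 (-3) (Function.update a1 (-1) (a1 (-4))) (-3) 2 := by
    refine Runs.straight (by simp) ?_ ?_ (by simp) <;> rw [evalS_copyCell (by omega)]
    norm_num
  have hA : ∀ z, Function.update a1 (-1) (a1 (-4)) z = if z = -1 then a1 (-4) else a1 z :=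
    fun z => Function.update_apply _ _ _ _
  generalize Function.update a1 (-1) (a1 (-4)) = a2 at R2 hA
  have hT : ∀ r, Track a2 r (-3 - 31 * ((2 * n : ℕ) : ℤ) - 34) [] := by
    intro r
    have := r.isLt
    have hF : flagCell r = 6 + 2 * (r.val : ℤ) := rfl
    change a2 (_ + flagCell r) = 0
    push_cast
    rw [hA, if_neg (by omega), k1 _ (by omega) (by omega)]
  obtain ⟨a3, R3, m1, m2, m3⟩ := runs_makeBlocks_loop (ord := ord) (2 * n) a2 (-3) []
    (fun z hz hz' hz'' => by
      push_cast at hz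
      rw [hA, if_neg (by omega), k2 z (by omega) (by omega)])
    (by rw [hA, if_pos (by omega), hA, if_neg (by omega)]; norm_num)
    (by push_cast; rw [hA, if_neg (by omega), k1 _ (by omega) (by omega)])
    (by rw [hA, if_neg (by omega), k3 _ (by omega)]; exact h3)
    (hT 0) (fun r _ => hT r)
  refine ⟨a3, _, (R1.seq (R2.seq R3)).mono ?_, m1, fun r => ?_⟩
  · ring_nf
    nlinarith
  · by_cases hr : r = 0
    · subst hr
      convert m2 using 1
      simp only [initStore, if_true, List.append_nil, cellList]
      congr 1
      refine List.map_congr_left fun i _ => ?_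
      rw [hA, if_neg (by omega), k3 _ (by omega)]
      congr 1; ring
    · simp only [initStore, if_neg hr]
      exact m3 r hr


end

/-! ### Writing the output -/

section
variable {K : Type u} [Semiring K]

/-- Carry the element in the cell `3` to the right through a run of zeros. -/
def carryZeros : Cmd K :=
  .loop true (.const 1 0 ;; copyCell 4 3 ;; .const 3 0 ;; .right ;; copyCell 1 4) ;; .const 1 0

/-- Carry the element in the cell `3` to the right through a run of ones. -/
def carryOnes : Cmd K :=
  .loop true (.const 2 1 ;; copyCell 4 3 ;; .const 3 1 ;; .right ;; copyCell 2 4) ;; .const 2 1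

/-- Move to the left through a run of ones. -/
def onesLeft : Cmd K := .loop true (.const 2 1 ;; .left ;; copyCell 2 0) ;; .const 2 1

/-- Move to the left through a run of zeros. -/
def zerosLeft : Cmd K := .loop true (.const 1 0 ;; .left ;; copyCell 1 0) ;; .const 1 0

/-- Move to the right through a run of zeros. -/
def zerosRight : Cmd K := .loop true (.const 1 0 ;; .right ;; copyCell 1 3) ;; .const 1 0

/-- Move the top of the stack `r` to the left end of the output string on the right of the blocks,
lengthen the run of ones that counts the elements of that string, and go to the next block. -/
def unloadStep (r : Reg) : Cmd K :=
  (copyCell 32 (valueCell r) ;; fill 1 0 31 ;; .const 0 1 ;; moveRight 29 ;; copyCell 1 4) ;;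
  carryZeros ;; (.const 2 1 ;; copyCell 4 3 ;; .const 3 1 ;; .right ;; copyCell 2 4) ;; carryOnes ;;
  (copyCell 4 3 ;; .const 3 0 ;; copyCell 2 0) ;; onesLeft ;; (.left ;; .left ;; copyCell 1 0) ;;
  zerosLeft ;; (moveLeft 32 ;; .const 1 1 ;; copyCell 2 (flagCell r))

/-- Delete the first element of the run of ones, which served as an end mark, and put the head
between this run and the output string. -/
def finishOutput : Cmd K :=
  (fill 1 0 32 ;; copyCell 1 3) ;; zerosRight ;; (.const 3 0 ;; moveRight 3) ;; walkRight ;;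
  moveRight 2

/-- Write the contents of the stack `r`, from the bottom to the top, as the output. -/
def unload (r : Reg) : Cmd K :=
  (.const 33 1 ;; .const 34 0 ;; .const 1 1 ;; copyCell 2 (flagCell r)) ;;
  .loop true (unloadStep r) ;; finishOutput

/-- Write the top of the stack `r` as the output. -/
def outputTop (r : Reg) : Cmd K := .const (-1) 1 ;; .const (-2) 0 ;; copyCell 1 (valueCell r)

end

section
variable {K : Type u} [Semiring K] [Nontrivial K] {ord : Option (SemiringOrder K)}

theorem runs_carryZeros : ∀ (k : ℕ) (a : ℤ → K) (h : ℤ),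
    a (h + 1) = a (h + 4) → a (h + 2) = 0 → (∀ z, h + 4 ≤ z → z < h + 4 + k → a z = 0) →
    a (h + 4 + k) = 1 →
    Runs ord carryZeros a h (fun z => if h + 1 ≤ z ∧ z < h + 3 + k then 0 else
      if z = h + 3 + k then a (h + 3) else a z) (h + k) (10 * k + 2) := by
  intro k
  induction k with
  | zero =>
    intro a h h1 h2 _ h3
    simp only [Nat.cast_zero, add_zero] at *
    refine (Runs.loop_seq_done (t := 1) ?_ ?_).mono (by omega)
    · rw [h1, h2, h3]
      simp [not_branchTest_one_zero]
    · refine Runs.straight trivial (funext fun z => ?_) rfl (by simp [Cmd.length])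
      simp only [Cmd.evalS, Function.update_apply]
      split_ifs <;> first | rfl | omega | rw [‹z = h + 3›] | rw [show z = h + 2 by omega, h2]
  | succ k ih =>
    intro a h h1 h2 h3 h4
    push_cast at *
    set body : Cmd K := .const 1 0 ;; copyCell 4 3 ;; .const 3 0 ;; .right ;; copyCell 1 4 with hb
    have hA : ∀ z, (body.evalS a h).1 z = if z = h + 2 then a (h + 5) else if z = h + 3 then 0 else
        if z = h + 4 then a (h + 3) else if z = h + 1 then 0 else a z := by
      intro z
      simp only [hb, Cmd.evalS]
      rw [evalS_copyCell (by omega)]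
      simp only
      rw [evalS_copyCell (by omega)]
      simp only [Function.update_apply]
      rw [show h + 1 + 4 = h + 5 by ring]
      split_ifs <;> first | rfl | omega
    have hE : (body.evalS a h).2 = h + 1 := by
      simp only [hb, Cmd.evalS]
      rw [evalS_copyCell (by omega)]
      simp only
      rw [evalS_copyCell (by omega)]
    have R1 : Runs ord body a h (body.evalS a h).1 (h + 1) 7 :=
      Runs.straight (by simp [hb, Cmd.IsStraight]) rfl hE (by simp [hb, Cmd.length])
    generalize (body.evalS a h).1 = a1 at R1 hA
    have := ih a1 (h + 1)
      (by rw [hA, if_pos (by omega), hA, if_neg (by omega), if_neg (by omega), if_neg (by omega),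
            if_neg (by omega)]; congr 1; ring)
      (by rw [hA, if_neg (by omega), if_pos (by omega)])
      (fun z hz hz' => by rw [hA, if_neg (by omega), if_neg (by omega), if_neg (by omega),
            if_neg (by omega), h3 z (by omega) (by omega)])
      (by rw [hA, if_neg (by omega), if_neg (by omega), if_neg (by omega),
            if_neg (by omega), ← h4]; congr 1; ring)
    refine (Runs.loop_seq_step ?_ R1
      (?_ : Runs ord carryZeros _ _ _ _ (10 * k + 2))).mono (by omega)
    · rw [h1, h2, h3 _ (by omega) (by omega)]
      simp [branchTest_self]
    · convert this using 1
      · funext z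
        rw [show a1 (h + 1 + 3) = a (h + 3) by
          rw [hA, if_neg (by omega), if_neg (by omega), if_pos (by omega)], hA]
        split_ifs <;> first | rfl | omega
      · ring

theorem runs_carryOnes : ∀ (k : ℕ) (a : ℤ → K) (h : ℤ),
    a (h + 1) = 1 → a (h + 2) = a (h + 4) → (∀ z, h + 4 ≤ z → z < h + 4 + k → a z = 1) →
    a (h + 4 + k) = 0 →
    Runs ord carryOnes a h (fun z => if h + 2 ≤ z ∧ z < h + 3 + k then 1 else
      if z = h + 3 + k then a (h + 3) else a z) (h + k) (10 * k + 2) := by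
  intro k
  induction k with
  | zero =>
    intro a h h1 h2 _ h3
    simp only [Nat.cast_zero, add_zero] at *
    refine (Runs.loop_seq_done (t := 1) ?_ ?_).mono (by omega)
    · rw [h1, h2, h3]
      simp [not_branchTest_one_zero]
    · refine Runs.straight trivial (funext fun z => ?_) rfl (by simp [Cmd.length])
      simp only [Cmd.evalS, Function.update_apply]
      split_ifs <;> first | rfl | omega | rw [‹z = h + 3›]
  | succ k ih =>
    intro a h h1 h2 h3 h4
    push_cast at *
    set body : Cmd K := .const 2 1 ;; copyCell 4 3 ;; .const 3 1 ;; .right ;; copyCell 2 4 with hb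
    have hA : ∀ z, (body.evalS a h).1 z = if z = h + 3 then a (h + 5) else
        if z = h + 4 then a (h + 3) else if z = h + 2 then 1 else a z := by
      intro z
      simp only [hb, Cmd.evalS]
      rw [evalS_copyCell (by omega)]
      simp only
      rw [evalS_copyCell (by omega)]
      simp only [Function.update_apply]
      rw [show h + 1 + 4 = h + 5 by ring]
      split_ifs <;> first | rfl | omega
    have hE : (body.evalS a h).2 = h + 1 := by
      simp only [hb, Cmd.evalS]
      rw [evalS_copyCell (by omega)]
      simp only
      rw [evalS_copyCell (by omega)]
    have R1 : Runs ord body a h (body.evalS a h).1 (h + 1) 7 :=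
      Runs.straight (by simp [hb, Cmd.IsStraight]) rfl hE (by simp [hb, Cmd.length])
    generalize (body.evalS a h).1 = a1 at R1 hA
    have := ih a1 (h + 1)
      (by rw [hA, if_neg (by omega), if_neg (by omega), if_pos (by omega)])
      (by rw [hA, if_pos (by omega), hA, if_neg (by omega), if_neg (by omega), if_neg (by omega)]
          congr 1; ring)
      (fun z hz hz' => by rw [hA, if_neg (by omega), if_neg (by omega), if_neg (by omega),
            h3 z (by omega) (by omega)])
      (by rw [hA, if_neg (by omega), if_neg (by omega), if_neg (by omega), ← h4]; congr 1; ring)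
    refine (Runs.loop_seq_step ?_ R1
      (?_ : Runs ord carryOnes _ _ _ _ (10 * k + 2))).mono (by omega)
    · rw [h1, h2, h3 _ (by omega) (by omega)]
      simp [branchTest_self]
    · convert this using 1
      · funext z
        rw [show a1 (h + 1 + 3) = a (h + 3) by
          rw [hA, if_neg (by omega), if_pos (by omega)], hA]
        split_ifs <;> first | rfl | omega
      · ring

theorem runs_onesLeft : ∀ (k : ℕ) (a : ℤ → K) (h : ℤ),
    a (h + 1) = 1 → a (h + 2) = a h → (∀ z, h - k < z → z ≤ h → a z = 1) → a (h - k) = 0 →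
    Runs ord onesLeft a h (fun z => if h - k < z ∧ z ≤ h + 2 then 1 else a z) (h - k)
      (10 * k + 2) := by
  intro k
  induction k with
  | zero =>
    intro a h h1 h2 _ h3
    simp only [Nat.cast_zero, sub_zero] at *
    refine (Runs.loop_seq_done (t := 1) ?_ ?_).mono (by omega)
    · rw [h1, h2, h3]
      simp [not_branchTest_one_zero]
    · refine Runs.straight trivial (funext fun z => ?_) rfl (by simp [Cmd.length])
      simp only [Cmd.evalS, Function.update_apply]
      split_ifs <;> first | rfl | omega | rw [show z = h + 1 by omega, h1]
  | succ k ih =>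
    intro a h h1 h2 h3 h4
    push_cast at *
    set body : Cmd K := .const 2 1 ;; .left ;; copyCell 2 0 with hb
    have hA : ∀ z, (body.evalS a h).1 z = if z = h + 1 then a (h - 1) else
        if z = h + 2 then 1 else a z := by
      intro z
      simp only [hb, Cmd.evalS]
      rw [evalS_copyCell (by omega)]
      simp only [Function.update_apply]
      rw [show h - 1 + 0 = h - 1 by ring]
      split_ifs <;> first | rfl | omega
    have hE : (body.evalS a h).2 = h - 1 := by
      simp only [hb, Cmd.evalS]
      rw [evalS_copyCell (by omega)]
    have R1 : Runs ord body a h (body.evalS a h).1 (h - 1) 7 :=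
      Runs.straight (by simp [hb, Cmd.IsStraight]) rfl hE (by simp [hb, Cmd.length])
    generalize (body.evalS a h).1 = a1 at R1 hA
    have := ih a1 (h - 1)
      (by rw [hA, if_neg (by omega), if_neg (by omega), h3 _ (by omega) (by omega)])
      (by rw [hA, if_pos (by omega), hA, if_neg (by omega), if_neg (by omega)])
      (fun z hz hz' => by rw [hA, if_neg (by omega), if_neg (by omega), h3 z (by omega) (by omega)])
      (by rw [hA, if_neg (by omega), if_neg (by omega), ← h4]; congr 1; ring)
    refine (Runs.loop_seq_step ?_ R1
      (?_ : Runs ord onesLeft _ _ _ _ (10 * k + 2))).mono (by omega)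
    · rw [h1, h2, h3 _ (by omega) (by omega)]
      simp [branchTest_self]
    · convert this using 1
      · funext z
        rw [hA]
        split_ifs <;> first | rfl | omega
      · ring

theorem runs_zerosLeft : ∀ (k : ℕ) (a : ℤ → K) (h : ℤ),
    a (h + 1) = a h → a (h + 2) = 0 → (∀ z, h - k < z → z ≤ h → a z = 0) → a (h - k) = 1 →
    Runs ord zerosLeft a h (fun z => if h - k < z ∧ z ≤ h + 2 then 0 else a z) (h - k)
      (10 * k + 2) := by
  intro k
  induction k with
  | zero =>
    intro a h h1 h2 _ h3
    simp only [Nat.cast_zero, sub_zero] at *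
    refine (Runs.loop_seq_done (t := 1) ?_ ?_).mono (by omega)
    · rw [h1, h2, h3]
      simp [not_branchTest_one_zero]
    · refine Runs.straight trivial (funext fun z => ?_) rfl (by simp [Cmd.length])
      simp only [Cmd.evalS, Function.update_apply]
      split_ifs <;> first | rfl | omega | rw [show z = h + 2 by omega, h2]
  | succ k ih =>
    intro a h h1 h2 h3 h4
    push_cast at *
    set body : Cmd K := .const 1 0 ;; .left ;; copyCell 1 0 with hb
    have hA : ∀ z, (body.evalS a h).1 z = if z = h then a (h - 1) else
        if z = h + 1 then 0 else a z := by
      intro z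
      simp only [hb, Cmd.evalS]
      rw [evalS_copyCell (by omega)]
      simp only [Function.update_apply]
      rw [show h - 1 + 0 = h - 1 by ring]
      split_ifs <;> first | rfl | omega
    have hE : (body.evalS a h).2 = h - 1 := by
      simp only [hb, Cmd.evalS]
      rw [evalS_copyCell (by omega)]
    have R1 : Runs ord body a h (body.evalS a h).1 (h - 1) 7 :=
      Runs.straight (by simp [hb, Cmd.IsStraight]) rfl hE (by simp [hb, Cmd.length])
    generalize (body.evalS a h).1 = a1 at R1 hA
    have := ih a1 (h - 1)
      (by rw [hA, if_pos (by omega), hA, if_neg (by omega), if_neg (by omega)])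
      (by rw [hA, if_neg (by omega), if_pos (by omega)])
      (fun z hz hz' => by rw [hA, if_neg (by omega), if_neg (by omega), h3 z (by omega) (by omega)])
      (by rw [hA, if_neg (by omega), if_neg (by omega), ← h4]; congr 1; ring)
    refine (Runs.loop_seq_step ?_ R1
      (?_ : Runs ord zerosLeft _ _ _ _ (10 * k + 2))).mono (by omega)
    · rw [h1, h2, h3 _ (by omega) (by omega)]
      simp [branchTest_self]
    · convert this using 1
      · funext z
        rw [hA]
        split_ifs <;> first | rfl | omega | (rw [h2]) | (rw [show z = h + 2 by omega, h2])
      · ring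

theorem runs_zerosRight : ∀ (k : ℕ) (a : ℤ → K) (h : ℤ),
    a (h + 1) = a (h + 3) → a (h + 2) = 0 → (∀ z, h + 3 ≤ z → z < h + 3 + k → a z = 0) →
    a (h + 3 + k) = 1 →
    Runs ord zerosRight a h (fun z => if h + 1 ≤ z ∧ z < h + 3 + k then 0 else a z) (h + k)
      (10 * k + 2) := by
  intro k
  induction k with
  | zero =>
    intro a h h1 h2 _ h3
    simp only [Nat.cast_zero, add_zero] at *
    refine (Runs.loop_seq_done (t := 1) ?_ ?_).mono (by omega)
    · rw [h1, h2, h3]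
      simp [not_branchTest_one_zero]
    · refine Runs.straight trivial (funext fun z => ?_) rfl (by simp [Cmd.length])
      simp only [Cmd.evalS, Function.update_apply]
      split_ifs <;> first | rfl | omega | rw [show z = h + 2 by omega, h2]
  | succ k ih =>
    intro a h h1 h2 h3 h4
    push_cast at *
    set body : Cmd K := .const 1 0 ;; .right ;; copyCell 1 3 with hb
    have hA : ∀ z, (body.evalS a h).1 z = if z = h + 2 then a (h + 4) else
        if z = h + 1 then 0 else a z := by
      intro z
      simp only [hb, Cmd.evalS]
      rw [evalS_copyCell (by omega)]
      simp only [Function.update_apply]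
      rw [show h + 1 + 3 = h + 4 by ring]
      split_ifs <;> first | rfl | omega
    have hE : (body.evalS a h).2 = h + 1 := by
      simp only [hb, Cmd.evalS]
      rw [evalS_copyCell (by omega)]
    have R1 : Runs ord body a h (body.evalS a h).1 (h + 1) 7 :=
      Runs.straight (by simp [hb, Cmd.IsStraight]) rfl hE (by simp [hb, Cmd.length])
    generalize (body.evalS a h).1 = a1 at R1 hA
    have := ih a1 (h + 1)
      (by rw [hA, if_pos (by omega), hA, if_neg (by omega), if_neg (by omega)]; congr 1; ring)
      (by rw [hA, if_neg (by omega), if_neg (by omega), h3 _ (by omega) (by omega)])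
      (fun z hz hz' => by rw [hA, if_neg (by omega), if_neg (by omega), h3 z (by omega) (by omega)])
      (by rw [hA, if_neg (by omega), if_neg (by omega), ← h4]; congr 1; ring)
    refine (Runs.loop_seq_step ?_ R1
      (?_ : Runs ord zerosRight _ _ _ _ (10 * k + 2))).mono (by omega)
    · rw [h1, h2, h3 _ (by omega) (by omega)]
      simp [branchTest_self]
    · convert this using 1
      · funext z
        rw [hA]
        split_ifs <;> first | rfl | omega
      · ring

/-- One round of the output loop: the gap between the blocks and the run of ones grows by 30, the
run of `j` ones grows by one, and the element `c` is put in front of the output string. -/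
theorem runs_unloadStep {r : Reg} {a : ℤ → K} {h : ℤ} {c : K} {g j : ℕ} (hj : 1 ≤ j)
    (hc : a (h + valueCell r) = c) (h1 : ∀ z, h + 33 ≤ z → z < h + 33 + g → a z = 0)
    (h2 : ∀ z, h + 33 + g ≤ z → z < h + 33 + g + j → a z = 1) (h3 : a (h + 33 + g + j) = 0) :
    ∃ a', Runs ord (unloadStep r) a h a' (h - 32) (20 * g + 20 * j + 500) ∧
      (∀ z, z < h → z ≠ h - 31 → z ≠ h - 30 → a' z = a z) ∧
      a' (h - 31) = 1 ∧ a' (h - 30) = a (h - 32 + flagCell r) ∧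
      (∀ z, h + 1 ≤ z → z ≤ h + 30 + g → a' z = 0) ∧
      (∀ z, h + 31 + g ≤ z → z < h + 32 + g + j → a' z = 1) ∧ a' (h + 32 + g + j) = 0 ∧
      a' (h + 33 + g + j) = c ∧ ∀ z, h + 33 + g + j < z → a' z = a z := by
  have hlt := r.isLt
  have hF : flagCell r = 6 + 2 * (r.val : ℤ) := rfl
  have hV : valueCell r = 7 + 2 * (r.val : ℤ) := rfl
  obtain ⟨k, rfl⟩ : ∃ k, j = k + 1 := ⟨j - 1, by omega⟩
  set s1 : Cmd K := copyCell 32 (valueCell r) ;; fill 1 0 31 ;; .const 0 1 ;; moveRight 29 ;;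
    copyCell 1 4 with hs1
  have hA1 : ∀ z, (s1.evalS a h).1 z = if z = h + 30 then a (h + 33) else if z = h then 1 else
      if h + 1 ≤ z ∧ z < h + 32 then 0 else if z = h + 32 then c else a z := by
    intro z
    simp only [hs1, Cmd.evalS]
    rw [evalS_copyCell (by omega)]
    simp only [evalS_fill, evalS_moveRight]
    rw [evalS_copyCell (by omega), hc]
    simp only [Function.update_apply]
    push_cast
    rw [show h + 29 + 4 = h + 33 by ring]
    split_ifs <;> first | rfl | omega
  have R1 : Runs ord s1 a h (s1.evalS a h).1 (h + 29) 70 := by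
    refine Runs.straight (by simp [hs1, Cmd.IsStraight]) rfl ?_ (by simp [hs1, Cmd.length])
    simp only [hs1, Cmd.evalS]
    rw [evalS_copyCell (by omega)]
    simp only [evalS_fill, evalS_moveRight]
    rw [evalS_copyCell (by omega)]
    simp
  generalize (s1.evalS a h).1 = a1 at R1 hA1
  have R2 := runs_carryZeros (ord := ord) g a1 (h + 29)
    (by rw [hA1, if_pos (by omega), hA1, if_neg (by omega), if_neg (by omega), if_neg (by omega),
          if_neg (by omega)]; congr 1; ring)
    (by rw [hA1, if_neg (by omega), if_neg (by omega), if_pos (by omega)])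
    (fun z hz hz' => by
      rw [hA1, if_neg (by omega), if_neg (by omega), if_neg (by omega), if_neg (by omega),
        h1 z (by omega) (by omega)])
    (by rw [hA1, if_neg (by omega), if_neg (by omega), if_neg (by omega), if_neg (by omega),
          h2 _ (by omega) (by push_cast; omega)])
  set p := h + 29 + (g : ℤ) with hp
  have hA2 : ∀ z, (fun z => if h + 29 + 1 ≤ z ∧ z < h + 29 + 3 + (g : ℤ) then 0 else
      if z = h + 29 + 3 + (g : ℤ) then a1 (h + 29 + 3) else a1 z) z =
      if h + 30 ≤ z ∧ z < p + 3 then 0 else if z = p + 3 then c else a1 z := by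
    intro z
    beta_reduce
    rw [show a1 (h + 29 + 3) = c by
      rw [hA1, if_neg (by omega), if_neg (by omega), if_neg (by omega), if_pos (by omega)]]
    split_ifs <;> first | rfl | omega
  generalize (fun z => if h + 29 + 1 ≤ z ∧ z < h + 29 + 3 + (g : ℤ) then 0 else
      if z = h + 29 + 3 + (g : ℤ) then a1 (h + 29 + 3) else a1 z) = a2 at R2 hA2
  set s3 : Cmd K := .const 2 1 ;; copyCell 4 3 ;; .const 3 1 ;; .right ;; copyCell 2 4 with hs3
  have hA3 : ∀ z, (s3.evalS a2 p).1 z = if z = p + 3 then a2 (p + 5) else if z = p + 4 then c else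
      if z = p + 2 then 1 else a2 z := by
    intro z
    have e : a2 (p + 3) = c := by rw [hA2, if_neg (by omega), if_pos rfl]
    simp only [hs3, Cmd.evalS]
    rw [evalS_copyCell (by omega)]
    simp only
    rw [evalS_copyCell (by omega)]
    simp only [Function.update_apply]
    rw [show p + 1 + 4 = p + 5 by ring, e]
    split_ifs <;> first | rfl | omega
  have R3 : Runs ord s3 a2 p (s3.evalS a2 p).1 (p + 1) 7 := by
    refine Runs.straight (by simp [hs3, Cmd.IsStraight]) rfl ?_ (by simp [hs3, Cmd.length])
    simp only [hs3, Cmd.evalS]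
    rw [evalS_copyCell (by omega)]
    simp only
    rw [evalS_copyCell (by omega)]
  generalize (s3.evalS a2 p).1 = a3 at R3 hA3
  have far2 : ∀ z, p + 5 ≤ z → a2 z = a z := by
    intro z hz
    rw [hA2, if_neg (by omega), if_neg (by omega), hA1, if_neg (by omega), if_neg (by omega),
      if_neg (by omega), if_neg (by omega)]
  have far3 : ∀ z, p + 5 ≤ z → a3 z = a z := by
    intro z hz
    rw [hA3, if_neg (by omega), if_neg (by omega), if_neg (by omega), far2 z hz]
  push_cast at h2 h3
  have R4 := runs_carryOnes (ord := ord) k a3 (p + 1)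
    (by rw [hA3, if_neg (by omega), if_neg (by omega), if_pos (by omega)])
    (by rw [far3 (p + 1 + 4) (by omega), hA3, if_pos (by omega), far2 (p + 5) le_rfl]
        congr 1; ring)
    (fun z hz hz' => by rw [far3 z (by omega), h2 z (by omega) (by omega)])
    (by rw [far3 _ (by omega), ← h3]; congr 1; omega)
  set q := p + 1 + (k : ℤ) with hq
  have hA4 : ∀ z, (fun z => if p + 1 + 2 ≤ z ∧ z < p + 1 + 3 + (k : ℤ) then 1 else
      if z = p + 1 + 3 + (k : ℤ) then a3 (p + 1 + 3) else a3 z) z =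
      if p + 3 ≤ z ∧ z < q + 3 then 1 else if z = q + 3 then c else a3 z := by
    intro z
    beta_reduce
    rw [show a3 (p + 1 + 3) = c by rw [hA3, if_neg (by omega), if_pos (by omega)]]
    split_ifs <;> first | rfl | omega
  generalize (fun z => if p + 1 + 2 ≤ z ∧ z < p + 1 + 3 + (k : ℤ) then 1 else
      if z = p + 1 + 3 + (k : ℤ) then a3 (p + 1 + 3) else a3 z) = a4 at R4 hA4
  set s5 : Cmd K := copyCell 4 3 ;; .const 3 0 ;; copyCell 2 0 with hs5
  have hA5 : ∀ z, (s5.evalS a4 q).1 z = if z = q + 2 then a4 q else if z = q + 3 then 0 else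
      if z = q + 4 then c else a4 z := by
    intro z
    have e : a4 (q + 3) = c := by rw [hA4, if_neg (by omega), if_pos rfl]
    simp only [hs5, Cmd.evalS]
    rw [evalS_copyCell (by omega)]
    simp only
    rw [evalS_copyCell (by omega)]
    simp only [Function.update_apply]
    rw [e, if_neg (by omega : ¬ (q + 0 = q + 3)), if_neg (by omega : ¬ (q + 0 = q + 4)), add_zero]
  have R5 : Runs ord s5 a4 q (s5.evalS a4 q).1 q 7 := by
    refine Runs.straight (by simp [hs5, Cmd.IsStraight]) rfl ?_ (by simp [hs5, Cmd.length])
    simp only [hs5, Cmd.evalS]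
    rw [evalS_copyCell (by omega)]
    simp only
    rw [evalS_copyCell (by omega)]
  generalize (s5.evalS a4 q).1 = a5 at R5 hA5
  have one4 : ∀ z, p + 2 ≤ z → z < q + 3 → a4 z = 1 := by
    intro z hz hz'
    rw [hA4]
    split_ifs with h4 h5
    · rfl
    · omega
    · rw [hA3, if_neg (by omega), if_neg (by omega), if_pos (by omega)]
  have zero4 : a4 (p + 1) = 0 := by
    rw [hA4, if_neg (by omega), if_neg (by omega), hA3, if_neg (by omega), if_neg (by omega),
      if_neg (by omega), hA2, if_pos (by omega)]
  have R6 := runs_onesLeft (ord := ord) k a5 q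
    (by rw [hA5, if_neg (by omega), if_neg (by omega), if_neg (by omega),
          one4 _ (by omega) (by omega)])
    (by rw [hA5, if_pos rfl, hA5, if_neg (by omega), if_neg (by omega), if_neg (by omega)])
    (fun z hz hz' => by rw [hA5, if_neg (by omega), if_neg (by omega), if_neg (by omega),
          one4 _ (by omega) (by omega)])
    (by rw [hA5, if_neg (by omega), if_neg (by omega), if_neg (by omega), ← zero4]; congr 1; omega)
  have hqk : q - (k : ℤ) = p + 1 := by omega
  rw [hqk] at R6
  have hA6 : ∀ z, (fun z => if p + 1 < z ∧ z ≤ q + 2 then 1 else a5 z) z =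
      if p + 1 < z ∧ z ≤ q + 2 then 1 else a5 z := fun z => rfl
  generalize (fun z => if p + 1 < z ∧ z ≤ q + 2 then 1 else a5 z) = a6 at R6 hA6
  set s7 : Cmd K := .left ;; .left ;; copyCell 1 0 with hs7
  have hA7 : ∀ z, (s7.evalS a6 (p + 1)).1 z = if z = p then a6 (p - 1) else a6 z := by
    intro z
    simp only [hs7, Cmd.evalS]
    rw [evalS_copyCell (by omega)]
    simp only [Function.update_apply]
    rw [show p + 1 - 1 - 1 + 1 = p by ring, show p + 1 - 1 - 1 + 0 = p - 1 by ring]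
  have R7 : Runs ord s7 a6 (p + 1) (s7.evalS a6 (p + 1)).1 (p - 1) 7 := by
    refine Runs.straight (by simp [hs7, Cmd.IsStraight]) rfl ?_ (by simp [hs7, Cmd.length])
    simp only [hs7, Cmd.evalS]
    rw [evalS_copyCell (by omega)]
    ring
  generalize (s7.evalS a6 (p + 1)).1 = a7 at R7 hA7
  have low6 : ∀ z, z ≤ p + 1 → a6 z = a2 z := by
    intro z hz
    rw [hA6, if_neg (by omega), hA5, if_neg (by omega), if_neg (by omega), if_neg (by omega), hA4,
      if_neg (by omega), if_neg (by omega), hA3, if_neg (by omega), if_neg (by omega),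
      if_neg (by omega)]
  have zero2 : ∀ z, h + 1 ≤ z → z ≤ p + 1 → a2 z = 0 := by
    intro z hz hz'
    rw [hA2]
    split_ifs with h4 h5
    · rfl
    · omega
    · rw [hA1, if_neg (by omega), if_neg (by omega), if_pos (by omega)]
  have R8 := runs_zerosLeft (ord := ord) (28 + g) a7 (p - 1)
    (by rw [hA7, if_pos (by omega), hA7, if_neg (by omega)])
    (by rw [hA7, if_neg (by omega), low6 _ (by omega), zero2 _ (by omega) (by omega)])
    (fun z hz hz' => by
      push_cast at hz
      rw [hA7, if_neg (by omega), low6 _ (by omega), zero2 _ (by omega) (by omega)])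
    (by
      push_cast
      rw [hA7, if_neg (by omega), low6 _ (by omega), hA2, if_neg (by omega), if_neg (by omega), hA1,
        if_neg (by omega), if_pos (by omega)])
  have hpg : p - 1 - ((28 + g : ℕ) : ℤ) = h := by push_cast; omega
  rw [hpg] at R8
  have hA8 : ∀ z, (fun z => if h < z ∧ z ≤ p - 1 + 2 then 0 else a7 z) z =
      if h < z ∧ z ≤ p - 1 + 2 then 0 else a7 z := fun z => rfl
  generalize (fun z => if h < z ∧ z ≤ p - 1 + 2 then 0 else a7 z) = a8 at R8 hA8
  set s9 : Cmd K := moveLeft 32 ;; .const 1 1 ;; copyCell 2 (flagCell r) with hs9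
  have hA9 : ∀ z, (s9.evalS a8 h).1 z = if z = h - 30 then a8 (h - 32 + flagCell r) else
      if z = h - 31 then 1 else a8 z := by
    intro z
    simp only [hs9, Cmd.evalS, evalS_moveLeft]
    rw [evalS_copyCell (by omega)]
    simp only [Function.update_apply]
    push_cast
    split_ifs <;> first | rfl | omega
  have R9 : Runs ord s9 a8 h (s9.evalS a8 h).1 (h - 32) 37 := by
    refine Runs.straight (by simp [hs9, Cmd.IsStraight]) rfl ?_ (by simp [hs9, Cmd.length])
    simp only [hs9, Cmd.evalS, evalS_moveLeft]
    rw [evalS_copyCell (by omega)]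
    rfl
  generalize (s9.evalS a8 h).1 = a9 at R9 hA9
  have high : ∀ z, p + 2 ≤ z → a9 z = a6 z := by
    intro z hz
    rw [hA9, if_neg (by omega), if_neg (by omega), hA8, if_neg (by omega), hA7, if_neg (by omega)]
  have low8 : ∀ z, z < h → a8 z = a z := by
    intro z hz
    rw [hA8, if_neg (by omega), hA7, if_neg (by omega), low6 _ (by omega), hA2, if_neg (by omega),
      if_neg (by omega), hA1, if_neg (by omega), if_neg (by omega), if_neg (by omega),
      if_neg (by omega)]
  refine ⟨a9, (R1.seq (R2.seq (R3.seq (R4.seq (R5.seq (R6.seq (R7.seq (R8.seq R9)))))))).mono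
    (by omega), ?_, ?_, ?_, ?_, ?_, ?_, ?_, ?_⟩
  · intro z hz hz1 hz2
    rw [hA9, if_neg (by omega), if_neg (by omega), low8 z hz]
  · rw [hA9, if_neg (by omega), if_pos rfl]
  · rw [hA9, if_pos rfl, low8 _ (by omega)]
  · intro z hz hz'
    rw [hA9, if_neg (by omega), if_neg (by omega), hA8, if_pos (by omega)]
  · intro z hz hz'
    push_cast at hz'
    rw [high z (by omega), hA6, if_pos (by omega)]
  · push_cast
    rw [high _ (by omega), hA6, if_neg (by omega), hA5, if_neg (by omega), if_pos (by omega)]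
  · push_cast
    rw [high _ (by omega), hA6, if_neg (by omega), hA5, if_neg (by omega), if_neg (by omega),
      if_pos (by omega)]
  · intro z hz
    push_cast at hz
    rw [high _ (by omega), hA6, if_neg (by omega), hA5, if_neg (by omega), if_neg (by omega),
      if_neg (by omega), hA4, if_neg (by omega), if_neg (by omega), far3 z (by omega)]

theorem runs_finishOutput {a : ℤ → K} {h : ℤ} {g : ℕ} {Y : List K} (hY : Y ≠ [])
    (h1 : ∀ z, h + 33 ≤ z → z < h + 33 + g → a z = 0)
    (h2 : ∀ z, h + 33 + g ≤ z → z < h + 33 + g + (Y.length + 1) → a z = 1)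
    (h3 : a (h + 33 + g + (Y.length + 1)) = 0)
    (h4 : ∀ (i : ℕ) (hi : i < Y.length), a (h + 33 + g + (Y.length + 1) + 1 + i) = Y[i]) :
    ∃ a' h', Runs ord finishOutput a h a' h' (20 * g + 20 * Y.length + 700) ∧
      Machine.ReadsOut (view a' h') Y := by
  obtain ⟨k, hk⟩ : ∃ k, Y.length = k + 1 :=
    ⟨Y.length - 1, by have := List.length_pos_iff.2 hY; omega⟩
  set s1 : Cmd K := fill 1 0 32 ;; copyCell 1 3 with hs1
  have hA1 : ∀ z, (s1.evalS a h).1 z = if h + 1 ≤ z ∧ z < h + 33 then 0 else a z := by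
    intro z
    simp only [hs1, Cmd.evalS, evalS_fill]
    rw [evalS_copyCell (by omega)]
    simp only [Function.update_apply]
    push_cast
    split_ifs <;> first | rfl | omega
  have R1 : Runs ord s1 a h (s1.evalS a h).1 h 40 := by
    refine Runs.straight (by simp [hs1, Cmd.IsStraight]) rfl ?_ (by simp [hs1, Cmd.length])
    simp only [hs1, Cmd.evalS, evalS_fill]
    rw [evalS_copyCell (by omega)]
  generalize (s1.evalS a h).1 = a1 at R1 hA1
  have R2 := runs_zerosRight (ord := ord) (30 + g) a1 h
    (by rw [hA1, if_pos (by omega), hA1, if_pos (by omega)])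
    (by rw [hA1, if_pos (by omega)])
    (fun z hz hz' => by
      push_cast at hz'
      rw [hA1]
      split_ifs
      · rfl
      · exact h1 z (by omega) (by omega))
    (by push_cast; rw [hA1, if_neg (by omega), h2 _ (by omega) (by omega)])
  set p := h + ((30 + g : ℕ) : ℤ) with hp
  push_cast at hp
  have hA2 : ∀ z, (fun z => if h + 1 ≤ z ∧ z < h + 3 + ((30 + g : ℕ) : ℤ) then 0 else a1 z) z =
      if h + 1 ≤ z ∧ z < p + 3 then 0 else a z := by
    intro z
    push_cast
    simp only [hA1]
    split_ifs <;> first | rfl | omega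
  generalize (fun z => if h + 1 ≤ z ∧ z < h + 3 + ((30 + g : ℕ) : ℤ) then 0 else a1 z) = a2
    at R2 hA2
  have R3 : Runs ord (.const 3 0 ;; moveRight 3) a2 p (Function.update a2 (p + 3) 0) (p + 3) 6 :=
    Runs.straight (by simp [Cmd.IsStraight]) (by simp [Cmd.evalS]) (by simp [Cmd.evalS])
      (by simp [Cmd.length])
  have hA3 : ∀ z, Function.update a2 (p + 3) 0 z = if z = p + 3 then 0 else a2 z :=
    fun z => Function.update_apply _ _ _ _
  generalize Function.update a2 (p + 3) 0 = a3 at R3 hA3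
  have high : ∀ z, p + 4 ≤ z → a3 z = a z := by
    intro z hz
    rw [hA3, if_neg (by omega), hA2, if_neg (by omega)]
  have R4 := runs_walkRight (ord := ord) k a3 (p + 3)
    (fun z hz hz' => by rw [high z (by omega), h2 z (by omega) (by omega)])
    (by rw [high _ (by omega), ← h3]; congr 1; omega)
  have R5 : Runs ord (moveRight 2) a3 (p + 3 + k) a3 (p + 5 + k) 4 :=
    Runs.straight (by simp) (by simp) (by simp; ring) (by simp)
  refine ⟨a3, _, (R1.seq (R2.seq (R3.seq (R4.seq R5)))).mono (by omega), ?_, ?_, ?_⟩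
  · intro i hi
    simp only [view]
    rw [high _ (by omega), h2 _ (by omega) (by omega)]
  · simp only [view]
    rw [hA3, if_pos (by omega)]
    exact zero_ne_one
  · intro i
    have hi := i.isLt
    simp only [view]
    rw [high _ (by omega), List.get_eq_getElem, ← h4 i hi]
    congr 1; omega

theorem runs_unload_loop (r : Reg) : ∀ (L : List K) (a : ℤ → K) (h : ℤ) (g : ℕ) (Y : List K),
    L.reverse ++ Y ≠ [] → Track a r h L → a (h + 1) = 1 → a (h + 2) = a (h + flagCell r) →
    (∀ z, h + 33 ≤ z → z < h + 33 + g → a z = 0) →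
    (∀ z, h + 33 + g ≤ z → z < h + 33 + g + (Y.length + 1) → a z = 1) →
    a (h + 33 + g + (Y.length + 1)) = 0 →
    (∀ (i : ℕ) (hi : i < Y.length), a (h + 33 + g + (Y.length + 1) + 1 + i) = Y[i]) →
    ∃ a' h', Runs ord (.loop true (unloadStep r) ;; finishOutput) a h a' h'
      ((L.length + 1) * (20 * g + 20 * Y.length + 620 * L.length + 1000)) ∧
      Machine.ReadsOut (view a' h') (L.reverse ++ Y) := by
  intro L
  have hlt := r.isLt
  have hF : flagCell r = 6 + 2 * (r.val : ℤ) := rfl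
  have hV : valueCell r = 7 + 2 * (r.val : ℤ) := rfl
  induction L with
  | nil =>
    intro a h g Y hY hT h1 h2 h3 h4 h5 h6
    obtain ⟨a', h', R, hR⟩ := runs_finishOutput (ord := ord) hY h3 h4 h5 h6
    refine ⟨a', h', (Runs.loop_seq_done ?_ R).mono (by simp), hR⟩
    rw [h1, h2, show a (h + flagCell r) = 0 from hT]
    simp [not_branchTest_one_zero]
  | cons c L ih =>
    intro a h g Y hY hT h1 h2 h3 h4 h5 h6
    obtain ⟨a1, R1, k1, k2, k3, k4, k5, k6, k7, k8⟩ := runs_unloadStep (ord := ord)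
      (r := r) (c := c) (g := g) (j := Y.length + 1) (by omega) hT.2.1 h3
      (by push_cast; exact h4) (by push_cast; exact h5)
    push_cast at k5 k6 k7 k8
    obtain ⟨a', h', R2, hR⟩ := ih a1 (h - 32) (g + 30) (c :: Y) (by simp)
      (hT.2.2.congr fun z hz hz' => by
        by_cases e : z = h
        · subst e; omega
        · exact k1 z (by omega) (by omega) (by omega))
      (by rw [← k2]; ring_nf)
      (by rw [k1 (h - 32 + flagCell r) (by omega) (by omega) (by omega), ← k3]; ring_nf)
      (fun z hz hz' => by push_cast at hz'; exact k4 z (by omega) (by omega))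
      (fun z hz hz' => by
        simp only [List.length_cons] at hz'
        push_cast at hz hz'
        exact k5 z (by omega) (by omega))
      (by simp only [List.length_cons]; push_cast; rw [← k6]; congr 1; ring)
      (fun i hi => by
        simp only [List.length_cons] at hi ⊢
        push_cast
        cases i with
        | zero => rw [List.getElem_cons_zero, ← k7]; congr 1; push_cast; ring
        | succ i =>
          rw [List.getElem_cons_succ, ← h6 i (by omega), k8 _ (by push_cast; omega)]
          congr 1; push_cast; ring)
    refine ⟨a', h', (Runs.loop_seq_step ?_ R1 R2).mono ?_, by simpa using hR⟩
    · rw [h1, h2, hT.1]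
      simp [branchTest_self]
    · simp only [List.length_cons]
      ring_nf
      nlinarith

theorem runs_unload {σ : Store K} {a : ℤ → K} {h : ℤ} (H : Rep σ a h) {r : Reg} (hr : σ r ≠ []) :
    ∃ a' h', Runs ord (unload r) a h a' h' (2000 * ((σ r).length + 1) ^ 2) ∧
      Machine.ReadsOut (view a' h') (σ r).reverse := by
  have hlt := r.isLt
  have hF : flagCell r = 6 + 2 * (r.val : ℤ) := rfl
  have hV : valueCell r = 7 + 2 * (r.val : ℤ) := rfl
  set s1 : Cmd K := .const 33 1 ;; .const 34 0 ;; .const 1 1 ;; copyCell 2 (flagCell r) with hs1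
  have hA1 : ∀ z, (s1.evalS a h).1 z = if z = h + 2 then a (h + flagCell r) else
      if z = h + 1 then 1 else if z = h + 34 then 0 else if z = h + 33 then 1 else a z := by
    intro z
    simp only [hs1, Cmd.evalS]
    rw [evalS_copyCell (by omega)]
    simp only [Function.update_apply]
    rw [if_neg (by omega : ¬ (h + flagCell r = h + 1)),
      if_neg (by omega : ¬ (h + flagCell r = h + 34)),
      if_neg (by omega : ¬ (h + flagCell r = h + 33))]
  have R1 : Runs ord s1 a h (s1.evalS a h).1 h 6 := by
    refine Runs.straight (by simp [hs1, Cmd.IsStraight]) rfl ?_ (by simp [hs1, Cmd.length])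
    simp only [hs1, Cmd.evalS]
    rw [evalS_copyCell (by omega)]
  generalize (s1.evalS a h).1 = a1 at R1 hA1
  obtain ⟨a', h', R2, hR⟩ := runs_unload_loop (ord := ord) r (σ r) a1 h 0 [] (by simpa using hr)
    ((H.2 r).congr fun z hz hz' => by
      rw [hA1, if_neg (by omega), if_neg (by omega), if_neg (by omega), if_neg (by omega)])
    (by rw [hA1, if_neg (by omega), if_pos rfl])
    (by rw [hA1, if_pos rfl, hA1, if_neg (by omega), if_neg (by omega), if_neg (by omega),
          if_neg (by omega)])
    (fun z hz hz' => by push_cast at hz'; omega)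
    (fun z hz hz' => by
      simp only [List.length_nil] at hz'
      push_cast at hz hz'
      rw [hA1, if_neg (by omega), if_neg (by omega), if_neg (by omega), if_pos (by omega)])
    (by simp only [List.length_nil]; push_cast
        rw [hA1, if_neg (by omega), if_neg (by omega), if_pos (by omega)])
    (fun i hi => by simp at hi)
  rw [List.append_nil] at hR
  obtain ⟨_, _, s, s', hs, e1, e2⟩ := R1.seq_inv
  refine ⟨a', h', (R1.seq R2).mono ?_, hR⟩
  simp only [List.length_nil]
  ring_nf
  nlinarith

theorem runs_outputTop {σ : Store K} {a : ℤ → K} {h : ℤ} (H : Rep σ a h) {r : Reg} {c : K}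
    {l : List K} (hr : σ r = c :: l) :
    ∃ a', Runs ord (outputTop r) a h a' h 4 ∧ Machine.ReadsOut (view a' h) [c] := by
  have hlt := r.isLt
  have hV : valueCell r = 7 + 2 * (r.val : ℤ) := rfl
  set s1 : Cmd K := .const (-1) 1 ;; .const (-2) 0 ;; copyCell 1 (valueCell r) with hs1
  have hA1 : ∀ z, (s1.evalS a h).1 z = if z = h + 1 then c else
      if z = h + -2 then 0 else if z = h + -1 then 1 else a z := by
    intro z
    simp only [hs1, Cmd.evalS]
    rw [evalS_copyCell (by omega)]
    simp only [Function.update_apply]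
    rw [if_neg (by omega : ¬ (h + valueCell r = h + -2)),
      if_neg (by omega : ¬ (h + valueCell r = h + -1)), H.value hr]
  have R1 : Runs ord s1 a h (s1.evalS a h).1 h 4 := by
    refine Runs.straight (by simp [hs1, Cmd.IsStraight]) rfl ?_ (by simp [hs1, Cmd.length])
    simp only [hs1, Cmd.evalS]
    rw [evalS_copyCell (by omega)]
  generalize (s1.evalS a h).1 = a1 at R1 hA1
  refine ⟨a1, R1, ?_, ?_, ?_⟩
  · intro i hi
    simp only [List.length_singleton, Nat.lt_one_iff] at hi
    subst hi
    simp [view, hA1]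
  · simp [view, hA1]
  · intro i
    simp [view, hA1]

end

/-! ### From programs on stacks to machines -/

section
variable {K : Type u} [Semiring K]

/-- The first `n` elements of a guess, filled up with zeros. -/
def padTake (n : ℕ) (x' : List K) : List K := (List.range n).map fun i => x'.getD i 0

@[simp] theorem length_padTake (n : ℕ) (x' : List K) : (padTake n x').length = n := by
  simp [padTake]

theorem padTake_eq_append {n : ℕ} {x' : List K} (h : x'.length ≤ n) :
    padTake n x' = x' ++ List.replicate (n - x'.length) 0 := by
  refine List.ext_getElem (by simp; omega) fun i h1 h2 => ?_
  simp only [padTake, List.getElem_map, List.getElem_range, List.getD_eq_getElem?_getD]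
  by_cases hi : i < x'.length
  · simp [hi]
  · rw [List.getElem_append_right (by omega)]
    simp [hi]

theorem guessState_one (x x' : List K) {z : ℤ} (h : -(x.length : ℤ) ≤ z) (h' : z < 0) :
    guessState x x' z = 1 := by
  rw [guessState, if_neg (by omega), if_pos (by omega)]

theorem guessState_sep (x x' : List K) : guessState x x' (-(x.length : ℤ) - 1) = 0 := by
  rw [guessState, if_neg (by omega), if_neg (by omega), if_neg (by omega)]

theorem guessState_zero (x x' : List K) : guessState x x' 0 = 0 := by
  rw [guessState, if_neg (by omega), if_neg (by omega), if_neg (by omega)]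

theorem guessState_pos (x x' : List K) (i : ℕ) :
    guessState x x' ((i : ℤ) + 1) = (x ++ x').getD i 0 := by
  rw [guessState, if_pos (by omega)]
  simp

theorem inputState_eq (x : List K) : inputState x = guessState x [] := by
  funext z
  simp only [inputState, guessState, List.append_nil, List.length_nil]
  split_ifs <;> first | rfl | (push_cast at *; omega)

theorem cellList_guessState (x x' : List K) :
    cellList (guessState x x') (2 * x.length) = x ++ padTake x.length x' := by
  refine List.ext_getElem (by simp [cellList]; omega) fun i h1 h2 => ?_
  simp only [cellList, List.getElem_map, List.getElem_range, guessState_pos]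
  by_cases hi : i < x.length
  · rw [List.getElem_append_left hi, List.getD_append _ _ _ _ hi]
    simp [hi]
  · rw [List.getElem_append_right (by omega), List.getD_append_right _ _ _ _ (by omega)]
    simp [padTake]

end

section
variable {K : Type u} [Semiring K] [Nontrivial K] {ord : Option (SemiringOrder K)}

theorem length_initStore_le (l : List K) (r : Reg) : (initStore l r).length ≤ l.length := by
  unfold initStore
  split_ifs <;> simp

theorem exists_run_of_does (x x' : List K) {y : List K} {P Q : Cmd K} {σ : Store K} {t s : ℕ}
    (H : Does ord P (initStore (x ++ padTake x.length x').reverse) σ t)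
    (HQ : ∀ a h, Rep σ a h → ∃ a' h', Runs ord Q a h a' h' s ∧ Machine.ReadsOut (view a' h') y) :
    ∃ T ≤ 3000 * (x.length + 1) ^ 2 + 1000 * t * (2 * x.length + t + 1) + s + 1,
      ((loadInput ;; P ;; Q).toMachine.run ord (guessState x x') T).1 =
        (loadInput ;; P ;; Q).toMachine.outputNode ∧
      Machine.ReadsOut ((loadInput ;; P ;; Q).toMachine.run ord (guessState x x') T).2 y := by
  obtain ⟨a1, h1, R1, hR1⟩ := runs_loadInput (ord := ord) x.length (guessState x x')
    (fun z hz hz' => guessState_one x x' hz hz') (guessState_sep x x') (guessState_zero x x')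
  rw [cellList_guessState] at hR1
  obtain ⟨a2, R2, hR2⟩ := H.2 (2 * x.length + t)
    (fun r => by have := length_initStore_le (x ++ padTake x.length x').reverse r
                 simp only [List.length_reverse, List.length_append, length_padTake] at this
                 omega) a1 h1 hR1
  obtain ⟨a3, h3, R3, hy⟩ := HQ a2 h1 hR2
  obtain ⟨T, hT, e⟩ := R1.seq (R2.seq R3)
  have := e.run_toMachine
  exact ⟨T + 1, by omega, by rw [this], by rw [this]; exact hy⟩

/-- A language is in `NP` if it is decided by a program on stacks, started with the input and
equally many elements of the guess on the stack `0`. -/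
theorem mem_NP_of_does {L : Set (List K)} (P : Cmd K) (R : Reg) (p : Polynomial ℕ)
    (F : List K → List K → K)
    (H : ∀ x g : List K, g.length = x.length → ∃ σ l,
      Does ord P (initStore (x ++ g).reverse) σ (p.eval x.length) ∧ σ R = F x g :: l)
    (HL : ∀ x, x ∈ L ↔ ∃ x' : List K, F x (padTake x.length x') ≠ 0) : L ∈ NP ord := by
  have key : ∀ x x' : List K, ∃ T ≤ 3000 * (x.length + 1) ^ 2 +
      1000 * p.eval x.length * (2 * x.length + p.eval x.length + 1) + 4 + 1,
      ((loadInput ;; P ;; outputTop R).toMachine.run ord (guessState x x') T).1 =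
        (loadInput ;; P ;; outputTop R).toMachine.outputNode ∧
      Machine.ReadsOut ((loadInput ;; P ;; outputTop R).toMachine.run ord (guessState x x') T).2
        [F x (padTake x.length x')] := by
    intro x x'
    obtain ⟨σ, l, h1, h2⟩ := H x (padTake x.length x') (by simp)
    exact exists_run_of_does x x' h1 fun a h hR =>
      let ⟨a', r1, r2⟩ := runs_outputTop hR h2
      ⟨a', h, r1, r2⟩
  refine ⟨(loadInput ;; P ;; outputTop R).toMachine,
    3000 * (.X + 1) ^ 2 + 1000 * p * (2 * .X + p + 1) + 5, fun x x' => ?_, fun x => ?_⟩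
  · obtain ⟨T, hT, h1, -⟩ := key x x'
    exact ⟨T, hT.trans (by simp), h1⟩
  · rw [HL]
    refine exists_congr fun x' => ?_
    obtain ⟨T, hT, h1, h2⟩ := key x x'
    constructor
    · exact fun h => ⟨_, ⟨T, h1, h2⟩, h⟩
    · rintro ⟨y, hy, hy0⟩
      rw [Machine.outputs_iff_of_halted h1] at hy
      have e1 := hy.2.2 ⟨0, by simp⟩
      have e2 := h2.2.2 ⟨0, by simp⟩
      simp only [List.get_eq_getElem, List.getElem_cons_zero] at e1 e2
      rwa [e2, ← e1]

/-- A function is computable in polynomial time if it is computed by a program on stacks, started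
with the input and equally many zeros on the stack `0`. -/
theorem polyTimeComputable_of_does {f : List K → List K} (P : Cmd K) (R : Reg) (p : Polynomial ℕ)
    (H : ∀ x : List K, ∃ σ, Does ord P (initStore (x ++ padTake x.length []).reverse) σ
      (p.eval x.length) ∧ σ R = (f x).reverse ∧ f x ≠ []) : PolyTimeComputable ord f := by
  have key : ∀ x : List K, ∃ T ≤ 3000 * (x.length + 1) ^ 2 +
      1000 * p.eval x.length * (2 * x.length + p.eval x.length + 1) +
        2000 * (2 * x.length + p.eval x.length + 1) ^ 2 + 1,
      ((loadInput ;; P ;; unload R).toMachine.run ord (guessState x []) T).1 =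
        (loadInput ;; P ;; unload R).toMachine.outputNode ∧
      Machine.ReadsOut ((loadInput ;; P ;; unload R).toMachine.run ord (guessState x []) T).2
        (f x) := by
    intro x
    obtain ⟨σ, h1, h2, h3⟩ := H x
    refine exists_run_of_does x [] h1 fun a h hR => ?_
    obtain ⟨a', h', r1, r2⟩ := runs_unload (ord := ord) hR (r := R) (by simpa [h2] using h3)
    refine ⟨a', h', r1.mono ?_, by simpa [h2] using r2⟩
    have e1 := h1.1 R
    have e2 := length_initStore_le (x ++ padTake x.length []).reverse R
    simp only [List.length_reverse, List.length_append, length_padTake] at e2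
    gcongr
    omega
  refine ⟨(loadInput ;; P ;; unload R).toMachine,
    3000 * (.X + 1) ^ 2 + 1000 * p * (2 * .X + p + 1) + 2000 * (2 * .X + p + 1) ^ 2 + 1,
    fun x => ?_⟩
  obtain ⟨T, hT, h1, h2⟩ := key x
  rw [inputState_eq]
  exact ⟨⟨T, hT.trans (by simp), h1⟩, T, h1, h2⟩

end

/-! ### Stores with explicit components -/

/-- The contents of the thirteen stacks as a structure. -/
structure Regs (K : Type u) : Type u where
  r0 : List K := []
  r1 : List K := []
  r2 : List K := []
  r3 : List K := []
  r4 : List K := []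
  r5 : List K := []
  r6 : List K := []
  r7 : List K := []
  r8 : List K := []
  r9 : List K := []
  r10 : List K := []
  r11 : List K := []
  r12 : List K := []

namespace Regs

variable {K : Type u}

/-- The store with the given components. -/
def toStore (s : Regs K) : Store K
  | 0 => s.r0
  | 1 => s.r1
  | 2 => s.r2
  | 3 => s.r3
  | 4 => s.r4
  | 5 => s.r5
  | 6 => s.r6
  | 7 => s.r7
  | 8 => s.r8
  | 9 => s.r9
  | 10 => s.r10
  | 11 => s.r11
  | 12 => s.r12

variable (s : Regs K) (l : List K)

@[simp] theorem toStore_0 : s.toStore 0 = s.r0 := rfl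
@[simp] theorem toStore_1 : s.toStore 1 = s.r1 := rfl
@[simp] theorem toStore_2 : s.toStore 2 = s.r2 := rfl
@[simp] theorem toStore_3 : s.toStore 3 = s.r3 := rfl
@[simp] theorem toStore_4 : s.toStore 4 = s.r4 := rfl
@[simp] theorem toStore_5 : s.toStore 5 = s.r5 := rfl
@[simp] theorem toStore_6 : s.toStore 6 = s.r6 := rfl
@[simp] theorem toStore_7 : s.toStore 7 = s.r7 := rfl
@[simp] theorem toStore_8 : s.toStore 8 = s.r8 := rfl
@[simp] theorem toStore_9 : s.toStore 9 = s.r9 := rfl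
@[simp] theorem toStore_10 : s.toStore 10 = s.r10 := rfl
@[simp] theorem toStore_11 : s.toStore 11 = s.r11 := rfl
@[simp] theorem toStore_12 : s.toStore 12 = s.r12 := rfl

theorem update_eq {r : Reg} {s s' : Regs K} (h : s'.toStore r = l)
    (h' : ∀ r', r' ≠ r → s'.toStore r' = s.toStore r') :
    Function.update s.toStore r l = s'.toStore := by
  funext r'
  by_cases hr : r' = r
  · subst hr; rw [Function.update_self, h]
  · rw [Function.update_of_ne hr, h' r' hr]

@[simp] theorem update_0 : Function.update s.toStore 0 l = { s with r0 := l }.toStore :=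
  update_eq l rfl (by
    intro r' h; fin_cases r' <;> first | exact absurd rfl h | rfl)
@[simp] theorem update_1 : Function.update s.toStore 1 l = { s with r1 := l }.toStore :=
  update_eq l rfl (by
    intro r' h; fin_cases r' <;> first | exact absurd rfl h | rfl)
@[simp] theorem update_2 : Function.update s.toStore 2 l = { s with r2 := l }.toStore :=
  update_eq l rfl (by
    intro r' h; fin_cases r' <;> first | exact absurd rfl h | rfl)
@[simp] theorem update_3 : Function.update s.toStore 3 l = { s with r3 := l }.toStore :=
  update_eq l rfl (by
    intro r' h; fin_cases r' <;> first | exact absurd rfl h | rfl)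
@[simp] theorem update_4 : Function.update s.toStore 4 l = { s with r4 := l }.toStore :=
  update_eq l rfl (by
    intro r' h; fin_cases r' <;> first | exact absurd rfl h | rfl)
@[simp] theorem update_5 : Function.update s.toStore 5 l = { s with r5 := l }.toStore :=
  update_eq l rfl (by
    intro r' h; fin_cases r' <;> first | exact absurd rfl h | rfl)
@[simp] theorem update_6 : Function.update s.toStore 6 l = { s with r6 := l }.toStore :=
  update_eq l rfl (by
    intro r' h; fin_cases r' <;> first | exact absurd rfl h | rfl)
@[simp] theorem update_7 : Function.update s.toStore 7 l = { s with r7 := l }.toStore :=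
  update_eq l rfl (by
    intro r' h; fin_cases r' <;> first | exact absurd rfl h | rfl)
@[simp] theorem update_8 : Function.update s.toStore 8 l = { s with r8 := l }.toStore :=
  update_eq l rfl (by
    intro r' h; fin_cases r' <;> first | exact absurd rfl h | rfl)
@[simp] theorem update_9 : Function.update s.toStore 9 l = { s with r9 := l }.toStore :=
  update_eq l rfl (by
    intro r' h; fin_cases r' <;> first | exact absurd rfl h | rfl)
@[simp] theorem update_10 : Function.update s.toStore 10 l = { s with r10 := l }.toStore :=
  update_eq l rfl (by
    intro r' h; fin_cases r' <;> first | exact absurd rfl h | rfl)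
@[simp] theorem update_11 : Function.update s.toStore 11 l = { s with r11 := l }.toStore :=
  update_eq l rfl (by
    intro r' h; fin_cases r' <;> first | exact absurd rfl h | rfl)
@[simp] theorem update_12 : Function.update s.toStore 12 l = { s with r12 := l }.toStore :=
  update_eq l rfl (by
    intro r' h; fin_cases r' <;> first | exact absurd rfl h | rfl)

theorem initStore_eq : initStore l = ({ r0 := l } : Regs K).toStore := by
  funext r'; fin_cases r' <;> rfl

end Regs

section
variable {K : Type u} [Semiring K]

/-- Move the top of the stack `s` to the stack `r`. -/
def moveTop (r s : Reg) : Cmd K := pushTop r s ;; popReg s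

/-- Empty the stack `r`. -/
def clear (r : Reg) : Cmd K := whileNonempty r (popReg r)

/-- Move all elements of the stack `s` one by one to the stack `r`. -/
def moveAll (r s : Reg) : Cmd K := whileNonempty s (moveTop r s)

end

section
variable {K : Type u} [Semiring K] [Nontrivial K] {ord : Option (SemiringOrder K)}

theorem does_moveTop {σ : Store K} {r s : Reg} (hrs : s ≠ r) {c : K} {l : List K}
    (hs : σ s = c :: l) :
    Does ord (moveTop r s) σ (Function.update (Function.update σ r (c :: σ r)) s l) 2 :=
  (does_pushTop r hs).seq (does_popReg (by rw [Function.update_of_ne hrs, hs]))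

theorem does_clear (r : Reg) : ∀ (l : List K) (σ : Store K), σ r = l →
    Does ord (clear r) σ (Function.update σ r []) (2 * l.length + 1)
  | [], σ, h => (does_whileNonempty_nil h).congr (by rw [← h, Function.update_eq_self])
  | c :: l, σ, h => by
      refine ((does_whileNonempty_cons (by simp [h]) (does_popReg h)
        (does_clear r l _ (Function.update_self _ _ _))).mono ?_).congr ?_
      · simp only [List.length_cons]; omega
      · simp

theorem does_moveAll {r s : Reg} (hrs : s ≠ r) : ∀ (l : List K) (σ : Store K), σ s = l →
    Does ord (moveAll r s) σ (Function.update (Function.update σ r (l.reverse ++ σ r)) s [])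
      (3 * l.length + 1)
  | [], σ, h => (does_whileNonempty_nil h).congr (by
      rw [List.reverse_nil, List.nil_append, Function.update_eq_self, ← h, Function.update_eq_self])
  | c :: l, σ, h => by
      refine ((does_whileNonempty_cons (by simp [h]) (does_moveTop hrs h)
        (does_moveAll hrs l _ (Function.update_self _ _ _))).mono ?_).congr ?_
      · simp only [List.length_cons]; omega
      · funext r'
        by_cases h1 : r' = s
        · subst h1; simp
        · by_cases h2 : r' = r
          · subst h2; simp [Function.update_of_ne h1]
          · simp [Function.update_of_ne h1, Function.update_of_ne h2]

end

/-! ### Formulas as strings of tokens -/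

/-- The symbols of the postfix notation. -/
inductive Token (K : Type u) : Type u
  | lit (l : Literal)
  | const (c : K)
  | eq
  | le
  | and
  | or

section
variable {K : Type u} [Semiring K]

/-- The part of the code of a literal that starts with its sign. -/
def literalKey (K : Type u) [Semiring K] : Literal → List K
  | .pos p => 0 :: encodeProposition K p
  | .neg p => 1 :: encodeProposition K p

theorem encodeLiteral_eq (l : Literal) : encodeLiteral K l = 0 :: 0 :: literalKey K l := by
  cases l <;> rfl

/-- The code of a token. -/
def Token.encode : Token K → List K
  | .lit l => encodeLiteral K l
  | .const c => [0, 1, 0, c]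
  | .eq => [0, 1, 1]
  | .le => [1, 0, 0]
  | .and => [1, 0, 1]
  | .or => [1, 1, 0]

variable {ord : Option (SemiringOrder K)}

/-- The postfix notation of a formula. -/
def Formula.tokens : Formula ord → List (Token K)
  | .lit l => [.lit l]
  | .const c => [.const c]
  | .eq φ ψ => φ.tokens ++ ψ.tokens ++ [.eq]
  | .le _ φ ψ => φ.tokens ++ ψ.tokens ++ [.le]
  | .and φ ψ => φ.tokens ++ ψ.tokens ++ [.and]
  | .or φ ψ => φ.tokens ++ ψ.tokens ++ [.or]

theorem Formula.encode_eq (φ : Formula ord) : φ.encode = φ.tokens.flatMap Token.encode := by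
  induction φ <;> simp_all [Formula.encode, Formula.tokens, Token.encode]

/-- The effect of a token on a stack of formulas. -/
def Token.apply (ord : Option (SemiringOrder K)) : Token K → List (Formula ord) →
    Option (List (Formula ord))
  | .lit l, Φ => some (.lit l :: Φ)
  | .const c, Φ => some (.const c :: Φ)
  | .eq, ψ :: φ :: Φ => some (.eq φ ψ :: Φ)
  | .le, ψ :: φ :: Φ => if h : ord.isSome then some (.le h φ ψ :: Φ) else none
  | .and, ψ :: φ :: Φ => some (.and φ ψ :: Φ)
  | .or, ψ :: φ :: Φ => some (.or φ ψ :: Φ)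
  | _, _ => none

/-- Evaluate a string of tokens on a stack of formulas. -/
def applyTokens (ord : Option (SemiringOrder K)) : List (Token K) → List (Formula ord) →
    Option (List (Formula ord))
  | [], Φ => some Φ
  | τ :: l, Φ => (τ.apply ord Φ).bind (applyTokens ord l)

theorem applyTokens_tokens (φ : Formula ord) : ∀ (l : List (Token K)) (Φ : List (Formula ord)),
    applyTokens ord (φ.tokens ++ l) Φ = applyTokens ord l (φ :: Φ) := by
  induction φ with
  | lit => intro l Φ; rfl
  | const => intro l Φ; rfl
  | eq φ ψ h1 h2 => intro l Φ; simp only [Formula.tokens, List.append_assoc, h1, h2]; rfl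
  | le h φ ψ h1 h2 =>
    intro l Φ
    simp only [Formula.tokens, List.append_assoc, h1, h2]
    simp [applyTokens, Token.apply, h]
  | and φ ψ h1 h2 => intro l Φ; simp only [Formula.tokens, List.append_assoc, h1, h2]; rfl
  | or φ ψ h1 h2 => intro l Φ; simp only [Formula.tokens, List.append_assoc, h1, h2]; rfl

theorem Formula.tokens_injective : Function.Injective (Formula.tokens (ord := ord)) := by
  intro φ ψ h
  have h1 := applyTokens_tokens φ [] []
  have h2 := applyTokens_tokens ψ [] []
  rw [h, h2] at h1
  simp only [applyTokens, Option.some.injEq, List.cons.injEq, and_true] at h1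
  exact h1.symm

/-- A stack of formulas that is reached from the empty stack by a string of tokens has this string
as its postfix notation. -/
theorem tokens_of_applyTokens : ∀ (l : List (Token K)) (Φ Ψ : List (Formula ord)),
    applyTokens ord l Φ = some Ψ →
    Ψ.reverse.flatMap Formula.tokens = Φ.reverse.flatMap Formula.tokens ++ l := by
  intro l
  induction l with
  | nil => intro Φ Ψ h; simp only [applyTokens, Option.some.injEq] at h; simp [h]
  | cons τ l ih =>
    intro Φ Ψ h
    simp only [applyTokens, Option.bind_eq_some_iff] at h
    obtain ⟨Φ', h1, h2⟩ := h
    rw [ih Φ' Ψ h2]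
    rcases τ with _ | _ | _ | _ | _ | _ <;> rcases Φ with _ | ⟨ψ, _ | ⟨φ, Φ⟩⟩ <;>
      simp only [Token.apply, Option.some.injEq, reduceCtorEq] at h1 <;>
      first
      | (subst h1; simp [Formula.tokens])
      | (split_ifs at h1; simp only [Option.some.injEq] at h1; subst h1; simp [Formula.tokens])

end

section
variable {K : Type u} [Semiring K] [Nontrivial K]

theorem bit_injective : Function.Injective (bit K) := by
  intro b c h
  cases b <;> cases c <;> simp_all [bit]

theorem encodeProposition_append_inj : ∀ (p q : Proposition) (u v : List K),
    encodeProposition K p ++ u = encodeProposition K q ++ v → p = q ∧ u = v := by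
  intro p
  induction p with
  | nil =>
    intro q u v h
    cases q with
    | nil => simpa [encodeProposition] using h
    | cons b q => simp [encodeProposition] at h
  | cons b p ih =>
    intro q u v h
    cases q with
    | nil => simp [encodeProposition] at h
    | cons c q =>
      simp only [encodeProposition, List.flatMap_cons, List.cons_append, List.nil_append,
        List.append_assoc, List.cons.injEq, true_and] at h
      obtain ⟨h1, h2⟩ := h
      obtain ⟨rfl, h3⟩ := ih q u v (by simpa [encodeProposition] using h2)
      exact ⟨by rw [bit_injective h1], h3⟩

theorem literalKey_append_inj {l m : Literal} {u v : List K}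
    (h : literalKey K l ++ u = literalKey K m ++ v) : l = m ∧ u = v := by
  cases l <;> cases m <;> simp only [literalKey, List.cons_append, List.cons.injEq, zero_ne_one,
    one_ne_zero, false_and, true_and] at h
  all_goals obtain ⟨rfl, h2⟩ := encodeProposition_append_inj _ _ _ _ h; exact ⟨rfl, h2⟩

theorem literalKey_injective : Function.Injective (literalKey K) := fun l m h =>
  (literalKey_append_inj (u := []) (v := []) (by simpa using h)).1

theorem Token.encode_append_inj {τ τ' : Token K} {u v : List K}
    (h : τ.encode ++ u = τ'.encode ++ v) : τ = τ' ∧ u = v := by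
  cases τ <;> cases τ' <;>
    simp only [Token.encode, encodeLiteral_eq, List.cons_append, List.nil_append, List.cons.injEq,
      zero_ne_one, one_ne_zero, false_and, true_and, and_false] at h
  · obtain ⟨rfl, h2⟩ := literalKey_append_inj h
    exact ⟨rfl, h2⟩
  · obtain ⟨rfl, h2⟩ := h
    exact ⟨rfl, h2⟩
  all_goals exact ⟨rfl, h⟩

theorem flatMap_encode_injective :
    Function.Injective (fun l : List (Token K) => l.flatMap Token.encode) := by
  intro l
  induction l with
  | nil =>
    intro m h
    cases m with
    | nil => rfl
    | cons τ m =>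
      simp only [List.flatMap_nil, List.flatMap_cons] at h
      cases τ <;> simp [Token.encode, encodeLiteral_eq] at h
  | cons τ l ih =>
    intro m h
    cases m with
    | nil =>
      simp only [List.flatMap_nil, List.flatMap_cons] at h
      cases τ <;> simp [Token.encode, encodeLiteral_eq] at h
    | cons τ' m =>
      obtain ⟨rfl, h2⟩ := Token.encode_append_inj h
      rw [ih h2]

theorem Formula.encode_injective {ord : Option (SemiringOrder K)} :
    Function.Injective (Formula.encode (ord := ord)) := by
  intro φ ψ h
  rw [Formula.encode_eq, Formula.encode_eq] at h
  exact Formula.tokens_injective (flatMap_encode_injective h)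

end

/-! ### Symbolic execution -/

section
variable {K : Type u} [Semiring K] [Nontrivial K] {ord : Option (SemiringOrder K)} {P Q : Cmd K}
  {σ σ' : Store K} {t : ℕ}

theorem Does.push_seq {r : Reg} {c : K} (H : Does ord P (Function.update σ r (c :: σ r)) σ' t) :
    Does ord (push r c ;; P) σ σ' (1 + t) := (does_push σ r c).seq H

theorem Does.pushTop_seq {r s : Reg} {c : K} {l : List K} (hs : σ s = c :: l)
    (H : Does ord P (Function.update σ r (c :: σ r)) σ' t) :
    Does ord (pushTop r s ;; P) σ σ' (1 + t) := (does_pushTop r hs).seq H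

theorem Does.popReg_seq {r : Reg} {c : K} {l : List K} (hr : σ r = c :: l)
    (H : Does ord P (Function.update σ r l) σ' t) :
    Does ord (popReg r ;; P) σ σ' (1 + t) := (does_popReg hr).seq H

theorem Does.moveTop_seq {r s : Reg} (hrs : s ≠ r) {c : K} {l : List K} (hs : σ s = c :: l)
    (H : Does ord P (Function.update (Function.update σ r (c :: σ r)) s l) σ' t) :
    Does ord (moveTop r s ;; P) σ σ' (2 + t) := (does_moveTop hrs hs).seq H

theorem Does.moveAll_seq {r s : Reg} (hrs : s ≠ r)
    (H : Does ord P (Function.update (Function.update σ r ((σ s).reverse ++ σ r)) s []) σ' t) :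
    Does ord (moveAll r s ;; P) σ σ' (3 * (σ s).length + 1 + t) := (does_moveAll hrs _ σ rfl).seq H

end

/-! ### The verifier -/

/-!
The verifier keeps its data on the following stacks.
* 0: nonempty if the input has been rejected (and the raw input at the start)
* 1: the rest of the formula
* 2: the rest of the guess
* 3: the values of the subformulas that are waiting for an operation
* 4, 5: the name of the current literal, and a part of it during a comparison
* 6, 7: the dictionary of the literals seen so far; stack 7 holds names and values, and stack 6
  has a one for every symbol of a name and a zero for every value
* 8, 9: the part of the dictionary that has been compared already
* 10, 11: the constants zero and one
* 12: a flag
-/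

section
variable {K : Type u} [Semiring K]

/-- Reject the input. -/
def reject : Cmd K := push 0 0

/-- Read a bit from the formula; do `P` if it is zero and `Q` if it is one. -/
def bitCase (P Q : Cmd K) : Cmd K :=
  ifEmpty 1 reject (ifEq 1 10 (popReg 1 ;; P) (ifEq 1 11 (popReg 1 ;; Q) reject))

/-- The program `P` succeeds in the store `s` with the outcome `o`. If there is no outcome, then it
rejects, and the flag on the stack 12 is not set. -/
def Tries (ord : Option (SemiringOrder K)) (P : Cmd K) (s : Regs K) (o : Option (Regs K)) (t : ℕ) :
    Prop :=
  match o with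
  | some s' => Does ord P s.toStore s'.toStore t ∧ s'.r0 = []
  | none => ∃ s' : Regs K, Does ord P s.toStore s'.toStore t ∧ s'.r0 ≠ [] ∧ s'.r12 = []

open Classical in
/-- Read a bit from a string and continue with `a` if it is zero and with `b` if it is one. -/
noncomputable def bitMatch {α : Type*} (a b : List K → Option α) : List K → Option α
  | [] => none
  | c :: X => if c = 0 then a X else if c = 1 then b X else none

variable {ord : Option (SemiringOrder K)} {P Q : Cmd K} {s : Regs K} {o : Option (Regs K)}
  {t t' : ℕ}

theorem Tries.mono (H : Tries ord P s o t) (h : t ≤ t') : Tries ord P s o t' := by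
  cases o with
  | some s' => exact ⟨H.1.mono h, H.2⟩
  | none => obtain ⟨s', h1, h2⟩ := H; exact ⟨s', h1.mono h, h2⟩

theorem Tries.congr {o' : Option (Regs K)} (H : Tries ord P s o t) (h : o = o') :
    Tries ord P s o' t := h ▸ H

theorem Tries.imp {Q : Cmd K} {s₂ : Regs K}
    (H : Tries ord P s o t)
    (h : ∀ s', Does ord P s.toStore s' t → Does ord Q s₂.toStore s' t') : Tries ord Q s₂ o t' := by
  cases o with
  | some s' => exact ⟨h _ H.1, H.2⟩
  | none => obtain ⟨s', h1, h2⟩ := H; exact ⟨s', h _ h1, h2⟩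

end

section
variable {K : Type u} [Semiring K] [Nontrivial K] {ord : Option (SemiringOrder K)} {P Q : Cmd K}
  {s : Regs K} {t : ℕ}

theorem tries_reject (h : s.r12 = []) : Tries ord reject s none 1 :=
  ⟨_, (does_push _ _ _).congr (Regs.update_0 _ _), by simp, h⟩

/-- The constants are in place, nothing has been rejected so far, and the flag is not set. -/
def Ready (s : Regs K) : Prop := s.r0 = [] ∧ s.r10 = [0] ∧ s.r11 = [1] ∧ s.r12 = []

theorem tries_bitCase (hs : Ready s) {a b : List K → Option (Regs K)}
    (ha : ∀ Y, s.r1 = 0 :: Y → Tries ord P { s with r1 := Y } (a Y) t)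
    (hb : ∀ Y, s.r1 = 1 :: Y → Tries ord Q { s with r1 := Y } (b Y) t) :
    Tries ord (bitCase P Q) s (bitMatch a b s.r1) (t + 7) := by
  have hs' := hs
  obtain ⟨h0, h10, h11, h12⟩ := hs
  cases hX : s.r1 with
  | nil =>
    refine (tries_reject (s := s) h12).imp fun s' H => ?_
    exact (does_ifEmpty_pos (by simp [hX]) H).mono (by omega)
  | cons c Y =>
    have hX' : s.toStore 1 = c :: Y := by simp [hX]
    by_cases hc : c = 0
    · subst hc
      simp only [bitMatch, if_true]
      refine (ha Y hX).imp fun s' H => ?_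
      refine Does.mono (does_ifEmpty_neg (by simp [hX]) (does_ifEq_pos hX' (m := []) (by simp [h10])
        (Does.popReg_seq hX' (t := t) ?_))) (by omega)
      simpa using H
    · by_cases hc1 : c = 1
      · subst hc1
        simp only [bitMatch, if_true, one_ne_zero, if_false]
        refine (hb Y hX).imp fun s' H => ?_
        refine Does.mono (does_ifEmpty_neg (by simp [hX]) (does_ifEq_neg hX' (d := 0) (m := [])
          (by simp [h10]) hc (does_ifEq_pos hX' (m := []) (by simp [h11])
          (Does.popReg_seq hX' (t := t) ?_)))) (by omega)
        simpa using H
      · simp only [bitMatch, hc, hc1, if_false]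
        refine (tries_reject (s := s) h12).imp fun s' H => ?_
        exact (does_ifEmpty_neg (by simp [hX]) (does_ifEq_neg hX' (d := 0) (m := [])
          (by simp [h10]) hc (does_ifEq_neg hX' (d := 1) (m := [])
          (by simp [h11]) hc1 H))).mono (by omega)

/-- Read the name of a proposition from the formula and push it onto the stack 4. -/
def readName : Cmd K := whileNonempty 12 (popReg 12 ;;
  bitCase (push 4 0) (push 4 1 ;;
    bitCase (push 4 0 ;; push 12 0) (push 4 1 ;; push 12 0)))

open Classical in
/-- Split off the code of a proposition from a string. -/
noncomputable def splitName : List K → Option (Proposition × List K)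
  | [] => none
  | [c] => if c = 0 then some ([], []) else none
  | c :: d :: X =>
    if c = 0 then some ([], d :: X)
    else if c = 1 then
      if d = 0 then (splitName X).map fun q => (false :: q.1, q.2)
      else if d = 1 then (splitName X).map fun q => (true :: q.1, q.2) else none
    else none

theorem splitName_eq_some : ∀ (X : List K) (p : Proposition) (Y : List K),
    splitName X = some (p, Y) ↔ X = encodeProposition K p ++ Y
  | [], p, Y => by cases p <;> simp [splitName, encodeProposition]
  | [c], p, Y => by
      cases p with
      | nil => by_cases hc : c = 0 <;> simp [splitName, encodeProposition, hc, eq_comm]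
      | cons b p => by_cases hc : c = 0 <;> simp [splitName, encodeProposition, hc]
  | c :: d :: X, p, Y => by
      have ih := splitName_eq_some X
      cases p with
      | nil =>
        simp only [splitName]
        split_ifs <;> simp_all [encodeProposition, eq_comm]
      | cons b p =>
        have ih' := ih p Y
        simp only [encodeProposition] at ih'
        cases b <;> simp only [splitName] <;> split_ifs <;>
          simp_all [encodeProposition, bit]

theorem splitName_length {X Y : List K} {p : Proposition} (h : splitName X = some (p, Y)) :
    X.length = (encodeProposition K p).length + Y.length := by
  rw [(splitName_eq_some _ _ _).1 h, List.length_append]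

theorem Tries.while_step {body : Cmd K} {f : Regs K → Option (Regs K)} {o : Option (Regs K)}
    {t' : ℕ} (hE : s.r12 ≠ []) (H : Tries ord body s o t)
    (H' : ∀ s', o = some s' → Tries ord (whileNonempty 12 body) s' (f s') t') :
    Tries ord (whileNonempty 12 body) s (o.bind f) (t + t' + 2) := by
  cases o with
  | none =>
    obtain ⟨s', h1, h2, h3⟩ := H
    exact ⟨s', Does.mono (t := t + 1 + 1) (does_whileNonempty_cons hE h1
      (does_whileNonempty_nil (r := 12) (by simpa using h3)))
      (by omega), h2, h3⟩
  | some s' =>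
    exact (H' s' rfl).imp fun s₂ h => Does.mono (t := t + t' + 1)
      (does_whileNonempty_cons hE H.1 h) (by omega)

theorem tries_readName : ∀ (n : ℕ) (s : Regs K), s.r1.length ≤ n →
    Ready { s with r12 := [] } → s.r12 = [0] →
    Tries ord readName s ((splitName s.r1).map fun q =>
      { s with r1 := q.2, r4 := (encodeProposition K q.1).reverse ++ s.r4, r12 := [] })
      (30 * (n + 1)) := by
  intro n
  induction n using Nat.strong_induction_on with
  | _ n ih =>
  intro s hn hs hE
  obtain ⟨h0, h10, h11, -⟩ := hs
  simp only at h0 h10 h11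
  have hbody : Tries ord (popReg 12 ;;
      bitCase (push 4 0) (push 4 1 ;;
        bitCase (push 4 0 ;; push 12 0) (push 4 1 ;; push 12 0))) s
      (bitMatch (fun Y => some { s with r1 := Y, r4 := 0 :: s.r4, r12 := [] })
        (bitMatch (fun Y => some { s with r1 := Y, r4 := 0 :: 1 :: s.r4, r12 := [0] })
          (fun Y => some { s with r1 := Y, r4 := 1 :: 1 :: s.r4, r12 := [0] })) s.r1) 20 := by
    refine (tries_bitCase (s := { s with r12 := [] }) (t := 10) ⟨h0, h10, h11, rfl⟩
      (fun Y hY => ?_) (fun Y hY => ?_)).imp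
      fun s' H => Does.mono (Does.popReg_seq (by simpa using hE)
        (by simpa using H)) (by omega)
    · exact ⟨(does_push _ _ _).congr (by simp) |>.mono (by omega), h0⟩
    · refine (tries_bitCase (s := { s with r1 := Y, r4 := 1 :: s.r4, r12 := [] }) (t := 2)
        ⟨h0, h10, h11, rfl⟩ (fun Z hZ => ?_) (fun Z hZ => ?_)).imp
        fun s' H => (Does.push_seq (by simpa using H)).mono (by omega)
      · exact ⟨((Does.push_seq (does_push _ _ _)).congr (by simp)).mono (by omega), h0⟩
      · exact ⟨((Does.push_seq (does_push _ _ _)).congr (by simp)).mono (by omega), h0⟩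
  have hdone : ∀ s' : Regs K, s'.r12 = [] → s'.r0 = [] → Tries ord readName s' (some s') 1 :=
    fun s' h h' => ⟨does_whileNonempty_nil h, h'⟩
  have hne : s.r12 ≠ [] := by simp [hE]
  rcases hX : s.r1 with _ | ⟨c, _ | ⟨d, X⟩⟩
  · rw [hX] at hbody
    simp only [bitMatch] at hbody
    exact Tries.mono (t := 20 + 1 + 2) (hbody.while_step (f := some) hne (by simp)) (by omega)
  · rw [hX] at hbody
    by_cases hc : c = 0
    · subst hc
      simp only [bitMatch, splitName, if_true] at hbody ⊢
      refine Tries.mono (t := 20 + 1 + 2) (hbody.while_step (f := some) hne ?_) (by omega)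
      intro s' hs'
      simp only [Option.some.injEq] at hs'
      subst hs'
      exact hdone _ rfl h0
    · have : bitMatch (α := Regs K) (fun Y => some { s with r1 := Y, r4 := 0 :: s.r4, r12 := [] })
        (bitMatch (fun Y => some { s with r1 := Y, r4 := 0 :: 1 :: s.r4, r12 := [0] })
          (fun Y => some { s with r1 := Y, r4 := 1 :: 1 :: s.r4, r12 := [0] })) [c] = none := by
        simp [bitMatch, hc]
      rw [this] at hbody
      simp only [splitName, hc, if_false]
      exact Tries.mono (t := 20 + 1 + 2) (hbody.while_step (f := some) hne (by simp)) (by omega)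
  · rw [hX] at hbody hn
    simp only [List.length_cons] at hn
    simp only [splitName]
    by_cases hc : c = 0
    · subst hc
      simp only [bitMatch, if_true] at hbody ⊢
      refine Tries.mono (t := 20 + 1 + 2) (hbody.while_step (f := some) hne ?_) (by omega)
      intro s' hs'
      simp only [Option.some.injEq] at hs'
      subst hs'
      exact hdone _ rfl h0
    by_cases hc1 : c = 1
    · subst hc1
      simp only [bitMatch, if_true, one_ne_zero, if_false] at hbody ⊢
      by_cases hd : d = 0
      · subst hd
        simp only [if_true] at hbody ⊢
        have := hbody.while_step (t' := 30 * (X.length + 1)) hne (f := fun _ => _)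
          (by rintro s' ⟨⟩; exact ih X.length (by omega) _ le_rfl ⟨h0, h10, h11, rfl⟩ rfl)
        have := this.mono (show _ ≤ 30 * (n + 1) by omega)
        refine this.congr ?_
        cases splitName X <;> simp [encodeProposition, bit]
      · by_cases hd1 : d = 1
        · subst hd1
          simp only [if_true, one_ne_zero, if_false] at hbody ⊢
          have := hbody.while_step (t' := 30 * (X.length + 1)) hne (f := fun _ => _)
            (by rintro s' ⟨⟩; exact ih X.length (by omega) _ le_rfl ⟨h0, h10, h11, rfl⟩ rfl)
          have := this.mono (show _ ≤ 30 * (n + 1) by omega)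
          refine this.congr ?_
          cases splitName X <;> simp [encodeProposition, bit]
        · simp only [hd, hd1, if_false] at hbody ⊢
          exact Tries.mono (t := 20 + 1 + 2) (hbody.while_step (f := some) hne (by simp)) (by omega)
    · simp only [bitMatch, hc, hc1, if_false] at hbody ⊢
      exact Tries.mono (t := 20 + 1 + 2) (hbody.while_step (f := some) hne (by simp)) (by omega)

end

/-! ### Comparing a literal with the dictionary -/

section
variable {K : Type u} [Semiring K]

/-- Compare a symbol of a name in the dictionary with the current name. -/
def scanKey : Cmd K :=
  ifEmpty 4 (push 12 0) (ifEq 7 4 (moveTop 5 4) (moveTop 5 4 ;; push 12 0))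

/-- At a value in the dictionary, reject if the name in front of it is the current name and the
value is not the first guess. -/
def scanValue : Cmd K :=
  ifEmpty 4 skip (push 12 0) ;; ifEmpty 12 (ifEq 7 2 skip reject) (clear 12) ;; moveAll 4 5

/-- Compare the first guess with the values of all occurrences of the current name in the
dictionary. -/
def scan : Cmd K := whileNonempty 6 (ifEq 6 11 scanKey scanValue ;; moveTop 8 6 ;; moveTop 9 7)

/-- The content of the stack 6 that belongs to the dictionary `D`. -/
def dictFlags (D : List (List K × K)) : List K :=
  D.flatMap fun e => List.replicate e.1.length 1 ++ [0]

/-- The content of the stack 7 that belongs to the dictionary `D`. -/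
def dictSymbols (D : List (List K × K)) : List K := D.flatMap fun e => e.1 ++ [e.2]

open Classical in
/-- The contents of the stacks 4, 5 and 12 after the comparison of the name `k` with the stack 4. -/
noncomputable def compareName : List K → List K → List K → List K → List K × List K × List K
  | [], N, M, E => (N, M, E)
  | _ :: k, [], M, E => compareName k [] M (0 :: E)
  | c :: k, d :: N, M, E => compareName k N (d :: M) (if c = d then E else 0 :: E)

theorem compareName_restore : ∀ k N M E : List K,
    (compareName k N M E).2.1.reverse ++ (compareName k N M E).1 = M.reverse ++ N
  | [], N, M, E => rfl
  | _ :: k, [], M, E => compareName_restore k [] M _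
  | c :: k, d :: N, M, E => by
      simp only [compareName]
      rw [compareName_restore k N (d :: M) _]
      simp

theorem compareName_length : ∀ k N M E : List K,
    (compareName k N M E).2.1.length ≤ M.length + k.length ∧
    (compareName k N M E).2.2.length ≤ E.length + k.length
  | [], N, M, E => by simp [compareName]
  | _ :: k, [], M, E => by
      have := compareName_length k [] M (0 :: E)
      simp only [compareName, List.length_cons] at *
      omega
  | c :: k, d :: N, M, E => by
      simp only [compareName]
      split_ifs
      · have := compareName_length k N (d :: M) E
        simp only [List.length_cons] at *
        omega
      · have := compareName_length k N (d :: M) (0 :: E)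
        simp only [List.length_cons] at *
        omega

theorem compareName_eq_nil : ∀ k N M E : List K,
    ((compareName k N M E).1 = [] ∧ (compareName k N M E).2.2 = []) ↔ E = [] ∧ k = N
  | [], N, M, E => by simp [compareName, and_comm, eq_comm]
  | _ :: k, [], M, E => by simp [compareName, compareName_eq_nil k [] M]
  | c :: k, d :: N, M, E => by
      simp only [compareName]
      rw [compareName_eq_nil k N]
      split_ifs with h <;> simp [h]

end

section
variable {K : Type u} [Semiring K] [Nontrivial K] {ord : Option (SemiringOrder K)}

theorem does_scan_key : ∀ (k F W : List K) (s : Regs K), s.r11 = [1] →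
    s.r6 = List.replicate k.length 1 ++ F → s.r7 = k ++ W → ∀ (s' : Store K) (t : ℕ),
    Does ord scan { s with
      r4 := (compareName k s.r4 s.r5 s.r12).1, r5 := (compareName k s.r4 s.r5 s.r12).2.1,
      r12 := (compareName k s.r4 s.r5 s.r12).2.2, r6 := F, r7 := W,
      r8 := List.replicate k.length 1 ++ s.r8, r9 := k.reverse ++ s.r9 }.toStore s' t →
    Does ord scan s.toStore s' (20 * k.length + t) := by
  intro k
  induction k with
  | nil =>
    intro F W s h11 h6 h7 s' t H
    simp only [List.length_nil, List.replicate_zero, List.nil_append] at h6 h7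
    subst h6 h7
    simpa [compareName] using H
  | cons c k ih =>
    intro F W s h11 h6 h7 s' t H
    simp only [List.length_cons, List.replicate_succ, List.cons_append] at h6 h7
    have h6' : s.toStore 6 = 1 :: (List.replicate k.length 1 ++ F) := by simp [h6]
    have h7' : s.toStore 7 = c :: (k ++ W) := by simp [h7]
    have hcomm : List.replicate k.length (1 : K) ++ 1 :: s.r8 =
        1 :: (List.replicate k.length 1 ++ s.r8) := by
      rw [← List.cons_append, ← List.replicate_succ, List.replicate_succ', List.append_assoc]; rfl
    cases h4 : s.r4 with
    | nil =>
      have hb : Does ord (ifEq 6 11 scanKey scanValue ;; moveTop 8 6 ;; moveTop 9 7) s.toStore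
          { s with r12 := 0 :: s.r12, r6 := List.replicate k.length 1 ++ F, r7 := k ++ W,
                   r8 := 1 :: s.r8, r9 := c :: s.r9 }.toStore 15 := by
        refine ((Does.seq (does_ifEq_pos h6' (m := []) (by simp [h11])
          (does_ifEmpty_pos (by simp [h4]) (does_push _ 12 0))) (Does.moveTop_seq (by decide)
            (c := 1) (l := List.replicate k.length 1 ++ F) (by simp [h6])
          (does_moveTop (by decide) (c := c) (l := k ++ W) (by simp [h7])))).congr
          (by simp)).mono (by omega)
      refine (does_whileNonempty_cons (by simp [h6]) hb (ih F W
        { s with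
          r12 := 0 :: s.r12, r6 := List.replicate k.length 1 ++ F, r7 := k ++ W
          r8 := 1 :: s.r8, r9 := c :: s.r9 }
        h11 rfl rfl s' t ?_)).mono ?_
      · simp only [h4, compareName] at H ⊢
        simpa [List.replicate_succ, hcomm] using H
      · simp only [List.length_cons]; omega
    | cons d N =>
      have hb : Does ord (ifEq 6 11 scanKey scanValue ;; moveTop 8 6 ;; moveTop 9 7) s.toStore
          { s with r4 := N, r5 := d :: s.r5, r12 := (compareName [c] (d :: N) s.r5 s.r12).2.2,
                   r6 := List.replicate k.length 1 ++ F, r7 := k ++ W,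
                   r8 := 1 :: s.r8, r9 := c :: s.r9 }.toStore 15 := by
        by_cases hcd : c = d
        · subst hcd
          refine ((Does.seq (does_ifEq_pos h6' (m := []) (by simp [h11])
            (does_ifEmpty_neg (by simp [h4]) (does_ifEq_pos h7' (m := N) (by simp [h4])
              (does_moveTop (by decide) (c := c) (l := N) (by simp [h4])))))
            (Does.moveTop_seq (by decide)
              (c := 1) (l := List.replicate k.length 1 ++ F) (by simp [h6])
            (does_moveTop (by decide) (c := c) (l := k ++ W) (by simp [h7])))).congr
            (by simp [compareName])).mono (by omega)
        · refine ((Does.seq (does_ifEq_pos h6' (m := []) (by simp [h11])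
            (does_ifEmpty_neg (by simp [h4]) (does_ifEq_neg h7' (d := d) (m := N) (by simp [h4]) hcd
              (Does.moveTop_seq (by decide) (c := d) (l := N) (by simp [h4]) (does_push _ 12 0)))))
            (Does.moveTop_seq (by decide)
              (c := 1) (l := List.replicate k.length 1 ++ F) (by simp [h6])
            (does_moveTop (by decide) (c := c) (l := k ++ W) (by simp [h7])))).congr
            (by simp [compareName, hcd])).mono (by omega)
      refine (does_whileNonempty_cons (by simp [h6]) hb (ih F W
        { s with
          r4 := N, r5 := d :: s.r5, r12 := (compareName [c] (d :: N) s.r5 s.r12).2.2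
          r6 := List.replicate k.length 1 ++ F, r7 := k ++ W
          r8 := 1 :: s.r8, r9 := c :: s.r9 }
        h11 rfl rfl s' t ?_)).mono ?_
      · simp only [h4, compareName] at H ⊢
        simpa [List.replicate_succ, hcomm] using H
      · simp only [List.length_cons]; omega

theorem does_scanValue {s : Regs K} {v g : K} {G W : List K} (h7 : s.r7 = v :: W)
    (h2 : s.r2 = g :: G) :
    ∃ f : List K, (f = [] ↔ s.r0 = [] ∧ (s.r4 = [] ∧ s.r12 = [] → v = g)) ∧
      Does ord scanValue s.toStore
        { s with r0 := f, r12 := [], r4 := s.r5.reverse ++ s.r4, r5 := [] }.toStore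
        (2 * s.r12.length + 3 * s.r5.length + 10) := by
  cases h4 : s.r4 with
  | cons d N =>
    refine ⟨s.r0, by simp, ?_⟩
    exact ((Does.seq (does_ifEmpty_neg (by simp [h4]) (does_push _ 12 0))
      (Does.seq (does_ifEmpty_neg (by simp) (does_clear 12 (0 :: s.r12) _ (by simp)))
      (does_moveAll (by decide) s.r5 _ (by simp)))).congr (by simp [h4])).mono
      (by simp only [List.length_cons]; omega)
  | nil =>
    cases h12 : s.r12 with
    | cons d N =>
      refine ⟨s.r0, by simp, ?_⟩
      exact ((Does.seq (does_ifEmpty_pos (by simp [h4]) (does_skip _))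
        (Does.seq (does_ifEmpty_neg (by simp [h12]) (does_clear 12 (d :: N) _ (by simp [h12])))
        (does_moveAll (by decide) s.r5 _ (by simp)))).congr (by simp [h4])).mono
        (by simp only [List.length_cons]; omega)
    | nil =>
      by_cases hv : v = g
      · refine ⟨s.r0, by simp [hv], ?_⟩
        subst hv
        exact ((Does.seq (does_ifEmpty_pos (by simp [h4]) (does_skip _))
          (Does.seq (does_ifEmpty_pos (by simp [h12]) (does_ifEq_pos (r := 7) (s := 2) (c := v)
            (l := W) (m := G)
            (by simp only [Regs.toStore_7, h7]) (by simp only [Regs.toStore_2, h2]) (does_skip _)))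
          (does_moveAll (by decide) s.r5 _ (by simp)))).congr (by simp [h4, h12])).mono
          (by simp only [List.length_nil]; omega)
      · refine ⟨0 :: s.r0, by simp [hv], ?_⟩
        exact ((Does.seq (does_ifEmpty_pos (by simp [h4]) (does_skip _))
          (Does.seq (does_ifEmpty_pos (by simp [h12]) (does_ifEq_neg (r := 7) (s := 2)
            (l := W) (m := G)
            (by simp only [Regs.toStore_7, h7]) (by simp only [Regs.toStore_2, h2]) hv
            (does_push _ 0 0)))
          (does_moveAll (by decide) s.r5 _ (by simp)))).congr (by simp [h4, h12])).mono
          (by simp only [List.length_nil]; omega)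

theorem does_scan_entry {s : Regs K} {k F W G : List K} {v g : K} (h10 : s.r11 = [1])
    (h6 : s.r6 = List.replicate k.length 1 ++ 0 :: F) (h7 : s.r7 = k ++ v :: W)
    (h2 : s.r2 = g :: G) (h5 : s.r5 = []) (h12 : s.r12 = []) :
    ∃ f : List K, (f = [] ↔ s.r0 = [] ∧ (k = s.r4 → v = g)) ∧
      ∀ (s' : Store K) (t : ℕ), Does ord scan { s with
        r0 := f, r6 := F, r7 := W, r8 := 0 :: (List.replicate k.length 1 ++ s.r8),
        r9 := v :: (k.reverse ++ s.r9) }.toStore s' t →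
      Does ord scan s.toStore s' (30 * (k.length + 1) + t) := by
  have hl := compareName_length k s.r4 s.r5 s.r12
  have hr := compareName_restore k s.r4 s.r5 s.r12
  have he := compareName_eq_nil k s.r4 s.r5 s.r12
  obtain ⟨f, hf, H⟩ := does_scanValue (ord := ord) (v := v) (g := g) (W := W) (G := G)
    (s := { s with
      r4 := (compareName k s.r4 s.r5 s.r12).1, r5 := (compareName k s.r4 s.r5 s.r12).2.1,
      r12 := (compareName k s.r4 s.r5 s.r12).2.2, r6 := 0 :: F, r7 := v :: W,
      r8 := List.replicate k.length 1 ++ s.r8, r9 := k.reverse ++ s.r9 }) rfl h2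
  refine ⟨f, ?_, fun s' t Hs => ?_⟩
  · simp only at hf
    rw [hf, he, h12]
    simp
  · refine Does.mono (does_scan_key k (0 :: F) (v :: W) s h10 h6 h7 s' _
      (does_whileNonempty_cons (by simp) (Does.seq (does_ifEq_neg (c := 0) (d := 1) (l := F)
        (m := []) (by simp) (by simp [h10]) zero_ne_one H)
        (Does.moveTop_seq (by decide) (c := 0) (l := F) (by simp)
        (does_moveTop (by decide) (c := v) (l := W) (by simp)))) (σ'' := s') (t' := t) ?_)) ?_
    · simp only [h5, h12, List.reverse_nil, List.nil_append] at hr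
      change Does ord scan _ _ _
      simpa [hr, h5, h12] using Hs
    · simp only [h5, h12, List.length_nil] at hl ⊢
      omega

theorem does_scan : ∀ (D : List (List K × K)) (s : Regs K) (g : K) (G : List K), s.r11 = [1] →
    s.r6 = dictFlags D → s.r7 = dictSymbols D → s.r2 = g :: G → s.r5 = [] → s.r12 = [] →
    ∃ f : List K, (f = [] ↔ s.r0 = [] ∧ ∀ e ∈ D, e.1 = s.r4 → e.2 = g) ∧
      Does ord scan s.toStore { s with
        r0 := f, r6 := [], r7 := [], r8 := (dictFlags D).reverse ++ s.r8,
        r9 := (dictSymbols D).reverse ++ s.r9 }.toStore (30 * (dictSymbols D).length + 1) := by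
  intro D
  induction D with
  | nil =>
    intro s g G h11 h6 h7 h2 h5 h12
    refine ⟨s.r0, by simp, ?_⟩
    simp only [dictFlags, dictSymbols, List.flatMap_nil] at h6 h7 ⊢
    exact (does_whileNonempty_nil h6).congr (by cases s; simp_all)
  | cons e D ih =>
    intro s g G h11 h6 h7 h2 h5 h12
    obtain ⟨f, hf, H⟩ := does_scan_entry (ord := ord) (s := s) (k := e.1) (v := e.2)
      (F := dictFlags D) (W := dictSymbols D) h11 (by simp [h6, dictFlags])
      (by simp [h7, dictSymbols]) h2 h5 h12
    obtain ⟨f', hf', H'⟩ := ih { s with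
        r0 := f, r6 := dictFlags D, r7 := dictSymbols D,
        r8 := 0 :: (List.replicate e.1.length 1 ++ s.r8),
        r9 := e.2 :: (e.1.reverse ++ s.r9) } g G h11 rfl rfl h2 h5 h12
    refine ⟨f', ?_, ?_⟩
    · simp only at hf'
      rw [hf', hf]
      simp only [List.mem_cons, forall_eq_or_imp]
      rw [and_assoc]
    · refine ((H _ _ H').congr ?_).mono ?_
      · simp [dictFlags, dictSymbols]
      · simp [dictSymbols]; omega

end

/-! ### Evaluating a token -/

section
variable {K : Type u} [Semiring K]

/-- The data of the verifier: the rest of the guess, the values of the subformulas that are waiting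
for an operation, and the dictionary of the literals seen so far. -/
structure Valuation (K : Type u) : Type u where
  guess : List K
  values : List K
  dict : List (Literal × K)

open Classical in
/-- The effect of a token on the data of the verifier. A literal takes its value from the guess,
which has to agree with the values taken by earlier occurrences of the literal. -/
noncomputable def Token.step (ord : Option (SemiringOrder K)) :
    Token K → Valuation K → Option (Valuation K)
  | .lit l, ⟨g :: G, V, D⟩ =>
    if ∀ e ∈ D, e.1 = l → e.2 = g then some ⟨G, g :: V, (l, g) :: D⟩ else none
  | .const c, ⟨G, V, D⟩ => some ⟨G, c :: V, D⟩
  | .eq, ⟨G, b :: a :: V, D⟩ => some ⟨G, (if a = b then 1 else 0) :: V, D⟩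
  | .le, ⟨G, b :: a :: V, D⟩ =>
    if ord.isSome then some ⟨G, (if BranchTest ord a b then 1 else 0) :: V, D⟩ else none
  | .and, ⟨G, b :: a :: V, D⟩ => some ⟨G, (a * b) :: V, D⟩
  | .or, ⟨G, b :: a :: V, D⟩ => some ⟨G, (a + b) :: V, D⟩
  | _, _ => none

/-- The dictionary as it is stored on the stacks, with reversed names. -/
def reversedNames (D : List (Literal × K)) : List (List K × K) :=
  D.map fun e => ((literalKey K e.1).reverse, e.2)

/-- The contents of the stacks between two tokens. -/
def Valuation.regs (v : Valuation K) (X : List K) : Regs K where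
  r1 := X
  r2 := v.guess
  r3 := v.values
  r6 := dictFlags (reversedNames v.dict)
  r7 := dictSymbols (reversedNames v.dict)
  r10 := [0]
  r11 := [1]

/-- Move the first guess to the values and add it to the dictionary, with the name on the
stack 4. -/
def enterLiteral : Cmd K :=
  push 6 0 ;; pushTop 7 2 ;; moveTop 3 2 ;; moveAll 5 4 ;; whileNonempty 5 (push 6 1 ;; moveTop 7 5)

/-- Evaluate the literal whose name is on the stack 4. -/
def evalLiteral : Cmd K :=
  ifEmpty 2 reject (scan ;; moveAll 6 8 ;; moveAll 7 9 ;; ifEmpty 0 enterLiteral skip)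

/-- Apply a binary operation to the values. -/
def evalBinary (P : Cmd K) : Cmd K :=
  ifEmpty 3 reject (moveTop 5 3 ;; ifEmpty 3 reject (P ;; popReg 5))

/-- Replace the top of the stack 3 by `c`. -/
def setTop (c : K) : Cmd K := popReg 3 ;; push 3 c

/-- Process the next token of the formula. -/
def evalToken (ord : Option (SemiringOrder K)) : Cmd K :=
  bitCase
    (bitCase
      (bitCase ((push 4 0 ;; push 12 0 ;; readName) ;; ifEmpty 0 evalLiteral skip)
        ((push 4 1 ;; push 12 0 ;; readName) ;; ifEmpty 0 evalLiteral skip))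
      (bitCase (ifEmpty 1 reject (moveTop 3 1)) (evalBinary (ifEq 3 5 (setTop 1) (setTop 0)))))
    (bitCase
      (bitCase (if ord.isSome then evalBinary (ifTest 3 5 (setTop 1) (setTop 0)) else reject)
        (evalBinary (mulTop 3 5)))
      (bitCase (evalBinary (addTop 3 5)) reject))

/-- The effect of `evalToken` for a given rest of the formula. -/
noncomputable def evalTokenResult (ord : Option (SemiringOrder K)) (v : Valuation K) :
    List K → Option (Regs K) :=
  let op (τ : Token K) (Y : List K) : Option (Regs K) := (τ.step ord v).map fun v' => v'.regs Y
  bitMatch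
    (bitMatch
      (bitMatch (fun Y => (splitName Y).bind fun q => op (.lit (.pos q.1)) q.2)
        (fun Y => (splitName Y).bind fun q => op (.lit (.neg q.1)) q.2))
      (bitMatch (fun Y => match Y with | [] => none | c :: Y' => op (.const c) Y') (op .eq)))
    (bitMatch (bitMatch (op .le) (op .and)) (bitMatch (op .or) fun _ => none))

theorem dictSymbols_length (D : List (List K × K)) :
    (dictFlags D).length = (dictSymbols D).length := by
  induction D with
  | nil => rfl
  | cons e D ih => simp_all [dictFlags, dictSymbols]

end

section
variable {K : Type u} [Semiring K] [Nontrivial K] {ord : Option (SemiringOrder K)} {P Q : Cmd K}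
  {s : Regs K} {t : ℕ}

theorem bitMatch_eq_some {α : Type*} {a b : List K → Option α} {X : List K} {r : α} :
    bitMatch a b X = some r ↔
      (∃ Y, X = 0 :: Y ∧ a Y = some r) ∨ ∃ Y, X = 1 :: Y ∧ b Y = some r := by
  cases X with
  | nil => simp [bitMatch]
  | cons c Y =>
    simp only [bitMatch, List.cons.injEq]
    split_ifs with h h1
    · subst h; simp [zero_ne_one]
    · subst h1; simp
    · simp [h, h1]

theorem evalTokenResult_eq_some (v : Valuation K) (X : List K) (r : Regs K) :
    evalTokenResult ord v X = some r ↔ ∃ (τ : Token K) (Y : List K) (v' : Valuation K),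
      X = τ.encode ++ Y ∧ τ.step ord v = some v' ∧ r = v'.regs Y := by
  simp only [evalTokenResult, bitMatch_eq_some]
  constructor
  · rintro (⟨X, rfl, ⟨X, rfl, h⟩ | ⟨X, rfl, h⟩⟩ | ⟨X, rfl, ⟨X, rfl, h⟩ | ⟨X, rfl, h⟩⟩)
    · obtain ⟨Z, rfl, h⟩ | ⟨Z, rfl, h⟩ := h <;>
        simp only [Option.bind_eq_some_iff, Option.map_eq_some_iff, Prod.exists] at h <;>
        obtain ⟨p, Y, h1, v', h2, rfl⟩ := h <;> rw [splitName_eq_some] at h1 <;> subst h1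
      · exact ⟨.lit (.pos p), Y, v', rfl, h2, rfl⟩
      · exact ⟨.lit (.neg p), Y, v', rfl, h2, rfl⟩
    · obtain ⟨Z, rfl, h⟩ | ⟨Z, rfl, h⟩ := h
      · cases Z with
        | nil => simp at h
        | cons c Z =>
          obtain ⟨v', h1, rfl⟩ := Option.map_eq_some_iff.1 h
          exact ⟨.const c, Z, v', rfl, h1, rfl⟩
      · obtain ⟨v', h1, rfl⟩ := Option.map_eq_some_iff.1 h
        exact ⟨.eq, Z, v', rfl, h1, rfl⟩
    · obtain ⟨Z, rfl, h⟩ | ⟨Z, rfl, h⟩ := h <;> obtain ⟨v', h1, rfl⟩ := Option.map_eq_some_iff.1 h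
      · exact ⟨.le, Z, v', rfl, h1, rfl⟩
      · exact ⟨.and, Z, v', rfl, h1, rfl⟩
    · obtain ⟨Z, rfl, h⟩ | ⟨Z, rfl, h⟩ := h
      · obtain ⟨v', h1, rfl⟩ := Option.map_eq_some_iff.1 h
        exact ⟨.or, Z, v', rfl, h1, rfl⟩
      · simp at h
  · rintro ⟨τ, Y, v', rfl, h1, rfl⟩
    rcases τ with (p | p) | c | _ | _ | _ | _
    · exact .inl ⟨_, rfl, .inl ⟨_, rfl, .inl ⟨_, rfl, by
        simp [(splitName_eq_some _ p Y).2 rfl, h1]⟩⟩⟩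
    · exact .inl ⟨_, rfl, .inl ⟨_, rfl, .inr ⟨_, rfl, by
        simp [(splitName_eq_some _ p Y).2 rfl, h1]⟩⟩⟩
    · exact .inl ⟨_, rfl, .inr ⟨_, rfl, .inl ⟨_, rfl, by simp [h1]⟩⟩⟩
    · exact .inl ⟨_, rfl, .inr ⟨_, rfl, .inr ⟨_, rfl, by simp [h1]⟩⟩⟩
    · exact .inr ⟨_, rfl, .inl ⟨_, rfl, .inl ⟨_, rfl, by simp [h1]⟩⟩⟩
    · exact .inr ⟨_, rfl, .inl ⟨_, rfl, .inr ⟨_, rfl, by simp [h1]⟩⟩⟩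
    · exact .inr ⟨_, rfl, .inr ⟨_, rfl, .inl ⟨_, rfl, by simp [h1]⟩⟩⟩

theorem Tries.seq {f : Regs K → Option (Regs K)} {o : Option (Regs K)} {t' : ℕ}
    (H : Tries ord P s o t) (H' : ∀ s', o = some s' → Tries ord Q s' (f s') t') :
    Tries ord (P ;; ifEmpty 0 Q skip) s (o.bind f) (t + t' + 2) := by
  cases o with
  | none =>
    obtain ⟨s', h1, h2, h3⟩ := H
    exact ⟨s', (h1.seq (does_ifEmpty_neg (r := 0) h2 (does_skip _))).mono (by omega), h2, h3⟩
  | some s' =>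
    exact (H' s' rfl).imp fun s₂ h => (H.1.seq (does_ifEmpty_pos (r := 0) H.2 h)).mono (by omega)

theorem does_enterLoop : ∀ (N : List K) (s : Regs K), s.r5 = N →
    Does ord (whileNonempty 5 (push 6 1 ;; moveTop 7 5)) s.toStore
      { s with r5 := [], r6 := List.replicate N.length 1 ++ s.r6, r7 := N.reverse ++ s.r7 }.toStore
      (4 * N.length + 1)
  | [], s, h => (does_whileNonempty_nil h).congr (by cases s; simp_all)
  | c :: N, s, h => by
      refine ((does_whileNonempty_cons (by simp [h]) ((Does.push_seq (does_moveTop (by decide)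
        (c := c) (l := N) (by simp [h]))).congr (by simp)) (does_enterLoop N
          { s with r5 := N, r6 := 1 :: s.r6, r7 := c :: s.r7 } rfl)).congr ?_).mono ?_
      · simp only [List.length_cons, List.replicate_succ', List.reverse_cons, List.append_assoc]
        rfl
      · simp only [List.length_cons]; omega

theorem does_enterLiteral {s : Regs K} {g : K} {G : List K} (h2 : s.r2 = g :: G)
    (h5 : s.r5 = []) :
    Does ord enterLiteral s.toStore
      { s with r2 := G, r3 := g :: s.r3, r4 := [], r5 := [],
               r6 := List.replicate s.r4.length 1 ++ 0 :: s.r6,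
               r7 := s.r4 ++ g :: s.r7 }.toStore (7 * s.r4.length + 10) := by
  have H := does_enterLoop (ord := ord) s.r4.reverse
    { s with r2 := G, r3 := g :: s.r3, r4 := [], r5 := s.r4.reverse, r6 := 0 :: s.r6,
             r7 := g :: s.r7 } rfl
  rw [List.length_reverse, List.reverse_reverse] at H
  refine Does.mono (t := 1 + (1 + (2 + (3 * s.r4.length + 1 + (4 * s.r4.length + 1))))) ?_
    (by omega)
  refine Does.push_seq (Does.pushTop_seq (s := 2) (c := g) (l := G) (by simp [h2])
    (Does.moveTop_seq (s := 2) (c := g) (l := G) (by decide) (by simp [h2])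
    ((does_moveAll (by decide) s.r4 _ (by simp)).seq ?_)))
  simpa [h5] using H

theorem tries_evalLiteral (v : Valuation K) (Y : List K) (l : Literal) :
    Tries ord evalLiteral { v.regs Y with r4 := (literalKey K l).reverse }
      (((Token.lit l).step ord v).map fun v' => v'.regs Y)
      (40 * ((dictSymbols (reversedNames v.dict)).length + (literalKey K l).length + 1)) := by
  obtain ⟨G, V, D⟩ := v
  cases G with
  | nil =>
    refine (tries_reject (s := { (Valuation.mk [] V D).regs Y with
      r4 := (literalKey K l).reverse }) rfl).imp fun s' h => ?_
    exact (does_ifEmpty_pos (by simp [Valuation.regs]) h).mono (by omega)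
  | cons g G =>
    obtain ⟨f, hf, H⟩ := does_scan (ord := ord) (reversedNames D)
      { r1 := Y, r2 := g :: G, r3 := V, r4 := (literalKey K l).reverse,
        r6 := dictFlags (reversedNames D), r7 := dictSymbols (reversedNames D), r10 := [0],
        r11 := [1] } g G rfl rfl rfl rfl rfl rfl
    have hf' : f = [] ↔ ∀ e ∈ D, e.1 = l → e.2 = g := by
      rw [hf]
      simp only [reversedNames, List.mem_map, forall_exists_index, and_imp,
        forall_apply_eq_imp_iff₂, List.reverse_inj, true_and,
        (literalKey_injective (K := K)).eq_iff]
    have hlen := dictSymbols_length (reversedNames D)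
    have H2 : ∀ s' t, Does ord (ifEmpty 0 enterLiteral skip)
        ({ r0 := f, r1 := Y, r2 := g :: G, r3 := V, r4 := (literalKey K l).reverse,
           r6 := dictFlags (reversedNames D), r7 := dictSymbols (reversedNames D), r10 := [0],
           r11 := [1] } : Regs K).toStore s' t →
        Does ord evalLiteral { (Valuation.mk (g :: G) V D).regs Y with
          r4 := (literalKey K l).reverse }.toStore s'
          (36 * (dictSymbols (reversedNames D)).length + 10 + t) := by
      intro s' t h
      refine (does_ifEmpty_neg (by simp) (H.seq (Does.moveAll_seq (by decide)
        (Does.moveAll_seq (by decide) (t := t) ?_)))).mono ?_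
      · simpa using h
      · simp [hlen]; omega
    by_cases hc : ∀ e ∈ D, e.1 = l → e.2 = g
    · rw [hf'.2 hc] at H2
      simp only [Token.step, if_pos hc, Option.map_some]
      refine ⟨?_, rfl⟩
      refine (H2 _ _ (does_ifEmpty_pos (by simp) (does_enterLiteral rfl rfl))).congr ?_ |>.mono ?_
      · simp [Valuation.regs, reversedNames, dictFlags, dictSymbols]
      · simp; omega
    · simp only [Token.step, if_neg hc, Option.map_none]
      exact ⟨_, (H2 _ _ (does_ifEmpty_neg (by simpa [hf'] using hc) (does_skip _))).mono (by omega),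
        by simpa [hf'] using hc, rfl⟩

theorem tries_evalBinary {τ : Token K} {v : Valuation K} {Y : List K} {P : Cmd K}
    {op : K → K → K}
    (hP : ∀ (s : Regs K) a b l m, s.r3 = a :: l → s.r5 = b :: m →
      Does ord P s.toStore { s with r3 := op a b :: l }.toStore t)
    (h0 : v.values = [] → τ.step ord v = none) (h1 : ∀ b, v.values = [b] → τ.step ord v = none)
    (h2 : ∀ a b V, v.values = b :: a :: V →
      τ.step ord v = some { v with values := op a b :: V }) :
    Tries ord (evalBinary P) (v.regs Y) ((τ.step ord v).map fun v' => v'.regs Y) (t + 10) := by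
  obtain ⟨G, V, D⟩ := v
  rcases V with _ | ⟨b, _ | ⟨a, V⟩⟩
  · rw [h0 rfl]
    exact (tries_reject rfl).imp fun s' h => (does_ifEmpty_pos (by simp [Valuation.regs]) h).mono
      (by omega)
  · rw [h1 b rfl]
    refine (tries_reject (s := { (Valuation.mk G [] D).regs Y with r5 := [b] }) rfl).imp
      fun s' h => Does.mono (t := 2 + (1 + 1) + 1) ?_ (by omega)
    refine does_ifEmpty_neg (by simp [Valuation.regs]) (Does.moveTop_seq (c := b) (l := [])
      (by decide) (by simp [Valuation.regs]) (does_ifEmpty_pos (by simp) ?_))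
    simpa [Valuation.regs] using h
  · rw [h2 a b V rfl]
    refine ⟨Does.mono (t := 2 + (t + 1 + 1) + 1) ?_ (by omega), rfl⟩
    refine does_ifEmpty_neg (by simp [Valuation.regs]) (Does.moveTop_seq (c := b) (l := a :: V)
      (by decide) (by simp [Valuation.regs]) (does_ifEmpty_neg (by simp) ?_))
    have := (hP { (Valuation.mk G (a :: V) D).regs Y with r5 := [b] } a b V [] rfl rfl).seq
      (does_popReg (r := 5) (c := b) (l := []) (by simp))
    simpa [Valuation.regs] using this

theorem does_setTop {s : Regs K} {a : K} {l : List K} (c : K) (h : s.r3 = a :: l) :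
    Does ord (setTop c) s.toStore { s with r3 := c :: l }.toStore 2 :=
  (Does.popReg_seq (c := a) (l := l) (by simp [h]) (does_push _ 3 c)).congr (by simp)

theorem tries_evalName (v : Valuation K) (Y : List K) (sign : Proposition → Literal) (c : K)
    (hsign : ∀ p, literalKey K (sign p) = c :: encodeProposition K p) {B : ℕ}
    (hB : Y.length + 2 + (dictSymbols (reversedNames v.dict)).length ≤ B) :
    Tries ord ((push 4 c ;; push 12 0 ;; readName) ;; ifEmpty 0 evalLiteral skip) (v.regs Y)
      ((splitName Y).bind fun q =>
        ((Token.lit (sign q.1)).step ord v).map fun v' => v'.regs q.2) (100 * (B + 1)) := by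
  have H := (tries_readName (ord := ord) Y.length { v.regs Y with r4 := [c], r12 := [0] } le_rfl
    ⟨rfl, rfl, rfl, rfl⟩ rfl).imp (Q := push 4 c ;; push 12 0 ;; readName) (s₂ := v.regs Y)
    (t' := 1 + (1 + 30 * (Y.length + 1))) fun s' h => Does.push_seq (Does.push_seq
      (by simpa [Valuation.regs] using h))
  have hY : ({ v.regs Y with r4 := [c], r12 := [0] } : Regs K).r1 = Y := rfl
  rw [hY] at H
  cases hq : splitName Y with
  | none =>
    rw [hq] at H
    exact (H.seq (f := some) (t' := 0) (by simp)).mono (by omega)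
  | some q =>
    rw [hq] at H
    have hl := splitName_length hq
    have hk := tries_evalLiteral (ord := ord) v q.2 (sign q.1)
    refine (H.seq (f := fun _ => ((Token.lit (sign q.1)).step ord v).map fun v' => v'.regs q.2)
      (t' := 40 * ((dictSymbols (reversedNames v.dict)).length +
        (literalKey K (sign q.1)).length + 1)) ?_).mono ?_
    · rintro s' ⟨⟩
      rw [hsign] at hk ⊢
      simpa [Valuation.regs] using hk
    · rw [hsign, List.length_cons]
      omega

theorem tries_evalToken (v : Valuation K) (X : List K) {B : ℕ}
    (hB : X.length + (dictSymbols (reversedNames v.dict)).length ≤ B) :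
    Tries ord (evalToken ord) (v.regs X) (evalTokenResult ord v X) (100 * (B + 1) + 50) := by
  obtain ⟨G, V, D⟩ := v
  set v : Valuation K := ⟨G, V, D⟩ with hv
  have hR : ∀ Y, Ready (v.regs Y) := fun Y => ⟨rfl, rfl, rfl, rfl⟩
  have hbit : ∀ {P Q : Cmd K} {a b : List K → Option (Regs K)} {Z : List K} {t : ℕ},
      (∀ Y, Z = 0 :: Y → Tries ord P (v.regs Y) (a Y) t) →
      (∀ Y, Z = 1 :: Y → Tries ord Q (v.regs Y) (b Y) t) →
      Tries ord (bitCase P Q) (v.regs Z) (bitMatch a b Z) (t + 7) :=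
    fun ha hb => tries_bitCase (hR _) ha hb
  have hcond : ∀ (s : Regs K) (a b : K) (l m : List K), s.r3 = a :: l → s.r5 = b :: m →
      Does ord (ifEq 3 5 (setTop 1) (setTop 0)) s.toStore
        { s with r3 := (open Classical in if a = b then 1 else 0) :: l }.toStore 4 := by
    intro s a b l m h3 h5
    by_cases hab : a = b
    · rw [if_pos hab]
      exact does_ifEq_pos (c := a) (by simpa using h3) (by rw [hab]; simpa using h5)
        (does_setTop 1 h3)
    · rw [if_neg hab]
      exact does_ifEq_neg (by simpa using h3) (by simpa using h5) hab (does_setTop 0 h3)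
  have hcond' : ∀ (s : Regs K) (a b : K) (l m : List K), s.r3 = a :: l → s.r5 = b :: m →
      Does ord (ifTest 3 5 (setTop 1) (setTop 0)) s.toStore
        { s with r3 := (open Classical in if BranchTest ord a b then 1 else 0) :: l }.toStore 3 := by
    intro s a b l m h3 h5
    by_cases hab : BranchTest ord a b
    · rw [if_pos hab]
      exact does_ifTest_pos (by simpa using h3) (by simpa using h5) hab (does_setTop 1 h3)
    · rw [if_neg hab]
      exact does_ifTest_neg (by simpa using h3) (by simpa using h5) hab (does_setTop 0 h3)
  refine Tries.mono (hbit (t := 100 * (B + 1) + 14) (fun Y hY => ?_) (fun Y hY => ?_))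
    (by omega) <;>
    subst hY <;> refine hbit (fun Y hY => ?_) (fun Y hY => ?_) <;> subst hY <;>
    refine hbit (fun Y hY => ?_) (fun Y hY => ?_) <;> subst hY <;>
    simp only [List.length_cons] at hB
  · exact tries_evalName v Y .pos 0 (fun _ => rfl) (by omega)
  · exact tries_evalName v Y .neg 1 (fun _ => rfl) (by omega)
  · cases Y with
    | nil =>
      exact (tries_reject rfl).imp fun s' h => (does_ifEmpty_pos (by simp [Valuation.regs]) h).mono
        (by omega)
    | cons c Y =>
      refine ⟨Does.mono (t := 2 + 1) ?_ (by omega), rfl⟩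
      exact (does_ifEmpty_neg (by simp [Valuation.regs]) (does_moveTop (by decide) (c := c) (l := Y)
        (by simp [Valuation.regs]))).congr (by simp [hv, Valuation.regs])
  · exact (tries_evalBinary hcond (by rintro rfl; rfl) (by rintro b rfl; rfl)
      (by rintro a b V rfl; rfl)).mono (by omega)
  · cases ho : ord.isSome with
    | true =>
      rw [if_pos rfl]
      exact (tries_evalBinary hcond' (by rintro rfl; rfl) (by rintro b rfl; rfl)
        (by rintro a b V rfl; simp [hv, Token.step, ho])).mono (by omega)
    | false =>
      have : Token.le.step ord v = none := by
        rcases V with _ | ⟨b, _ | ⟨a, V⟩⟩ <;> simp [hv, Token.step, ho]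
      beta_reduce
      rw [this]
      exact (tries_reject rfl).mono (by omega)
  · exact (tries_evalBinary (op := fun a b => a * b) (fun s a b l m h3 h5 => does_mulTop
      (σ := s.toStore) (r := 3) (s := 5) h3 h5 |>.congr (by simp)) (by rintro rfl; rfl)
      (by rintro b rfl; rfl) (by rintro a b V rfl; rfl)).mono (by omega)
  · exact (tries_evalBinary (op := fun a b => a + b) (fun s a b l m h3 h5 => does_addTop
      (σ := s.toStore) (r := 3) (s := 5) h3 h5 |>.congr (by simp)) (by rintro rfl; rfl)
      (by rintro b rfl; rfl) (by rintro a b V rfl; rfl)).mono (by omega)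
  · exact (tries_reject rfl).mono (by omega)

end

/-! ### Satisfiability is in NP -/

section
variable {K : Type u} [Semiring K]

/-- The effect of a string of tokens on the data of the verifier. -/
noncomputable def stepTokens (ord : Option (SemiringOrder K)) :
    List (Token K) → Valuation K → Option (Valuation K)
  | [], v => some v
  | τ :: l, v => (τ.step ord v).bind (stepTokens ord l)

/-- Process the tokens of the formula until it is finished or rejected. -/
def verifyLoop (ord : Option (SemiringOrder K)) : Cmd K :=
  whileNonempty 1 (evalToken ord ;; ifEmpty 0 skip (clear 1))

/-- Split the input into the formula and the guess, which have the same length. -/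
def splitInput : Cmd K :=
  whileNonempty 0 (push 4 0 ;; moveTop 3 0) ;; moveAll 0 3 ;;
    whileNonempty 4 (popReg 4 ;; popReg 4 ;; moveTop 2 0) ;; moveAll 1 0 ;; push 10 0 ;; push 11 1

/-- Put the value of the formula on the top of the stack 3, or zero if the input is rejected. -/
def formulaValue : Cmd K :=
  ifEmpty 0 (ifEmpty 3 (push 3 0) (moveTop 5 3 ;; ifEmpty 3 (moveTop 3 5) (push 3 0))) (push 3 0)

/-- The literals of a formula in the order of their occurrences. -/
def Formula.literals {ord : Option (SemiringOrder K)} : Formula ord → List Literal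
  | .lit l => [l]
  | .const _ => []
  | .eq φ ψ => φ.literals ++ ψ.literals
  | .le _ φ ψ => φ.literals ++ ψ.literals
  | .and φ ψ => φ.literals ++ ψ.literals
  | .or φ ψ => φ.literals ++ ψ.literals

theorem Formula.length_literals_le {ord : Option (SemiringOrder K)} (φ : Formula ord) :
    φ.literals.length ≤ φ.encode.length := by
  induction φ with
  | lit l => cases l <;> simp [literals, encode, encodeLiteral]
  | const => simp [literals]
  | _ => simp only [literals, encode, List.length_append] at *; omega

theorem branchTest_iff_le {ord : Option (SemiringOrder K)} (h : ord.isSome) (a b : K) :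
    BranchTest ord a b ↔ (ord.get h).Le a b := by
  cases ord with
  | none => simp at h
  | some o => rfl

variable {ord : Option (SemiringOrder K)}

/-- An accepted token acts on the values of formulas under every assignment that agrees with the
dictionary. -/
theorem Token.step_sound {τ : Token K} {v v' : Valuation K} (h : τ.step ord v = some v') :
    v.dict ⊆ v'.dict ∧
    ((∀ e ∈ v.dict, ∀ e' ∈ v.dict, e.1 = e'.1 → e.2 = e'.2) →
      ∀ e ∈ v'.dict, ∀ e' ∈ v'.dict, e.1 = e'.1 → e.2 = e'.2) ∧
    ∀ (s : Literal → K) (Φ : List (Formula ord)), (∀ e ∈ v'.dict, s e.1 = e.2) →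
      v.values = Φ.map (Formula.eval s) →
      ∃ Φ', τ.apply ord Φ = some Φ' ∧ v'.values = Φ'.map (Formula.eval s) := by
  obtain ⟨G, V, D⟩ := v
  have hbin : ∀ {s : Literal → K} {Φ : List (Formula ord)} {b a : K} {V : List K},
      b :: a :: V = Φ.map (Formula.eval s) → ∃ ψ φ Φ', Φ = ψ :: φ :: Φ' ∧ b = ψ.eval s ∧
        a = φ.eval s ∧ V = Φ'.map (Formula.eval s) := by
    intro s Φ b a V hV
    rcases Φ with _ | ⟨ψ, _ | ⟨φ, Φ⟩⟩ <;> simp at hV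
    exact ⟨ψ, φ, Φ, rfl, hV⟩
  cases τ with
  | lit l =>
    cases G with
    | nil => simp [Token.step] at h
    | cons g G =>
      simp only [Token.step] at h
      split_ifs at h with hc
      obtain rfl := Option.some.inj h
      refine ⟨fun e he => List.mem_cons_of_mem _ he, fun hD e he e' he' hee => ?_,
        fun s Φ hs hV => ⟨.lit l :: Φ, rfl, ?_⟩⟩
      · rcases List.mem_cons.1 he with rfl | he <;> rcases List.mem_cons.1 he' with rfl | he'
        · rfl
        · exact (hc e' he' hee.symm).symm
        · exact hc e he hee
        · exact hD e he e' he' hee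
      · simp only at hV
        simp [Formula.eval, hV, hs (l, g) (List.mem_cons_self ..)]
  | const c =>
    obtain rfl := Option.some.inj h
    exact ⟨fun _ h => h, fun h => h, fun s Φ hs hV =>
      ⟨.const c :: Φ, rfl, by simp only at hV; simp [Formula.eval, hV]⟩⟩
  | le =>
    rcases V with _ | ⟨b, _ | ⟨a, V⟩⟩
    · simp [Token.step] at h
    · simp [Token.step] at h
    simp only [Token.step] at h
    by_cases ho : ord.isSome
    swap
    · rw [if_neg ho] at h; cases h
    rw [if_pos ho] at h
    obtain rfl := Option.some.inj h
    refine ⟨fun _ h => h, fun h => h, fun s Φ hs hV => ?_⟩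
    obtain ⟨ψ, φ, Φ', rfl, rfl, rfl, rfl⟩ := hbin hV
    exact ⟨.le ho φ ψ :: Φ', by simp [Token.apply, ho],
      by classical exact congrArg (· :: _) (if_congr (branchTest_iff_le ho _ _) rfl rfl)⟩
  | _ =>
    rcases V with _ | ⟨b, _ | ⟨a, V⟩⟩
    · simp [Token.step] at h
    · simp [Token.step] at h
    obtain rfl := Option.some.inj h
    refine ⟨fun _ h => h, fun h => h, fun s Φ hs hV => ?_⟩
    obtain ⟨ψ, φ, Φ', rfl, rfl, rfl, rfl⟩ := hbin hV
    exact ⟨_, rfl, by simp [Formula.eval]⟩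

theorem stepTokens_sound : ∀ (l : List (Token K)) (v v' : Valuation K),
    stepTokens ord l v = some v' → v.dict ⊆ v'.dict ∧
    ((∀ e ∈ v.dict, ∀ e' ∈ v.dict, e.1 = e'.1 → e.2 = e'.2) →
      ∀ e ∈ v'.dict, ∀ e' ∈ v'.dict, e.1 = e'.1 → e.2 = e'.2) ∧
    ∀ (s : Literal → K) (Φ : List (Formula ord)), (∀ e ∈ v'.dict, s e.1 = e.2) →
      v.values = Φ.map (Formula.eval s) →
      ∃ Φ', applyTokens ord l Φ = some Φ' ∧ v'.values = Φ'.map (Formula.eval s)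
  | [], v, v', h => by
      obtain rfl := Option.some.inj h
      exact ⟨fun _ h => h, fun h => h, fun s Φ _ hV => ⟨Φ, rfl, hV⟩⟩
  | τ :: l, v, v', h => by
      obtain ⟨v₁, h1, h2⟩ := Option.bind_eq_some_iff.1 h
      obtain ⟨a1, a2, a3⟩ := Token.step_sound h1
      obtain ⟨b1, b2, b3⟩ := stepTokens_sound l v₁ v' h2
      refine ⟨fun e he => b1 (a1 he), fun hD => b2 (a2 hD), fun s Φ hs hV => ?_⟩
      obtain ⟨Φ₁, h3, h4⟩ := a3 s Φ (fun e he => hs e (b1 he)) hV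
      obtain ⟨Φ₂, h5, h6⟩ := b3 s Φ₁ hs h4
      exact ⟨Φ₂, by rw [applyTokens, h3]; exact h5, h6⟩

/-- If the guess consists of the values of the literals under the assignment `s`, then the tokens
of a formula compute its value. -/
theorem stepTokens_complete (s : Literal → K) (φ : Formula ord) :
    ∀ (l : List (Token K)) (G V : List K) (D : List (Literal × K)), (∀ e ∈ D, s e.1 = e.2) →
    ∃ D', (∀ e ∈ D', s e.1 = e.2) ∧
      stepTokens ord (φ.tokens ++ l) ⟨φ.literals.map s ++ G, V, D⟩ =
        stepTokens ord l ⟨G, φ.eval s :: V, D'⟩ := by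
  have hbin : ∀ {φ ψ : Formula ord} {τ : Token K} {y : K},
      (∀ (l : List (Token K)) (G V : List K) (D : List (Literal × K)), (∀ e ∈ D, s e.1 = e.2) →
        ∃ D', (∀ e ∈ D', s e.1 = e.2) ∧
        stepTokens ord (φ.tokens ++ l) ⟨φ.literals.map s ++ G, V, D⟩ =
          stepTokens ord l ⟨G, φ.eval s :: V, D'⟩) →
      (∀ (l : List (Token K)) (G V : List K) (D : List (Literal × K)), (∀ e ∈ D, s e.1 = e.2) →
        ∃ D', (∀ e ∈ D', s e.1 = e.2) ∧
        stepTokens ord (ψ.tokens ++ l) ⟨ψ.literals.map s ++ G, V, D⟩ =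
          stepTokens ord l ⟨G, ψ.eval s :: V, D'⟩) →
      (∀ G V D, τ.step ord ⟨G, ψ.eval s :: φ.eval s :: V, D⟩ = some ⟨G, y :: V, D⟩) →
      ∀ (l : List (Token K)) (G V : List K) (D : List (Literal × K)), (∀ e ∈ D, s e.1 = e.2) →
        ∃ D', (∀ e ∈ D', s e.1 = e.2) ∧
        stepTokens ord ((φ.tokens ++ ψ.tokens ++ [τ]) ++ l)
          ⟨(φ.literals ++ ψ.literals).map s ++ G, V, D⟩ = stepTokens ord l ⟨G, y :: V, D'⟩ := by
    intro φ ψ τ y h1 h2 h3 l G V D hD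
    simp only [List.append_assoc, List.map_append]
    obtain ⟨D₁, hD₁, e1⟩ := h1 (ψ.tokens ++ ([τ] ++ l)) (ψ.literals.map s ++ G) V D hD
    obtain ⟨D₂, hD₂, e2⟩ := h2 ([τ] ++ l) G (φ.eval s :: V) D₁ hD₁
    exact ⟨D₂, hD₂, by rw [e1, e2, List.singleton_append, stepTokens, h3]; rfl⟩
  induction φ with
  | lit l =>
    intro m G V D hD
    refine ⟨(l, s l) :: D, by simpa using hD, ?_⟩
    have : ∀ e ∈ D, e.1 = l → e.2 = s l := fun e he hl => by rw [← hD e he, hl]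
    simp only [Formula.tokens, Formula.literals, List.map_cons, List.map_nil, List.cons_append,
      List.nil_append, stepTokens, Token.step, if_pos this, Option.bind_some, Formula.eval]
  | const c =>
    intro m G V D hD
    exact ⟨D, hD, rfl⟩
  | le h φ ψ h1 h2 =>
    refine hbin h1 h2 fun G V D => ?_
    simp only [Token.step, h, if_true, Formula.eval]
    classical rw [if_congr (branchTest_iff_le h _ _) rfl rfl]
  | eq φ ψ h1 h2 => exact hbin h1 h2 fun G V D => by simp [Token.step, Formula.eval]
  | and φ ψ h1 h2 => exact hbin h1 h2 fun G V D => by simp [Token.step, Formula.eval]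
  | or φ ψ h1 h2 => exact hbin h1 h2 fun G V D => by simp [Token.step, Formula.eval]

theorem Token.step_size {τ : Token K} {v v' : Valuation K} (h : τ.step ord v = some v') :
    (dictSymbols (reversedNames v'.dict)).length ≤
      (dictSymbols (reversedNames v.dict)).length + τ.encode.length := by
  obtain ⟨G, V, D⟩ := v
  cases τ with
  | lit l =>
    cases G with
    | nil => simp [Token.step] at h
    | cons g G =>
      simp only [Token.step] at h
      split_ifs at h with hc
      obtain rfl := Option.some.inj h
      simp [dictSymbols, reversedNames, Token.encode, encodeLiteral_eq]
      omega
  | const c => obtain rfl := Option.some.inj h; simp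
  | le =>
    rcases V with _ | ⟨b, _ | ⟨a, V⟩⟩
    · simp [Token.step] at h
    · simp [Token.step] at h
    simp only [Token.step] at h
    by_cases ho : ord.isSome
    swap
    · rw [if_neg ho] at h; cases h
    rw [if_pos ho] at h
    obtain rfl := Option.some.inj h
    simp
  | _ =>
    rcases V with _ | ⟨b, _ | ⟨a, V⟩⟩
    · simp [Token.step] at h
    · simp [Token.step] at h
    obtain rfl := Option.some.inj h
    simp

theorem Token.encode_length_pos (τ : Token K) : 0 < τ.encode.length := by
  cases τ <;> simp [Token.encode, encodeLiteral_eq]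

end

section
variable {K : Type u} [Semiring K] [Nontrivial K] {ord : Option (SemiringOrder K)}

theorem does_verifyLoop {B : ℕ} : ∀ (n : ℕ) (X : List K) (v : Valuation K), X.length ≤ n →
    X.length + (dictSymbols (reversedNames v.dict)).length ≤ B →
    ∃ s' : Regs K, Does ord (verifyLoop ord) (v.regs X).toStore s'.toStore
      ((n + 1) * (1000 * (B + 1))) ∧
      ((∃ l v', X = l.flatMap Token.encode ∧ stepTokens ord l v = some v' ∧ s' = v'.regs []) ∨
      (s'.r0 ≠ [] ∧
        ∀ l : List (Token K), X = l.flatMap Token.encode → stepTokens ord l v = none)) := by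
  intro n
  induction n with
  | zero =>
    intro X v hn hB
    obtain rfl := List.length_eq_zero_iff.1 (Nat.le_zero.1 hn)
    exact ⟨v.regs [], (does_whileNonempty_nil rfl).mono (by omega), .inl ⟨[], v, rfl, rfl, rfl⟩⟩
  | succ n ih =>
    intro X v hn hB
    cases hX : X with
    | nil =>
      exact ⟨v.regs [], (does_whileNonempty_nil rfl).mono (by nlinarith),
        .inl ⟨[], v, rfl, rfl, rfl⟩⟩
    | cons c X' =>
      have hne : (v.regs (c :: X')).toStore 1 ≠ [] := by simp [Valuation.regs]
      have H := tries_evalToken (ord := ord) v X hB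
      rw [← hX] at hne ⊢
      cases hr : evalTokenResult ord v X with
      | none =>
        rw [hr] at H
        obtain ⟨s', h1, h2, -⟩ := H
        have hlen : s'.r1.length ≤ B + (100 * (B + 1) + 50) := by
          have := h1.1 1
          simp only [Regs.toStore_1] at this
          have h' : (v.regs X).r1.length = X.length := rfl
          omega
        refine ⟨{ s' with r1 := [] }, ?_, .inr ⟨h2, fun l hl => ?_⟩⟩
        · refine (does_whileNonempty_cons hne (h1.seq (does_ifEmpty_neg (r := 0) h2
            (does_clear 1 s'.r1 _ rfl))) (does_whileNonempty_nil (by simp))).congr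
            (by simp) |>.mono ?_
          nlinarith
        · cases l with
          | nil => rw [hX] at hl; simp at hl
          | cons τ l =>
            cases hv : τ.step ord v with
            | none => simp [stepTokens, hv]
            | some v' =>
              have := (evalTokenResult_eq_some (ord := ord) v X _).2 ⟨τ, _, v', hl, hv, rfl⟩
              rw [hr] at this
              exact absurd this (by simp)
      | some r =>
        rw [hr] at H
        obtain ⟨τ, Y, v', hXY, hv, rfl⟩ := (evalTokenResult_eq_some v X r).1 hr
        have hlen : X.length = τ.encode.length + Y.length := by rw [hXY, List.length_append]
        have := τ.encode_length_pos
        have := Token.step_size hv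
        obtain ⟨s', h1, h2⟩ := ih Y v' (by omega) (by omega)
        refine ⟨s', ?_, ?_⟩
        · refine (does_whileNonempty_cons hne (H.1.seq
            (does_ifEmpty_pos (r := 0) H.2 (does_skip _))) h1).mono ?_
          nlinarith
        · rcases h2 with ⟨l, v'', h3, h4, h5⟩ | ⟨h3, h4⟩
          · exact .inl ⟨τ :: l, v'', by rw [hXY, h3]; rfl, by simp [stepTokens, hv, h4], h5⟩
          · refine .inr ⟨h3, fun l hl => ?_⟩
            cases l with
            | nil => rw [hX] at hl; simp at hl
            | cons τ' l =>
              obtain ⟨rfl, h6⟩ := Token.encode_append_inj (hXY.symm.trans hl)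
              simp only [stepTokens, hv, Option.bind_some]
              exact h4 l h6

theorem does_countInput : ∀ (l : List K) (s : Regs K), s.r0 = l →
    Does ord (whileNonempty 0 (push 4 0 ;; moveTop 3 0)) s.toStore
      { s with r0 := [], r3 := l.reverse ++ s.r3, r4 := List.replicate l.length 0 ++ s.r4 }.toStore
      (4 * l.length + 1)
  | [], s, h => (does_whileNonempty_nil h).congr (by cases s; simp_all)
  | c :: l, s, h => by
      refine ((does_whileNonempty_cons (by simp [h]) ((Does.push_seq (does_moveTop (by decide)
        (c := c) (l := l) (by simp [h]))).congr (by simp)) (does_countInput l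
          { s with r0 := l, r3 := c :: s.r3, r4 := 0 :: s.r4 } rfl)).congr ?_).mono ?_
      · simp only [List.length_cons, List.replicate_succ', List.reverse_cons, List.append_assoc]
        rfl
      · simp only [List.length_cons]; omega

theorem does_takeGuess : ∀ (l m : List K) (s : Regs K), s.r0 = l ++ m →
    s.r4 = List.replicate (2 * l.length) 0 →
    Does ord (whileNonempty 4 (popReg 4 ;; popReg 4 ;; moveTop 2 0)) s.toStore
      { s with r0 := m, r2 := l.reverse ++ s.r2, r4 := [] }.toStore (5 * l.length + 1)
  | [], m, s, h, h' => (does_whileNonempty_nil h').congr (by cases s; simp_all)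
  | c :: l, m, s, h, h' => by
      have h4 : s.r4 = 0 :: 0 :: List.replicate (2 * l.length) 0 := by
        rw [h', List.length_cons, Nat.mul_succ, List.replicate_succ, List.replicate_succ]
      refine ((does_whileNonempty_cons (by simp [h4])
        ((Does.popReg_seq (c := 0) (l := 0 :: List.replicate (2 * l.length) 0) (by simp [h4])
        (Does.popReg_seq (c := 0) (l := List.replicate (2 * l.length) 0) (by simp)
        (does_moveTop (by decide) (c := c) (l := l ++ m) (by simp [h])))).congr (by simp))
        (does_takeGuess l m { s with
          r0 := l ++ m, r2 := c :: s.r2, r4 := List.replicate (2 * l.length) 0 } rfl rfl)).congr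
        ?_).mono ?_
      · simp
      · simp only [List.length_cons]; omega

theorem does_splitInput (x g : List K) (h : g.length = x.length) :
    Does ord splitInput (initStore (x ++ g).reverse) ((Valuation.mk g [] []).regs x).toStore
      (30 * (x.length + 1)) := by
  rw [Regs.initStore_eq]
  have H1 := does_countInput (ord := ord) _ { r0 := (x ++ g).reverse } rfl
  have H2 := does_takeGuess (ord := ord) g.reverse x.reverse
    { r0 := (x ++ g).reverse, r4 := List.replicate (x ++ g).reverse.length 0 } (by simp)
    (by simp [h]; omega)
  have H3 : Does ord splitInput _ _ _ := H1.seq (Does.moveAll_seq (by decide) (Does.seq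
    (σ' := ({ r0 := x.reverse, r2 := g, r4 := [] } : Regs K).toStore) (by simpa using H2)
    (Does.moveAll_seq (by decide) (Does.push_seq (does_push _ 11 1)))))
  refine (H3.congr ?_).mono ?_
  · simp [Valuation.regs, dictFlags, dictSymbols, reversedNames]
  · simp [h]; omega

theorem does_formulaValue (s : Regs K) : ∃ (σ : Store K) (y : K) (l : List K),
    Does ord formulaValue s.toStore σ 10 ∧ σ 3 = y :: l ∧ (y ≠ 0 → s.r0 = [] ∧ s.r3 = [y]) ∧
    ∀ a, s.r0 = [] → s.r3 = [a] → y = a := by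
  by_cases h0 : s.r0 = []
  · rcases h3 : s.r3 with _ | ⟨a, _ | ⟨b, l⟩⟩
    · refine ⟨_, 0, _, (does_ifEmpty_pos (r := 0) h0 (does_ifEmpty_pos (r := 3) h3
        (does_push _ _ _))).mono (by omega), Function.update_self _ _ _, by simp, by simp⟩
    · refine ⟨_, a, [], (does_ifEmpty_pos (r := 0) h0 (does_ifEmpty_neg (by simp [h3])
        (Does.moveTop_seq (c := a) (l := []) (by decide) (by simp [h3])
        (does_ifEmpty_pos (by simp) (does_moveTop (r := 3) (s := 5) (c := a) (l := s.r5) (by decide)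
        (by simp)))))).mono (by omega), ?_, by simp [h0], by simp⟩
      simp
    · refine ⟨_, 0, _, (does_ifEmpty_pos (r := 0) h0 (does_ifEmpty_neg (by simp [h3])
        (Does.moveTop_seq (c := a) (l := b :: l) (by decide) (by simp [h3])
        (does_ifEmpty_neg (by simp) (does_push _ 3 0))))).mono (by omega),
        Function.update_self _ _ _, by simp, by simp⟩
  · exact ⟨_, 0, _, (does_ifEmpty_neg (r := 0) h0 (does_push _ 3 0)).mono (by omega),
      Function.update_self _ _ _, by simp, by simp [h0]⟩

/-- The satisfiability problem is in `NP`: the values of the literals of a formula serve as a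
guess. -/
theorem sat_mem_NP (ord : Option (SemiringOrder K)) : SAT ord ∈ NP ord := by
  have key : ∀ x g : List K, ∃ y, g.length = x.length →
      (∃ σ l, Does ord (splitInput ;; verifyLoop ord ;; formulaValue) (initStore (x ++ g).reverse) σ
        (30 * (x.length + 1) + ((x.length + 1) * (1000 * (x.length + 1)) + 10)) ∧ σ 3 = y :: l) ∧
      (y ≠ 0 → x ∈ SAT ord) ∧
      ∀ (φ : Formula ord) (s : Literal → K) (G : List K), φ.encode = x →
        g = φ.literals.map s ++ G → y = φ.eval s := by
    intro x g
    by_cases hg : g.length = x.length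
    swap
    · exact ⟨0, fun h => absurd h hg⟩
    obtain ⟨s', h1, h2⟩ := does_verifyLoop (ord := ord) x.length x ⟨g, [], []⟩ le_rfl
      (B := x.length) (by simp [dictSymbols, reversedNames])
    obtain ⟨σ, y, l, h3, h4, h5, h6⟩ := does_formulaValue (ord := ord) s'
    refine ⟨y, fun _ => ⟨⟨σ, l, (does_splitInput x g hg).seq (h1.seq h3), h4⟩, fun hy => ?_,
      fun φ s G hx hG => ?_⟩⟩
    · obtain ⟨h0, h7⟩ := h5 hy
      rcases h2 with ⟨toks, v', e1, e2, rfl⟩ | ⟨h, -⟩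
      swap
      · exact absurd h0 h
      obtain ⟨-, a2, a3⟩ := stepTokens_sound toks _ _ e2
      have hD := a2 (by simp)
      -- the assignment read off from the final dictionary, which has only one value for a literal
      let s : Literal → K := fun l =>
        open Classical in if h : ∃ e ∈ v'.dict, e.1 = l then h.choose.2 else 0
      have hs : ∀ e ∈ v'.dict, s e.1 = e.2 := by
        intro e he
        have hex : ∃ e' ∈ v'.dict, e'.1 = e.1 := ⟨e, he, rfl⟩
        simp only [s, dif_pos hex]
        exact hD _ hex.choose_spec.1 _ he hex.choose_spec.2
      obtain ⟨Φ, b1, b2⟩ := a3 s [] hs rfl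
      have h7' : v'.values = [y] := h7
      rw [h7'] at b2
      rcases Φ with _ | ⟨φ, _ | ⟨ψ, Φ⟩⟩ <;> simp only [List.map_cons, List.map_nil, List.cons.injEq,
        reduceCtorEq, and_true, and_false] at b2
      have := tokens_of_applyTokens _ _ _ b1
      simp only [List.reverse_cons, List.reverse_nil, List.nil_append, List.flatMap_cons,
        List.flatMap_nil, List.append_nil] at this
      exact ⟨φ, by rw [Formula.encode_eq, this, e1], s, b2 ▸ hy⟩
    · obtain ⟨D', -, e⟩ := stepTokens_complete s φ [] G [] [] (by simp)
      rw [List.append_nil, ← hG] at e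
      rw [Formula.encode_eq] at hx
      rcases h2 with ⟨toks, v', e1, e2, rfl⟩ | ⟨-, h⟩
      · have : toks = φ.tokens := flatMap_encode_injective (e1.symm.trans hx.symm)
        rw [this, e] at e2
        obtain rfl := Option.some.inj e2
        exact h6 _ rfl rfl
      · rw [h _ hx.symm] at e
        simp [stepTokens] at e
  choose F hF using key
  refine mem_NP_of_does (splitInput ;; verifyLoop ord ;; formulaValue) 3
    (30 * (Polynomial.X + 1) + ((Polynomial.X + 1) * (1000 * (Polynomial.X + 1)) + 10)) F
    (fun x g hg => ?_) fun x => ⟨?_, ?_⟩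
  · obtain ⟨⟨σ, l, h1, h2⟩, -⟩ := hF x g hg
    refine ⟨σ, l, h1.mono (le_of_eq ?_), h2⟩
    simp
  · rintro ⟨φ, rfl, s, hs⟩
    refine ⟨φ.literals.map s, ?_⟩
    rw [(hF _ _ (length_padTake _ _)).2.2 φ s _ rfl
      (padTake_eq_append (by simpa using φ.length_literals_le))]
    exact hs
  · rintro ⟨x', hx'⟩
    exact (hF _ _ (length_padTake _ _)).2.1 hx'

end

/-! ### Formulas over an arbitrary set of variables -/

/-- Formulas over a set `α` of variables. The comparison `test` is the one made at branch nodes. -/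
inductive Schema (K : Type u) (α : Type) : Type u
  | var (a : α)
  | const (c : K)
  | eq (φ ψ : Schema K α)
  | test (φ ψ : Schema K α)
  | and (φ ψ : Schema K α)
  | or (φ ψ : Schema K α)

namespace Schema

variable {K : Type u} {α β : Type}

/-- Rename the variables. -/
def map (f : α → β) : Schema K α → Schema K β
  | var a => var (f a)
  | const c => const c
  | eq φ ψ => eq (φ.map f) (ψ.map f)
  | test φ ψ => test (φ.map f) (ψ.map f)
  | and φ ψ => and (φ.map f) (ψ.map f)
  | or φ ψ => or (φ.map f) (ψ.map f)

/-- The disjunction of a list of formulas, whose value is the sum of the values. -/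
def sum [Semiring K] (l : List (Schema K α)) : Schema K α := l.foldr or (const 0)

variable [Semiring K]

theorem map_sum (f : α → β) (l : List (Schema K α)) : (sum l).map f = sum (l.map (map f)) := by
  induction l with
  | nil => rfl
  | cons φ l ih => exact congrArg _ ih

open Classical in
/-- The value of a formula. -/
noncomputable def eval (ord : Option (SemiringOrder K)) (v : α → K) : Schema K α → K
  | var a => v a
  | const c => c
  | eq φ ψ => if φ.eval ord v = ψ.eval ord v then 1 else 0
  | test φ ψ => if BranchTest ord (φ.eval ord v) (ψ.eval ord v) then 1 else 0
  | and φ ψ => φ.eval ord v * ψ.eval ord v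
  | or φ ψ => φ.eval ord v + ψ.eval ord v

/-- The propositional formula with the literal `f a` for the variable `a`. -/
def toFormula (ord : Option (SemiringOrder K)) (f : α → Literal) : Schema K α → Formula ord
  | var a => .lit (f a)
  | const c => .const c
  | eq φ ψ => .eq (φ.toFormula ord f) (ψ.toFormula ord f)
  | test φ ψ =>
    if h : ord.isSome then .le h (φ.toFormula ord f) (ψ.toFormula ord f)
    else .eq (φ.toFormula ord f) (ψ.toFormula ord f)
  | and φ ψ => .and (φ.toFormula ord f) (ψ.toFormula ord f)
  | or φ ψ => .or (φ.toFormula ord f) (ψ.toFormula ord f)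

variable {ord : Option (SemiringOrder K)}

theorem eval_sum (v : α → K) (l : List (Schema K α)) :
    (sum l).eval ord v = (l.map (eval ord v)).sum := by
  induction l with
  | nil => rfl
  | cons φ l ih => rw [List.map_cons, List.sum_cons, ← ih]; rfl

theorem eval_toFormula (f : α → Literal) (s : Literal → K) (φ : Schema K α) :
    (φ.toFormula ord f).eval s = φ.eval ord (fun a => s (f a)) := by
  induction φ with
  | test φ ψ h1 h2 =>
    simp only [toFormula, eval]
    split_ifs with h h' h'
    · rw [Formula.eval, h1, h2, if_pos ((branchTest_iff_le h _ _).1 h')]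
    · rw [Formula.eval, h1, h2, if_neg (fun h3 => h' ((branchTest_iff_le h _ _).2 h3))]
    · cases ord with
      | none => rw [Formula.eval, h1, h2]; exact if_pos h'
      | some o => simp at h
    · cases ord with
      | none => rw [Formula.eval, h1, h2]; exact if_neg h'
      | some o => simp at h
  | eq φ ψ h1 h2 => classical exact if_congr (by rw [h1, h2]) rfl rfl
  | _ => simp_all [toFormula, eval, Formula.eval]

variable [Nontrivial K]

theorem eval_eq_ne_zero {v : α → K} {φ ψ : Schema K α} :
    (eq φ ψ).eval ord v ≠ 0 ↔ φ.eval ord v = ψ.eval ord v := by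
  simp [eval]

/-- The conjunction of a list of formulas. -/
def conj (ord : Option (SemiringOrder K)) (f : α → Literal) (l : List (Schema K α)) : Formula ord :=
  l.foldl (fun Φ φ => .and Φ (φ.toFormula ord f)) (.const 1)

theorem encode_conj (f : α → Literal) (l : List (Schema K α)) :
    (conj ord f l).encode =
      [0, 1, 0, 1] ++ l.flatMap (fun φ => (φ.toFormula ord f).encode ++ [1, 0, 1]) := by
  have : ∀ (Φ : Formula ord), (l.foldl (fun Φ φ => .and Φ (φ.toFormula ord f)) Φ).encode =
      Φ.encode ++ l.flatMap (fun φ => (φ.toFormula ord f).encode ++ [1, 0, 1]) := by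
    induction l with
    | nil => simp
    | cons φ l ih => intro Φ; rw [List.foldl_cons, ih]; simp [Formula.encode]
  exact this _

theorem eval_conj_ne_zero (hK : IsPositive K) (f : α → Literal) (s : Literal → K)
    (l : List (Schema K α)) :
    (conj ord f l).eval s ≠ 0 ↔ ∀ φ ∈ l, φ.eval ord (fun a => s (f a)) ≠ 0 := by
  have hmul : ∀ a b : K, a * b ≠ 0 ↔ a ≠ 0 ∧ b ≠ 0 := fun a b =>
    ⟨fun h => ⟨left_ne_zero_of_mul h, right_ne_zero_of_mul h⟩, fun h => hK.1 a b h.1 h.2⟩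
  have : ∀ (Φ : Formula ord), (l.foldl (fun Φ φ => .and Φ (φ.toFormula ord f)) Φ).eval s ≠ 0 ↔
      Φ.eval s ≠ 0 ∧ ∀ φ ∈ l, φ.eval ord (fun a => s (f a)) ≠ 0 := by
    induction l with
    | nil => simp
    | cons φ l ih =>
      intro Φ
      rw [List.foldl_cons, ih, Formula.eval, hmul, eval_toFormula]
      simp [and_assoc]
  rw [conj, this]
  simp [Formula.eval]

/-- If different variables have different names, then a conjunction is satisfiable if and only if
some values of the variables satisfy all its members. -/
theorem satisfiable_conj (hK : IsPositive K) {f : α → Literal} (hf : Function.Injective f)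
    (l : List (Schema K α)) :
    (conj ord f l).Satisfiable ↔ ∃ v : α → K, ∀ φ ∈ l, φ.eval ord v ≠ 0 := by
  constructor
  · rintro ⟨s, hs⟩
    exact ⟨_, (eval_conj_ne_zero hK f s l).1 hs⟩
  · rintro ⟨v, hv⟩
    refine ⟨Function.extend f v 0, (eval_conj_ne_zero hK f _ l).2 ?_⟩
    simpa only [hf.extend_apply] using hv

end Schema

/-! ### The tableau of a computation -/

/-- The variables of a tableau: the content of the cell `z` at time `t`, and the truth value of the
statement that the machine is at the node with the number `i` at time `t`. -/
inductive Var : Type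
  | cell (t : ℕ) (z : ℤ)
  | node (t i : ℕ)

/-- The name of a coordinate. -/
def coordName : ℤ → List Bool
  | .ofNat n => false :: List.replicate n true
  | .negSucc n => true :: List.replicate n true

/-- The literal that stands for a variable of a tableau. Cells are propositions and nodes are
negated propositions; these are unrelated under an assignment, so the names cannot clash. -/
def Var.name : Var → Literal
  | cell t z => .pos (List.replicate t true ++ false :: coordName z)
  | node t i => .neg (List.replicate t true ++ false :: List.replicate i true)

theorem replicate_append_false_inj {m n : ℕ} {u v : List Bool}
    (h : List.replicate m true ++ false :: u = List.replicate n true ++ false :: v) :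
    m = n ∧ u = v := by
  induction m generalizing n with
  | zero => cases n <;> simp_all [List.replicate_succ]
  | succ m ih =>
    cases n with
    | zero => simp [List.replicate_succ] at h
    | succ n =>
      simp only [List.replicate_succ, List.cons_append, List.cons.injEq, true_and] at h
      obtain ⟨rfl, h2⟩ := ih h
      exact ⟨rfl, h2⟩

theorem coordName_injective : Function.Injective coordName := by
  intro z z' h
  cases z <;> cases z' <;> simp_all [coordName]

theorem Var.name_injective : Function.Injective Var.name := by
  intro a b h
  cases a <;> cases b <;> simp only [name, Literal.pos.injEq, Literal.neg.injEq, reduceCtorEq] at h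
  · obtain ⟨rfl, h2⟩ := replicate_append_false_inj h
    rw [coordName_injective h2]
  · obtain ⟨rfl, h2⟩ := replicate_append_false_inj h
    rw [List.replicate_left_injective true h2]

namespace Machine

variable {K : Type u}

/-- The nodes of a machine. -/
noncomputable def nodes (M : Machine K) : List M.Node :=
  (@Finset.univ _ (@Fintype.ofFinite _ M.finite)).toList

/-- The number of a node. -/
noncomputable def index (M : Machine K) (q : M.Node) : ℕ :=
  (@Finite.equivFin M.Node M.finite q).val

theorem mem_nodes (M : Machine K) (q : M.Node) : q ∈ M.nodes := by
  simp [nodes]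

theorem index_injective (M : Machine K) : Function.Injective M.index := fun _ _ h =>
  (@Finite.equivFin M.Node M.finite).injective (Fin.ext h)

/-- In a list that runs through all nodes, only the node `q` contributes. -/
theorem sum_nodes [Semiring K] (M : Machine K) (N f : M.Node → K) (q : M.Node) (h : N q = 1)
    (h' : ∀ q', q' ≠ q → N q' = 0) : (M.nodes.map fun q' => N q' * f q').sum = f q := by
  let _ := @Fintype.ofFinite _ M.finite
  rw [nodes, Finset.sum_map_toList, Finset.sum_eq_single q]
  · rw [h, one_mul]
  · intro q' _ hq
    rw [h' q' hq, zero_mul]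
  · intro hq
    exact absurd (Finset.mem_univ _) hq

end Machine

/-- The largest absolute value of a coordinate named by an instruction. -/
def Instr.bound {K : Type u} {Q : Type} : Instr K Q → ℕ
  | .add i j k _ => max i.natAbs (max j.natAbs k.natAbs)
  | .mul i j k _ => max i.natAbs (max j.natAbs k.natAbs)
  | .const i _ _ => i.natAbs
  | _ => 0

theorem Machine.exists_bound {K : Type u} (M : Machine K) :
    ∃ w, 2 ≤ w ∧ ∀ q, (M.instr q).bound ≤ w := by
  have := M.finite
  obtain ⟨w, hw⟩ := (Set.finite_range fun q => (M.instr q).bound).bddAbove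
  exact ⟨max 2 w, le_max_left _ _, fun q => (hw ⟨q, rfl⟩).trans (le_max_right _ _)⟩

section
variable {K : Type u} [Semiring K] {α β : Type}

/-- The content of a cell after an instruction, where `cell` are the variables for all cells before
the instruction and `cur`, `next` and `prev` are those for the cell itself and its neighbours. The
predicate `hit` tells which coordinate is the one of the cell. -/
def cellAfter {Q : Type} (cell : ℤ → α) (hit : ℤ → Bool) (cur next prev : α) :
    Instr K Q → Schema K α
  | .add i j k _ => if hit i then .or (.var (cell j)) (.var (cell k)) else .var cur
  | .mul i j k _ => if hit i then .and (.var (cell j)) (.var (cell k)) else .var cur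
  | .const i c _ => if hit i then .const c else .var cur
  | .shiftLeft _ => .var next
  | .shiftRight _ => .var prev
  | _ => .var cur

open Classical in
/-- The truth value of the statement that the node `q` is the next node after an instruction at the
node `q'`, where `cell` are the variables for all cells. -/
noncomputable def reaches {Q : Type} (cell : ℤ → α) (q' q : Q) : Instr K Q → Schema K α
  | .output => .const (if q' = q then 1 else 0)
  | .branch q₁ q₂ =>
    .or (.and (.test (.var (cell 1)) (.var (cell 2))) (.const (if q₁ = q then 1 else 0)))
      (.and (.eq (.test (.var (cell 1)) (.var (cell 2))) (.const 0))
        (.const (if q₂ = q then 1 else 0)))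
  | .input r => .const (if r = q then 1 else 0)
  | .add _ _ _ r => .const (if r = q then 1 else 0)
  | .mul _ _ _ r => .const (if r = q then 1 else 0)
  | .const _ _ r => .const (if r = q then 1 else 0)
  | .shiftLeft r => .const (if r = q then 1 else 0)
  | .shiftRight r => .const (if r = q then 1 else 0)

/-- The equation for the content `new` of a cell after one step. -/
noncomputable def cellStep (M : Machine K) (node : M.Node → α) (cell : ℤ → α) (hit : ℤ → Bool)
    (new cur next prev : α) : Schema K α :=
  .eq (.var new) (.sum (M.nodes.map fun q =>
    .and (.var (node q)) (cellAfter cell hit cur next prev (M.instr q))))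

/-- The equation for the truth value `new` of the statement that the node `q` is reached after one
step. -/
noncomputable def nodeStep (M : Machine K) (node : M.Node → α) (cell : ℤ → α) (new : α)
    (q : M.Node) : Schema K α :=
  .eq (.var new) (.sum (M.nodes.map fun q' =>
    .and (.var (node q')) (reaches cell q' q (M.instr q'))))

theorem map_cellAfter {Q : Type} (f : α → β) (cell : ℤ → α) (hit : ℤ → Bool) (cur next prev : α)
    (I : Instr K Q) : (cellAfter cell hit cur next prev I).map f =
      cellAfter (fun z => f (cell z)) hit (f cur) (f next) (f prev) I := by
  cases I <;> simp only [cellAfter] <;> first | rfl | (split_ifs <;> rfl)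

theorem map_reaches {Q : Type} (f : α → β) (cell : ℤ → α) (q' q : Q) (I : Instr K Q) :
    (reaches cell q' q I).map f = reaches (fun z => f (cell z)) q' q I := by
  cases I <;> rfl

theorem map_cellStep (f : α → β) (M : Machine K) (node : M.Node → α) (cell : ℤ → α) (hit : ℤ → Bool)
    (new cur next prev : α) : (cellStep M node cell hit new cur next prev).map f =
      cellStep M (fun q => f (node q)) (fun z => f (cell z)) hit (f new) (f cur) (f next)
        (f prev) := by
  simp [cellStep, Schema.map, Schema.map_sum, map_cellAfter, Function.comp_def]

theorem map_nodeStep (f : α → β) (M : Machine K) (node : M.Node → α) (cell : ℤ → α) (new : α)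
    (q : M.Node) : (nodeStep M node cell new q).map f =
      nodeStep M (fun q => f (node q)) (fun z => f (cell z)) (f new) q := by
  simp [nodeStep, Schema.map, Schema.map_sum, map_reaches, Function.comp_def]

end

section
variable {K : Type u} [Semiring K] [Nontrivial K] {ord : Option (SemiringOrder K)} {α : Type}
  {M : Machine K} {c : M.Node × State K} {v : α → K} {node : M.Node → α} {cell : ℤ → α} {w : ℕ}

theorem eval_cellAfter {hit : ℤ → Bool} {cur next prev : α} {z : ℤ}
    (hw : (M.instr c.1).bound ≤ w) (hcell : ∀ j, j.natAbs ≤ w → v (cell j) = c.2 j)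
    (hhit : ∀ i : ℤ, i.natAbs ≤ w → (hit i = true ↔ z = i)) (hcur : v cur = c.2 z)
    (hnext : v next = c.2 (z + 1)) (hprev : v prev = c.2 (z - 1)) :
    (cellAfter cell hit cur next prev (M.instr c.1)).eval ord v = (M.step ord c).2 z := by
  unfold Machine.step
  cases hI : M.instr c.1 <;> simp only [hI, Instr.bound] at hw <;>
    simp only [cellAfter, Schema.eval, hcur, hnext, hprev]
  case add i j k q =>
    have := hhit i (by omega)
    by_cases hz : z = i
    · rw [if_pos (this.2 hz), hz, Function.update_self]
      simp only [Schema.eval]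
      rw [hcell j (by omega), hcell k (by omega)]
    · rw [if_neg (fun h => hz (this.1 h)), Function.update_of_ne hz]
      exact hcur
  case mul i j k q =>
    have := hhit i (by omega)
    by_cases hz : z = i
    · rw [if_pos (this.2 hz), hz, Function.update_self]
      simp only [Schema.eval]
      rw [hcell j (by omega), hcell k (by omega)]
    · rw [if_neg (fun h => hz (this.1 h)), Function.update_of_ne hz]
      exact hcur
  case const i a q =>
    have := hhit i (by omega)
    by_cases hz : z = i
    · rw [if_pos (this.2 hz), hz, Function.update_self]
      rfl
    · rw [if_neg (fun h => hz (this.1 h)), Function.update_of_ne hz]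
      exact hcur

open Classical in
theorem eval_reaches (h1 : v (cell 1) = c.2 1) (h2 : v (cell 2) = c.2 2) (q : M.Node) :
    (reaches cell c.1 q (M.instr c.1)).eval ord v = if (M.step ord c).1 = q then 1 else 0 := by
  unfold Machine.step
  cases hI : M.instr c.1
  case branch q₁ q₂ =>
    change (Schema.test (.var (cell 1)) (.var (cell 2))).eval ord v * (if q₁ = q then 1 else 0) +
      (Schema.eq (.test (.var (cell 1)) (.var (cell 2))) (.const 0)).eval ord v *
        (if q₂ = q then 1 else 0) = _
    by_cases hb : BranchTest ord (v (cell 1)) (v (cell 2))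
    · have hb' : BranchTest ord (c.2 1) (c.2 2) := by rwa [h1, h2] at hb
      have e : (Schema.test (.var (cell 1)) (.var (cell 2))).eval ord v = 1 := if_pos hb
      have e' : (Schema.eq (.test (.var (cell 1)) (.var (cell 2))) (.const 0)).eval ord v = 0 :=
        if_neg (by rw [e]; exact one_ne_zero)
      simp [e, e', hb']
    · have hb' : ¬ BranchTest ord (c.2 1) (c.2 2) := by rwa [h1, h2] at hb
      have e : (Schema.test (.var (cell 1)) (.var (cell 2))).eval ord v = 0 := if_neg hb
      have e' : (Schema.eq (.test (.var (cell 1)) (.var (cell 2))) (.const 0)).eval ord v = 1 :=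
        if_pos e
      simp [e, e', hb']
  all_goals rfl

open Classical in
/-- If the variables describe a configuration, then the equation for a cell holds if and only if the
new variable has the content of this cell in the next configuration. -/
theorem eval_cellStep {hit : ℤ → Bool} {new cur next prev : α} {z : ℤ}
    (hnode : ∀ q, v (node q) = if c.1 = q then 1 else 0)
    (hw : (M.instr c.1).bound ≤ w) (hcell : ∀ j, j.natAbs ≤ w → v (cell j) = c.2 j)
    (hhit : ∀ i : ℤ, i.natAbs ≤ w → (hit i = true ↔ z = i)) (hcur : v cur = c.2 z)
    (hnext : v next = c.2 (z + 1)) (hprev : v prev = c.2 (z - 1)) :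
    (cellStep M node cell hit new cur next prev).eval ord v ≠ 0 ↔
      v new = (M.step ord c).2 z := by
  rw [cellStep, Schema.eval_eq_ne_zero, Schema.eval_sum, List.map_map]
  simp only [Function.comp_def, Schema.eval]
  rw [M.sum_nodes (fun q => v (node q)) _ c.1 (by simp [hnode])
    (fun q hq => by simp [hnode, Ne.symm hq]), eval_cellAfter hw hcell hhit hcur hnext hprev]

open Classical in
theorem eval_nodeStep {new : α} {q : M.Node}
    (hnode : ∀ q, v (node q) = if c.1 = q then 1 else 0)
    (h1 : v (cell 1) = c.2 1) (h2 : v (cell 2) = c.2 2) :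
    (nodeStep M node cell new q).eval ord v ≠ 0 ↔
      v new = if (M.step ord c).1 = q then 1 else 0 := by
  rw [nodeStep, Schema.eval_eq_ne_zero, Schema.eval_sum, List.map_map]
  simp only [Function.comp_def, Schema.eval]
  rw [M.sum_nodes (fun q => v (node q)) _ c.1 (by simp [hnode])
    (fun q hq => by simp [hnode, Ne.symm hq]), eval_reaches h1 h2]

end

section
variable {K : Type u} [Semiring K]

/-- The equations for the cells that hold the input `x` and the unary code of its length. -/
def inputConstraints (x : List K) : List (Schema K Var) :=
  (List.range x.length).flatMap fun j =>
    [.eq (.var (.cell 0 (Int.ofNat (j + 1)))) (.const (x.getD j 0)),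
      .eq (.var (.cell 0 (Int.negSucc j))) (.const 1)]

/-- The equations for the cells that separate the unary codes in an initial state. -/
def separatorConstraints (K : Type u) [Semiring K] (n : ℕ) : List (Schema K Var) :=
  [.eq (.var (.cell 0 (Int.ofNat 0))) (.const 0), .eq (.var (.cell 0 (Int.negSucc n))) (.const 0)]

/-- The constraints for the first `W` cells of the guess. The unary code of its length consists of
ones followed by zeros, and the guess vanishes outside of its length. -/
def guessConstraints (K : Type u) [Semiring K] (n W : ℕ) : List (Schema K Var) :=
  (List.range W).flatMap fun j =>
    [.or (.eq (.var (.cell 0 (Int.negSucc (n + j + 1)))) (.const 1))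
      (.eq (.var (.cell 0 (Int.negSucc (n + j + 1)))) (.const 0)),
    .eq (.var (.cell 0 (Int.negSucc (n + j + 2))))
      (.and (.var (.cell 0 (Int.negSucc (n + j + 2)))) (.var (.cell 0 (Int.negSucc (n + j + 1))))),
    .eq (.var (.cell 0 (Int.ofNat (n + j + 1))))
      (.and (.var (.cell 0 (Int.ofNat (n + j + 1)))) (.var (.cell 0 (Int.negSucc (n + j + 1)))))]

open Classical in
/-- The computation starts at the input node. -/
noncomputable def startConstraints (M : Machine K) : List (Schema K Var) :=
  M.nodes.map fun q => .eq (.var (.node 0 (M.index q))) (.const (if M.inputNode = q then 1 else 0))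

/-- The constraints for the nodes in the step from `t` to `t + 1`. -/
noncomputable def nodeConstraints (M : Machine K) (t : ℕ) : List (Schema K Var) :=
  M.nodes.map fun q =>
    nodeStep M (fun q' => .node t (M.index q')) (.cell t) (.node (t + 1) (M.index q)) q

/-- The coordinates of absolute value at most `w`. -/
def nearCoords (w : ℕ) : List ℤ :=
  (List.range (w + 1)).map Int.ofNat ++ (List.range w).map Int.negSucc

/-- The constraints for the cells that may be named by an instruction. -/
noncomputable def nearConstraints (M : Machine K) (w t : ℕ) : List (Schema K Var) :=
  (nearCoords w).map fun z =>
    cellStep M (fun q => .node t (M.index q)) (.cell t) (fun i => decide (z = i))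
      (.cell (t + 1) z) (.cell t z) (.cell t (z + 1)) (.cell t (z - 1))

/-- The constraints for `2 * W` cells that are not named by an instruction. -/
noncomputable def farConstraints (M : Machine K) (w W t : ℕ) : List (Schema K Var) :=
  (List.range W).flatMap fun j =>
    [cellStep M (fun q => .node t (M.index q)) (.cell t) (fun _ => false)
      (.cell (t + 1) (Int.ofNat (j + (w + 1)))) (.cell t (Int.ofNat (j + (w + 1))))
      (.cell t (Int.ofNat (j + (w + 2)))) (.cell t (Int.ofNat (j + w))),
    cellStep M (fun q => .node t (M.index q)) (.cell t) (fun _ => false)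
      (.cell (t + 1) (Int.negSucc (j + w))) (.cell t (Int.negSucc (j + w)))
      (.cell t (Int.negSucc (j + (w - 1)))) (.cell t (Int.negSucc (j + (w + 1))))]

/-- The output at the time `T` is a single nonzero element. -/
def outputConstraints (K : Type u) [Semiring K] (T : ℕ) : List (Schema K Var) :=
  [.eq (.var (.cell T (Int.negSucc 0))) (.const 1),
    .eq (.eq (.var (.cell T (Int.negSucc 1))) (.const 1)) (.const 0),
    .var (.cell T (Int.ofNat 1))]

/-- The constraints on the tableau of an accepting computation on `x` of length `T`. -/
noncomputable def tableau (M : Machine K) (w : ℕ) (x : List K) (T : ℕ) : List (Schema K Var) :=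
  inputConstraints x ++ separatorConstraints K x.length ++ guessConstraints K x.length (T + w) ++
    startConstraints M ++
    (List.range T).flatMap (fun t =>
      nodeConstraints M t ++ nearConstraints M w t ++ farConstraints M w (T + w) t) ++
    outputConstraints K T

end

section
variable {K : Type u} [Semiring K] [Nontrivial K] {ord : Option (SemiringOrder K)}
  {M : Machine K} {v : Var → K} {w W : ℕ}

theorem Schema.eval_ne_ne_zero {φ ψ : Schema K Var} :
    (Schema.eq (.eq φ ψ) (.const 0)).eval ord v ≠ 0 ↔ φ.eval ord v ≠ ψ.eval ord v := by
  rw [eval_eq_ne_zero]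
  by_cases h : φ.eval ord v = ψ.eval ord v
  · have e : (Schema.eq φ ψ).eval ord v = 1 := if_pos h
    rw [e]
    simp [eval, h]
  · have e : (Schema.eq φ ψ).eval ord v = 0 := if_neg h
    rw [e]
    simp [eval, h]

theorem Schema.eval_eq_or_eq_ne_zero {φ ψ φ' ψ' : Schema K Var}
    (h : φ.eval ord v = ψ.eval ord v → φ'.eval ord v ≠ ψ'.eval ord v) :
    (Schema.or (.eq φ ψ) (.eq φ' ψ')).eval ord v ≠ 0 ↔
      φ.eval ord v = ψ.eval ord v ∨ φ'.eval ord v = ψ'.eval ord v := by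
  change (Schema.eq φ ψ).eval ord v + (Schema.eq φ' ψ').eval ord v ≠ 0 ↔ _
  by_cases h1 : φ.eval ord v = ψ.eval ord v
  · have e : (Schema.eq φ ψ).eval ord v = 1 := if_pos h1
    have e' : (Schema.eq φ' ψ').eval ord v = 0 := if_neg (h h1)
    simp [e, e', h1]
  · have e : (Schema.eq φ ψ).eval ord v = 0 := if_neg h1
    rw [e, zero_add, eval_eq_ne_zero]
    simp [h1]

/-- The constraints `l` hold under the values `v`. -/
def Holds (ord : Option (SemiringOrder K)) (v : Var → K) (l : List (Schema K Var)) : Prop :=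
  ∀ φ ∈ l, φ.eval ord v ≠ 0

theorem holds_append {l m : List (Schema K Var)} :
    Holds ord v (l ++ m) ↔ Holds ord v l ∧ Holds ord v m := List.forall_mem_append

theorem holds_cons {φ : Schema K Var} {l : List (Schema K Var)} :
    Holds ord v (φ :: l) ↔ φ.eval ord v ≠ 0 ∧ Holds ord v l := List.forall_mem_cons

theorem holds_nil : Holds ord v ([] : List (Schema K Var)) ↔ True := by simp [Holds]

theorem holds_range {k : ℕ} {f : ℕ → List (Schema K Var)} :
    Holds ord v ((List.range k).flatMap f) ↔ ∀ j < k, Holds ord v (f j) := by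
  simp only [Holds, List.mem_flatMap, List.mem_range]
  exact ⟨fun h j hj φ hφ => h φ ⟨j, hj, hφ⟩, fun h φ ⟨j, hj, hφ⟩ => h j hj φ hφ⟩

theorem holds_map {γ : Type*} {l : List γ} {f : γ → Schema K Var} :
    Holds ord v (l.map f) ↔ ∀ a ∈ l, (f a).eval ord v ≠ 0 := List.forall_mem_map

theorem mem_nearCoords {z : ℤ} : z ∈ nearCoords w ↔ z.natAbs ≤ w := by
  simp only [nearCoords, List.mem_append, List.mem_map, List.mem_range]
  constructor
  · rintro (⟨j, hj, rfl⟩ | ⟨j, hj, rfl⟩)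
    · simp; omega
    · simp; omega
  · intro h
    cases z with
    | ofNat n => exact .inl ⟨n, by simp at h; omega, rfl⟩
    | negSucc n => exact .inr ⟨n, by simp at h; omega, rfl⟩

/-- The values `v` describe the configuration `c` at time `t`, for the cells up to the absolute
value `m`. -/
def Describes (v : Var → K) (M : Machine K) (t m : ℕ) (c : M.Node × State K) : Prop :=
  (∀ q, v (.node t (M.index q)) = open Classical in if c.1 = q then 1 else 0) ∧
    ∀ z : ℤ, z.natAbs ≤ m → v (.cell t z) = c.2 z

theorem eval_cellStep_of_describes {t m : ℕ} {c : M.Node × State K} {hit : ℤ → Bool}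
    {z z' z'' : ℤ} (H : Describes v M t m c)
    (hw : ∀ q, (M.instr q).bound ≤ w) (hm : w ≤ m) (hz : z.natAbs < m) (hz' : z' = z + 1)
    (hz'' : z'' = z - 1) (hhit : ∀ i : ℤ, i.natAbs ≤ w → (hit i = true ↔ z = i)) :
    (cellStep M (fun q => .node t (M.index q)) (.cell t) hit (.cell (t + 1) z) (.cell t z)
      (.cell t z') (.cell t z'')).eval ord v ≠ 0 ↔ v (.cell (t + 1) z) = (M.step ord c).2 z := by
  subst hz' hz''
  exact eval_cellStep H.1 (hw _) (fun j hj => H.2 j (by omega)) hhit (H.2 _ (by omega))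
    (H.2 _ (by omega)) (H.2 _ (by omega))

theorem not_near_iff {z : ℤ} (hz : w < z.natAbs) (i : ℤ) (hi : i.natAbs ≤ w) :
    false = true ↔ z = i := by
  constructor
  · intro h
    cases h
  · rintro rfl
    omega

/-- The constraints for one step force a description of the next configuration on a window that is
smaller by one. -/
theorem describes_step {t m : ℕ} {c : M.Node × State K}
    (hw : ∀ q, (M.instr q).bound ≤ w) (h2 : 2 ≤ w) (hm : w ≤ m) (hm' : m ≤ w + W + 1)
    (H : Describes v M t m c) (Hn : Holds ord v (nodeConstraints M t))
    (Hc : Holds ord v (nearConstraints M w t)) (Hf : Holds ord v (farConstraints M w W t)) :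
    Describes v M (t + 1) (m - 1) (M.step ord c) := by
  refine ⟨fun q => ?_, fun z hz => ?_⟩
  · have := holds_map.1 Hn q (M.mem_nodes q)
    rw [eval_nodeStep H.1 (H.2 1 (by omega)) (H.2 2 (by omega))] at this
    exact this
  by_cases hm0 : m = 0
  · omega
  by_cases hzw : z.natAbs ≤ w
  · have := holds_map.1 Hc z (mem_nearCoords.2 hzw)
    rwa [eval_cellStep_of_describes H hw hm (by omega) rfl rfl (by simp)] at this
  · rw [farConstraints, holds_range] at Hf
    cases z with
    | ofNat n =>
      simp only [Int.ofNat_eq_natCast, Int.natAbs_natCast] at hz hzw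
      have := (holds_cons.1 (Hf (n - (w + 1)) (by omega))).1
      rw [show n - (w + 1) + (w + 1) = n by omega] at this
      rwa [eval_cellStep_of_describes H hw hm
        (by simp only [Int.ofNat_eq_natCast]; omega)
        (by simp only [Int.ofNat_eq_natCast]; omega) (by simp only [Int.ofNat_eq_natCast]; omega)
        (not_near_iff (by simp only [Int.ofNat_eq_natCast]; omega))] at this
    | negSucc n =>
      simp only [Int.natAbs_negSucc] at hz hzw
      have := (holds_cons.1 (holds_cons.1 (Hf (n - w) (by omega))).2).1
      rw [show n - w + w = n by omega] at this
      rwa [eval_cellStep_of_describes H hw hm (by simp only [Int.negSucc_eq]; omega)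
        (by simp only [Int.negSucc_eq]; omega) (by simp only [Int.negSucc_eq]; omega)
        (not_near_iff (by simp only [Int.negSucc_eq]; omega))] at this

/-- The values given by a computation satisfy the constraints for its steps. -/
theorem holds_step {t : ℕ} {c : M.Node × State K}
    (hw : ∀ q, (M.instr q).bound ≤ w) (h2 : 2 ≤ w) (H : ∀ m, Describes v M t m c)
    (H' : ∀ m, Describes v M (t + 1) m (M.step ord c)) :
    Holds ord v (nodeConstraints M t ++ nearConstraints M w t ++ farConstraints M w W t) := by
  rw [holds_append, holds_append]
  refine ⟨⟨holds_map.2 fun q _ => ?_, holds_map.2 fun z _ => ?_⟩, ?_⟩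
  · rw [eval_nodeStep (H 0).1 ((H 1).2 1 (by simp)) ((H 2).2 2 (by simp))]
    exact (H' 0).1 q
  · rw [eval_cellStep_of_describes (H (w + z.natAbs + 1)) hw (by omega) (by omega) rfl rfl
      (by simp)]
    exact (H' _).2 z le_rfl
  · rw [farConstraints, holds_range]
    intro j _
    simp only [holds_cons, holds_nil, and_true]
    constructor
    · rw [eval_cellStep_of_describes (H (w + (j + (w + 1)) + 1)) hw (by omega)
      (by simp only [Int.ofNat_eq_natCast]; omega)
        (by simp only [Int.ofNat_eq_natCast]; omega)
        (by simp only [Int.ofNat_eq_natCast]; omega) (not_near_iff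
        (by simp only [Int.ofNat_eq_natCast]; omega))]
      exact (H' _).2 _ le_rfl
    · rw [eval_cellStep_of_describes (H (w + (j + (w + 1)) + 1)) hw (by omega)
      (by simp only [Int.negSucc_eq]; omega)
        (by simp only [Int.negSucc_eq]; omega)
        (by simp only [Int.negSucc_eq]; omega) (not_near_iff
        (by simp only [Int.negSucc_eq]; omega))]
      exact (H' _).2 _ le_rfl

theorem holds_outputConstraints {T m : ℕ} {c : M.Node × State K} (H : Describes v M T m c)
    (hm : 2 ≤ m) : Holds ord v (outputConstraints K T) ↔
      Machine.ReadsOut c.2 [c.2 1] ∧ c.2 1 ≠ 0 := by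
  have e1 := H.2 (Int.negSucc 0) (by simp; omega)
  have e2 := H.2 (Int.negSucc 1) (by simp; omega)
  have e3 := H.2 (Int.ofNat 1) (by simp; omega)
  rw [outputConstraints, holds_cons, holds_cons, holds_cons, Schema.eval_ne_ne_zero,
    Schema.eval_eq_ne_zero]
  simp only [holds_nil, and_true, Schema.eval, e1, e2, e3]
  simp only [Machine.ReadsOut, List.length_cons, List.length_nil]
  constructor
  · rintro ⟨h1, h2, h3⟩
    refine ⟨⟨fun i hi => ?_, h2, fun i => ?_⟩, h3⟩
    · obtain rfl : i = 0 := by omega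
      exact h1
    · obtain ⟨i, hi⟩ := i
      obtain rfl : i = 0 := by simpa using hi
      rfl
  · rintro ⟨⟨h1, h2, -⟩, h3⟩
    exact ⟨h1 0 (by omega), h2, h3⟩

theorem guessState_negSucc (x x' : List K) (k : ℕ) : guessState x x' (Int.negSucc k) =
    if k < x.length ∨ x.length < k ∧ k < x.length + 1 + x'.length then 1 else 0 := by
  simp only [guessState, Int.negSucc_eq]
  split_ifs <;> first | rfl | omega

theorem guessState_ofNat (x x' : List K) (k : ℕ) :
    guessState x x' (Int.ofNat (k + 1)) = (x ++ x').getD k 0 := by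
  rw [← guessState_pos]
  rfl

/-- A sequence of ones and zeros that cannot change from zero to one. -/
theorem exists_ones_zeros (Z : ℕ → K) : ∀ W : ℕ, (∀ j < W, Z j = 1 ∨ Z j = 0) →
    (∀ j < W, Z (j + 1) = Z (j + 1) * Z j) →
    ∃ m ≤ W, (∀ j < m, Z j = 1) ∧ ∀ j, m ≤ j → j < W → Z j = 0
  | 0, _, _ => ⟨0, le_rfl, by simp, by simp⟩
  | W + 1, h1, h2 => by
      obtain ⟨m, hm, h3, h4⟩ := exists_ones_zeros Z W (fun j hj => h1 j (by omega))
        (fun j hj => h2 j (by omega))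
      rcases hm.lt_or_eq with hm' | rfl
      · refine ⟨m, by omega, h3, fun j hj hj' => ?_⟩
        by_cases hjW : j = W
        · obtain ⟨k, rfl⟩ : ∃ k, j = k + 1 := ⟨j - 1, by omega⟩
          rw [h2 k (by omega), h4 k (by omega) (by omega), mul_zero]
        · exact h4 j hj (by omega)
      · rcases h1 m (by omega) with h | h
        · refine ⟨m + 1, le_rfl, fun j hj => ?_, fun j hj hj' => by omega⟩
          by_cases hjm : j = m
          · rw [hjm, h]
          · exact h3 j (by omega)
        · refine ⟨m, by omega, h3, fun j hj hj' => ?_⟩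
          obtain rfl : j = m := by omega
          exact h

theorem holds_guessConstraints {n : ℕ} : Holds ord v (guessConstraints K n W) ↔ ∀ j < W,
    (v (.cell 0 (Int.negSucc (n + j + 1))) = 1 ∨ v (.cell 0 (Int.negSucc (n + j + 1))) = 0) ∧
    v (.cell 0 (Int.negSucc (n + j + 2))) =
      v (.cell 0 (Int.negSucc (n + j + 2))) * v (.cell 0 (Int.negSucc (n + j + 1))) ∧
    v (.cell 0 (Int.ofNat (n + j + 1))) =
      v (.cell 0 (Int.ofNat (n + j + 1))) * v (.cell 0 (Int.negSucc (n + j + 1))) := by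
  rw [guessConstraints, holds_range]
  refine forall₂_congr fun j _ => ?_
  simp only [holds_cons, holds_nil, and_true, Schema.eval_eq_ne_zero]
  refine and_congr ?_ Iff.rfl
  rw [Schema.eval_eq_or_eq_ne_zero (fun h1 h2 => one_ne_zero (h1.symm.trans h2))]
  rfl

/-- The constraints for the time `0` force an initial state on a window. -/
theorem exists_guess {x : List K} (H1 : Holds ord v (inputConstraints x))
    (H2 : Holds ord v (separatorConstraints K x.length))
    (H3 : Holds ord v (guessConstraints K x.length W)) :
    ∃ x' : List K, ∀ z : ℤ, z.natAbs ≤ W → v (.cell 0 z) = guessState x x' z := by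
  rw [holds_guessConstraints] at H3
  simp only [inputConstraints, holds_range, holds_cons, holds_nil, and_true,
    Schema.eval_eq_ne_zero, separatorConstraints] at H1 H2
  simp only [Schema.eval] at H1 H2
  obtain ⟨m, hm, h1, h0⟩ := exists_ones_zeros
    (fun j => v (.cell 0 (Int.negSucc (x.length + j + 1)))) W (fun j hj => (H3 j hj).1)
    (fun j hj => (H3 j hj).2.1)
  -- the guess consists of the cells that are counted by the `m` ones
  refine ⟨(List.range m).map fun j => v (.cell 0 (Int.ofNat (x.length + j + 1))), fun z hz => ?_⟩
  rcases z with (_ | k) | k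
  · rw [H2.1]
    exact (guessState_zero _ _).symm
  · rw [guessState_ofNat]
    by_cases hk : k < x.length
    · rw [(H1 k hk).1, List.getD_append _ _ _ _ hk]
    · rw [List.getD_append_right _ _ _ _ (by omega)]
      simp only [Int.ofNat_eq_natCast, Int.natAbs_natCast] at hz
      by_cases hj : k - x.length < m
      · rw [List.getD_eq_getElem _ _ (by simpa using hj), List.getElem_map, List.getElem_range,
          show x.length + (k - x.length) = k by omega]
      · have e1 := (H3 (k - x.length) (by omega)).2.2
        have e2 := h0 (k - x.length) (by omega) (by omega)
        rw [show x.length + (k - x.length) = k by omega] at e1 e2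
        rw [e1, e2, mul_zero, List.getD_eq_default _ _ (by simpa using hj)]
  · simp only [Int.natAbs_negSucc] at hz
    rw [guessState_negSucc, List.length_map, List.length_range]
    by_cases hk : k < x.length
    · rw [(H1 k hk).2, if_pos (.inl hk)]
    by_cases hk' : k = x.length
    · rw [hk', H2.2, if_neg (by omega)]
    by_cases hkm : k < x.length + 1 + m
    · have e := h1 (k - x.length - 1) (by omega)
      rw [show x.length + (k - x.length - 1) + 1 = k by omega] at e
      rw [e, if_pos (by omega)]
    · have e := h0 (k - x.length - 1) (by omega) (by omega)
      rw [show x.length + (k - x.length - 1) + 1 = k by omega] at e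
      rw [e, if_neg (by omega)]

theorem holds_initial (x x' : List K) (hv : ∀ z, v (.cell 0 z) = guessState x x' z) :
    Holds ord v (inputConstraints x) ∧ Holds ord v (separatorConstraints K x.length) ∧
      Holds ord v (guessConstraints K x.length W) := by
  rw [holds_guessConstraints]
  simp only [inputConstraints, holds_range, holds_cons, holds_nil, and_true,
    Schema.eval_eq_ne_zero, separatorConstraints]
  simp only [Schema.eval, hv, guessState_negSucc, guessState_ofNat]
  refine ⟨fun j hj => ⟨by rw [List.getD_append _ _ _ _ hj], if_pos (.inl hj)⟩,
    ⟨guessState_zero _ _, if_neg (by omega)⟩, fun j _ => ?_⟩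
  by_cases hj : j < x'.length
  · rw [if_pos (show x.length + j + 1 < x.length ∨ x.length < x.length + j + 1 ∧
      x.length + j + 1 < x.length + 1 + x'.length by omega)]
    simp
  · rw [if_neg (show ¬ (x.length + j + 1 < x.length ∨ x.length < x.length + j + 1 ∧
      x.length + j + 1 < x.length + 1 + x'.length) by omega),
      if_neg (show ¬ (x.length + j + 2 < x.length ∨ x.length < x.length + j + 2 ∧
      x.length + j + 2 < x.length + 1 + x'.length) by omega),
      List.getD_eq_default _ _ (by simp; omega)]
    simp

/-- The tableau can be filled in if and only if the machine accepts for some guess. -/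
theorem exists_holds_tableau (hw : ∀ q, (M.instr q).bound ≤ w) (h2 : 2 ≤ w)
    (x : List K) (T : ℕ) (hT : ∀ x', M.HaltsWithin ord (guessState x x') T) :
    (∃ v : Var → K, Holds ord v (tableau M w x T)) ↔
      ∃ (x' : List K) (y : K), M.Outputs ord (guessState x x') [y] ∧ y ≠ 0 := by
  have hfinal : ∀ x', (M.run ord (guessState x x') T).1 = M.outputNode := by
    intro x'
    obtain ⟨t, ht, h⟩ := hT x'
    rw [M.run_eq_of_halted h ht, h]
  have hstep : ∀ a t, M.run ord a (t + 1) = M.step ord (M.run ord a t) := fun a t =>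
    Function.iterate_succ_apply' _ _ _
  constructor
  · rintro ⟨v, hv⟩
    simp only [tableau, holds_append, holds_range] at hv
    obtain ⟨⟨⟨⟨⟨i1, i2⟩, i3⟩, i4⟩, i5⟩, i6⟩ := hv
    obtain ⟨x', hx'⟩ := exists_guess i1 i2 i3
    -- at the time `T` the window still has the size `w ≥ 2`, as the output constraints need
    have hD : ∀ t ≤ T, Describes v M t (T + w - t) (M.run ord (guessState x x') t) := by
      intro t
      induction t with
      | zero =>
        refine fun _ => ⟨fun q => ?_, hx'⟩
        have := holds_map.1 i4 q (M.mem_nodes q)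
        rwa [Schema.eval_eq_ne_zero] at this
      | succ t ih =>
        intro ht
        obtain ⟨⟨j1, j2⟩, j3⟩ := i5 t (by omega)
        rw [hstep]
        exact describes_step (m := T + w - t) hw h2 (by omega) (by omega) (ih (by omega)) j1 j2 j3
    obtain ⟨r1, r2⟩ := (holds_outputConstraints (hD T le_rfl) (by omega)).1 i6
    exact ⟨x', _, (M.outputs_iff_of_halted (hfinal x') _).2 r1, r2⟩
  · rintro ⟨x', y, hy, hy0⟩
    let v : Var → K := fun a => match a with
      | .cell t z => (M.run ord (guessState x x') t).2 z
      | .node t i => open Classical in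
        if M.index (M.run ord (guessState x x') t).1 = i then 1 else 0
    have hD : ∀ t m, Describes v M t m (M.run ord (guessState x x') t) := by
      intro t m
      refine ⟨fun q => ?_, fun z _ => rfl⟩
      classical exact if_congr M.index_injective.eq_iff rfl rfl
    rw [M.outputs_iff_of_halted (hfinal x')] at hy
    refine ⟨v, ?_⟩
    obtain ⟨k1, k2, k3⟩ := holds_initial (ord := ord) (v := v) (W := T + w) x x' fun z => rfl
    simp only [tableau, holds_append, holds_range]
    refine ⟨⟨⟨⟨⟨k1, k2⟩, k3⟩, holds_map.2 fun q _ => ?_⟩, fun t _ => ?_⟩, ?_⟩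
    · rw [Schema.eval_eq_ne_zero]
      exact (hD 0 0).1 q
    · have := holds_step (ord := ord) (W := T + w) hw h2 (hD t) (fun m => hstep _ t ▸ hD (t + 1) m)
      simpa only [holds_append] using this
    · rw [holds_outputConstraints (hD T 2) le_rfl]
      have e : y = (M.run ord (guessState x x') T).2 1 := hy.2.2 ⟨0, by simp⟩
      exact ⟨e ▸ hy, e ▸ hy0⟩

end

/-! ### Programs that write strings -/

section
variable {K : Type u} [Semiring K]

/-- Push the elements of a list one by one. -/
def pushList (r : Reg) : List K → Cmd K
  | [] => skip
  | c :: w => push r c ;; pushList r w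

/-- Push the list `w` onto the stack `r` once for every element of the stack `s`. -/
def pushRepeated (r s : Reg) (w : List K) : Cmd K :=
  whileNonempty s (pushList r w ;; moveTop 7 s) ;; moveAll s 7

/-- Do `P` once for every element of the stack `s`, while the elements move to the stack `r`. -/
def forEach (r s : Reg) (P : Cmd K) : Cmd K := whileNonempty s (P ;; moveTop r s) ;; moveAll s r

/-- The store in the round `j` of a loop that moves the stack `s` to the stack `r`. -/
def loopStore (r s : Reg) (σ : Store K) (j : ℕ) : Store K :=
  Function.update (Function.update σ r ((σ s).take j).reverse) s ((σ s).drop j)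

/-- Some program writes the string `w σ` in every store `σ` with the property `pre`, in time
polynomial in the size of the store. It writes onto the stack 0, needs the stack 7 for intermediate
results, and restores all other stacks. -/
def Emittable (ord : Option (SemiringOrder K)) (pre : Store K → Prop) (w : Store K → List K) :
    Prop :=
  ∃ (P : Cmd K) (c k : ℕ), ∀ (σ : Store K) (L : ℕ), pre σ → σ 7 = [] →
    (∀ r, r ≠ 0 → (σ r).length ≤ L) → ∀ o : List K, Does ord P (Function.update σ 0 o)
      (Function.update σ 0 ((w σ).reverse ++ o)) (c * (L + 1) ^ k)

end

section
variable {K : Type u} [Semiring K] [Nontrivial K] {ord : Option (SemiringOrder K)}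
  {pre pre' : Store K → Prop} {w w' : Store K → List K}

theorem does_pushList (r : Reg) : ∀ (w : List K) (σ : Store K),
    Does ord (pushList r w) σ (Function.update σ r (w.reverse ++ σ r)) (w.length + 1)
  | [], σ => (does_skip σ).congr (by simp)
  | c :: w, σ => ((Does.push_seq (does_pushList r w _)).congr (by simp)).mono
      (by simp only [List.length_cons]; omega)

theorem does_pushRepeated_loop {r s : Reg} (hr : r ≠ 7) (hs : s ≠ 7) (hrs : r ≠ s) (w : List K) :
    ∀ (l : List K) (σ : Store K), σ s = l →
    Does ord (whileNonempty s (pushList r w ;; moveTop 7 s)) σ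
      (Function.update (Function.update (Function.update σ r
        ((List.replicate l.length w).flatten.reverse ++ σ r)) s []) 7 (l.reverse ++ σ 7))
      ((w.length + 4) * l.length + 1)
  | [], σ, h => (does_whileNonempty_nil h).congr (by
      simp only [List.length_nil, List.replicate_zero, List.flatten_nil, List.reverse_nil,
        List.nil_append]
      rw [Function.update_eq_self, ← h, Function.update_eq_self, Function.update_eq_self])
  | c :: l, σ, h => by
      refine ((does_whileNonempty_cons (by simp [h]) ((does_pushList r w σ).seq (does_moveTop hs
        (c := c) (l := l) (by rw [Function.update_of_ne hrs.symm, h])))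
        (does_pushRepeated_loop hr hs hrs w l _ (Function.update_self _ _ _))).congr ?_).mono ?_
      · funext q
        by_cases h7 : q = 7
        · subst h7
          simp [Function.update_of_ne hs.symm, Function.update_of_ne hr.symm]
        · by_cases hqs : q = s
          · subst hqs
            simp [Function.update_of_ne h7]
          · by_cases hqr : q = r
            · subst hqr
              simp [Function.update_of_ne h7, Function.update_of_ne hqs, List.replicate_succ]
            · simp [Function.update_of_ne h7, Function.update_of_ne hqs, Function.update_of_ne hqr]
      · simp only [List.length_cons]
        ring_nf
        omega

theorem does_pushRepeated {r s : Reg} (hr : r ≠ 7) (hs : s ≠ 7) (hrs : r ≠ s) (w : List K)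
    (σ : Store K) (h7 : σ 7 = []) :
    Does ord (pushRepeated r s w) σ
      (Function.update σ r ((List.replicate (σ s).length w).flatten.reverse ++ σ r))
      ((w.length + 7) * (σ s).length + 2) := by
  refine (((does_pushRepeated_loop hr hs hrs w _ σ rfl).seq (does_moveAll hs.symm _ _ rfl)).congr
    ?_).mono ?_
  · funext q
    by_cases hq7 : q = 7
    · subst hq7
      simp [h7, Function.update_of_ne hr.symm]
    · by_cases hqs : q = s
      · subst hqs
        simp [Function.update_of_ne hq7, h7, Function.update_of_ne hrs.symm]
      · by_cases hqr : q = r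
        · subst hqr
          simp [Function.update_of_ne hq7, Function.update_of_ne hqs]
        · simp [Function.update_of_ne hq7, Function.update_of_ne hqs, Function.update_of_ne hqr]
  · simp only [h7, List.append_nil, Function.update_self, List.length_reverse]
    ring_nf
    omega

theorem loopStore_of_ne {r s q : Reg} (hr : q ≠ r) (hs : q ≠ s) (σ : Store K) (j : ℕ) :
    loopStore r s σ j q = σ q := by
  rw [loopStore, Function.update_of_ne hs, Function.update_of_ne hr]

theorem loopStore_counter {r s : Reg} (hrs : r ≠ s) (σ : Store K) (j : ℕ) :
    loopStore r s σ j r = ((σ s).take j).reverse := by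
  rw [loopStore, Function.update_of_ne hrs, Function.update_self]

theorem loopStore_source {r s : Reg} (σ : Store K) (j : ℕ) :
    loopStore r s σ j s = (σ s).drop j := Function.update_self _ _ _

namespace Emittable

theorem mono (H : Emittable ord pre w) (h : ∀ σ, pre' σ → pre σ) : Emittable ord pre' w := by
  obtain ⟨P, c, k, H⟩ := H
  exact ⟨P, c, k, fun σ L hσ => H σ L (h σ hσ)⟩

theorem congr (H : Emittable ord pre w) (h : ∀ σ, pre σ → w σ = w' σ) : Emittable ord pre w' := by
  obtain ⟨P, c, k, H⟩ := H
  exact ⟨P, c, k, fun σ L hσ => h σ hσ ▸ H σ L hσ⟩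

theorem list (l : List K) : Emittable ord pre fun _ => l :=
  ⟨pushList 0 l, l.length + 1, 0, fun σ L _ _ _ o =>
    ((does_pushList 0 l _).congr (by simp)).mono (by simp)⟩

theorem append (H : Emittable ord pre w) (H' : Emittable ord pre w') :
    Emittable ord pre fun σ => w σ ++ w' σ := by
  obtain ⟨P, c, k, H⟩ := H
  obtain ⟨P', c', k', H'⟩ := H'
  refine ⟨P ;; P', c + c', k + k', fun σ L h1 h2 h3 o => ?_⟩
  refine (((H σ L h1 h2 h3 o).seq (H' σ L h1 h2 h3 _)).congr (by simp)).mono ?_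
  have e1 : (L + 1) ^ k ≤ (L + 1) ^ (k + k') := Nat.pow_le_pow_right (by omega) (by omega)
  have e2 : (L + 1) ^ k' ≤ (L + 1) ^ (k + k') := Nat.pow_le_pow_right (by omega) (by omega)
  rw [add_mul]
  gcongr

theorem flatMap {α : Type*} (l : List α) {f : α → Store K → List K}
    (H : ∀ a, Emittable ord pre (f a)) : Emittable ord pre fun σ => l.flatMap fun a => f a σ := by
  induction l with
  | nil => exact list []
  | cons a l ih => exact (H a).append ih

/-- Write a list once for every element of a stack. -/
theorem replicate {s : Reg} (h0 : s ≠ 0) (h7 : s ≠ 7) (l : List K) :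
    Emittable ord pre fun σ => (List.replicate (σ s).length l).flatten := by
  refine ⟨pushRepeated 0 s l, l.length + 7, 1, fun σ L _ h2 h3 o => ?_⟩
  refine ((does_pushRepeated (r := 0) (by decide) h7 h0.symm l _ ?_).congr ?_).mono ?_
  · rw [Function.update_of_ne (by decide), h2]
  · simp [Function.update_of_ne h0]
  · have := h3 s h0
    rw [Function.update_of_ne h0, pow_one]
    nlinarith

/-- Write the top of a stack. -/
theorem head {s : Reg} (h0 : s ≠ 0) :
    Emittable ord (fun σ => σ s ≠ []) fun σ => [(σ s).headD 0] := by
  refine ⟨pushTop 0 s, 1, 0, fun σ L h1 _ _ o => ?_⟩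
  obtain ⟨c, l, hs⟩ := List.exists_cons_of_ne_nil h1
  refine ((does_pushTop (r := 0) (s := s) (c := c) (l := l) ?_).congr ?_).mono (by simp)
  · rw [Function.update_of_ne h0, hs]
  · simp [hs]

/-- Write a string for every element of a stack. -/
theorem forEach {r s : Reg} (hr0 : r ≠ 0) (hr7 : r ≠ 7) (hs0 : s ≠ 0) (hs7 : s ≠ 7) (hrs : r ≠ s)
    (H : Emittable ord pre w) (hpre : ∀ σ, pre' σ → σ r = [] ∧
      ∀ j < (σ s).length, pre (loopStore r s σ j)) :
    Emittable ord pre' fun σ =>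
      (List.range (σ s).length).flatMap fun j => w (loopStore r s σ j) := by
  obtain ⟨P, c, k, H⟩ := H
  refine ⟨CookK.forEach r s P, c + 8, k + 1, fun σ L h1 h2 h3 o => ?_⟩
  obtain ⟨hr, hpre⟩ := hpre σ h1
  have hlen : ∀ j q, q ≠ 0 → (loopStore r s σ j q).length ≤ L := by
    intro j q hq
    by_cases hqs : q = s
    · subst hqs
      rw [loopStore_source, List.length_drop]
      exact (Nat.sub_le _ _).trans (h3 q hq)
    · by_cases hqr : q = r
      · subst hqr
        rw [loopStore_counter hrs, List.length_reverse, List.length_take]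
        exact (min_le_right _ _).trans (h3 s hs0)
      · rw [loopStore_of_ne hqr hqs]
        exact h3 q hq
  have hloop : ∀ m j o, j + m = (σ s).length → Does ord (whileNonempty s (P ;; moveTop r s))
      (Function.update (loopStore r s σ j) 0 o)
      (Function.update (loopStore r s σ (σ s).length) 0
        (((List.range' j m).flatMap fun i => w (loopStore r s σ i)).reverse ++ o))
      ((c * (L + 1) ^ k + 3) * m + 1) := by
    intro m
    induction m with
    | zero =>
      intro j o hj
      rw [add_zero] at hj
      subst hj
      exact does_whileNonempty_nil (by rw [Function.update_of_ne hs0, loopStore_source]; simp)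
    | succ m ih =>
      intro j o hj
      have hj' : j < (σ s).length := by omega
      have hd : loopStore r s σ j s = (σ s)[j] :: (σ s).drop (j + 1) := by
        rw [loopStore_source, List.drop_eq_getElem_cons hj']
      have hmid : Function.update (Function.update (Function.update (loopStore r s σ j) 0
          ((w (loopStore r s σ j)).reverse ++ o)) r ((σ s)[j] :: loopStore r s σ j r)) s
          ((σ s).drop (j + 1)) = Function.update (loopStore r s σ (j + 1)) 0
          ((w (loopStore r s σ j)).reverse ++ o) := by
        funext q
        by_cases hqs : q = s
        · subst hqs
          rw [Function.update_self, Function.update_of_ne hs0, loopStore_source]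
        · rw [Function.update_of_ne hqs]
          by_cases hqr : q = r
          · subst hqr
            rw [Function.update_self, Function.update_of_ne hr0, loopStore_counter hrs,
              loopStore_counter hrs, List.take_succ_eq_append_getElem hj', List.reverse_append]
            rfl
          · rw [Function.update_of_ne hqr]
            by_cases hq0 : q = 0
            · subst hq0
              rw [Function.update_self, Function.update_self]
            · rw [Function.update_of_ne hq0, Function.update_of_ne hq0, loopStore_of_ne hqr hqs,
                loopStore_of_ne hqr hqs]
      have hP := H (loopStore r s σ j) L (hpre j hj')
        (by rw [loopStore_of_ne hr7.symm hs7.symm, h2]) (hlen j) o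
      have hmove := does_moveTop (ord := ord) (r := r) (s := s) (c := (σ s)[j])
        (l := (σ s).drop (j + 1)) (σ := Function.update (loopStore r s σ j) 0
          ((w (loopStore r s σ j)).reverse ++ o)) hrs.symm (by rw [Function.update_of_ne hs0, hd])
      rw [Function.update_of_ne hr0 _ (loopStore r s σ j), hmid] at hmove
      refine ((does_whileNonempty_cons (by
        rw [Function.update_of_ne hs0, hd]; exact List.cons_ne_nil _ _)
        (hP.seq hmove) (ih (j + 1) _ (by omega))).congr ?_).mono ?_
      · rw [List.range'_succ, List.flatMap_cons, List.reverse_append, List.append_assoc]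
      · ring_nf
        omega
  have h0 : loopStore r s σ 0 = σ := by
    funext q
    by_cases hqs : q = s
    · subst hqs; simp [loopStore]
    · by_cases hqr : q = r
      · subst hqr; simp [loopStore_counter hrs, hr]
      · rw [loopStore_of_ne hqr hqs]
  have hfinal := hloop (σ s).length 0 o (by omega)
  rw [h0, ← List.range_eq_range'] at hfinal
  refine ((hfinal.seq (does_moveAll hrs (σ s).reverse _ ?_)).congr ?_).mono ?_
  · rw [Function.update_of_ne hr0, loopStore_counter hrs, List.take_length]
  · funext q
    by_cases hqr : q = r
    · subst hqr; simp [Function.update_of_ne hr0, hr]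
    · rw [Function.update_of_ne hqr]
      by_cases hqs : q = s
      · subst hqs
        simp [Function.update_of_ne hs0, loopStore_source]
      · rw [Function.update_of_ne hqs]
        by_cases hq0 : q = 0
        · subst hq0; simp
        · rw [Function.update_of_ne hq0, Function.update_of_ne hq0, loopStore_of_ne hqr hqs]
  · have hL := h3 s hs0
    rw [List.length_reverse]
    have e1 : (c * (L + 1) ^ k + 3) * (σ s).length ≤ (c * (L + 1) ^ k + 3) * L := by gcongr
    have e2 : L + 1 ≤ (L + 1) ^ (k + 1) := Nat.le_self_pow (by omega) _
    have e3 : (c + 8) * (L + 1) ^ (k + 1) = c * (L + 1) ^ k * L + c * (L + 1) ^ k +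
      8 * (L + 1) ^ (k + 1) := by ring
    rw [e3]
    nlinarith

end Emittable

end

/-! ### Writing the tableau -/

/-- A natural number given by the sizes of stacks: the total size of the stacks `regs`, increased by
`const`. The stacks `0` and `7` are reserved for writing. -/
structure Numeral where
  regs : List { r : Reg // r ≠ 0 ∧ r ≠ 7 }
  const : ℕ

/-- The number denoted by a numeral. -/
def Numeral.val {K : Type u} (σ : Store K) (ν : Numeral) : ℕ :=
  (ν.regs.map fun r => (σ r.1).length).sum + ν.const

/-- A variable of a tableau with numerals in place of numbers. The coordinate of a cell is given by
its sign and a numeral, where the numeral `n` with the negative sign stands for `-(n + 1)`. -/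
inductive SchematicVar : Type
  | cell (t : Numeral) (neg : Bool) (z : Numeral)
  | node (t : Numeral) (i : ℕ)

/-- The coordinate with a given sign. -/
def signed : Bool → ℕ → ℤ
  | false, n => Int.ofNat n
  | true, n => Int.negSucc n

/-- The variable denoted by a schematic variable. -/
def SchematicVar.val {K : Type u} (σ : Store K) : SchematicVar → Var
  | cell t neg z => .cell (t.val σ) (signed neg (z.val σ))
  | node t i => .node (t.val σ) i

/-- The cell with a fixed coordinate. -/
def SchematicVar.fixed (t : Numeral) : ℤ → SchematicVar
  | .ofNat n => .cell t false ⟨[], n⟩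
  | .negSucc n => .cell t true ⟨[], n⟩

theorem signed_false (n : ℕ) : signed false n = Int.ofNat n := rfl

theorem signed_true (n : ℕ) : signed true n = Int.negSucc n := rfl

theorem SchematicVar.val_cell {K : Type u} (σ : Store K) (t : Numeral) (neg : Bool) (z : Numeral) :
    (cell t neg z).val σ = .cell (t.val σ) (signed neg (z.val σ)) := rfl

theorem SchematicVar.val_node {K : Type u} (σ : Store K) (t : Numeral) (i : ℕ) :
    (node t i).val σ = .node (t.val σ) i := rfl

theorem SchematicVar.val_fixed {K : Type u} (σ : Store K) (t : Numeral) (z : ℤ) :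
    (fixed t z).val σ = .cell (t.val σ) z := by
  cases z <;> simp [fixed, val, Numeral.val, signed]

/-- The part of the code of a conjunction that belongs to its members. -/
def code {K : Type u} [Semiring K] (ord : Option (SemiringOrder K)) (l : List (Schema K Var)) :
    List K :=
  l.flatMap fun φ => (φ.toFormula ord Var.name).encode ++ [1, 0, 1]

section
variable {K : Type u} [Semiring K] [Nontrivial K] {ord : Option (SemiringOrder K)}
  {pre : Store K → Prop} {M : Machine K}

theorem code_append (l m : List (Schema K Var)) : code ord (l ++ m) = code ord l ++ code ord m :=
  List.flatMap_append

theorem code_flatMap {α : Type*} (l : List α) (f : α → List (Schema K Var)) :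
    code ord (l.flatMap f) = l.flatMap fun a => code ord (f a) := List.flatMap_assoc

theorem encodeProposition_append (p q : Proposition) :
    encodeProposition K (p ++ q) = p.flatMap (fun b => [1, bit K b]) ++ encodeProposition K q := by
  simp [encodeProposition]

theorem emittable_unary (ν : Numeral) : Emittable ord pre fun σ =>
    (List.replicate (ν.val σ) true).flatMap fun b => [1, bit K b] := by
  have h : ∀ n, (List.replicate n true).flatMap (fun b => [1, bit K b]) =
      (List.replicate n [1, 1]).flatten := by
    intro n
    rw [List.flatMap_replicate]
    rfl
  simp only [h]
  obtain ⟨regs, m⟩ := ν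
  induction regs with
  | nil => simpa [Numeral.val] using Emittable.list _
  | cons r regs ih =>
    refine ((Emittable.replicate r.2.1 r.2.2 [1, 1]).append ih).congr fun σ _ => ?_
    simp only [Numeral.val, List.map_cons, List.sum_cons]
    simp only [add_assoc, List.replicate_add, List.flatten_append]

theorem emittable_var (a : SchematicVar) :
    Emittable ord pre fun σ => encodeLiteral K (a.val σ).name := by
  cases a with
  | cell t neg z =>
    refine ((Emittable.list [0, 0, 0]).append ((emittable_unary t).append
      ((Emittable.list [1, 0, 1, bit K neg]).append ((emittable_unary z).append
      (Emittable.list [0]))))).congr fun σ _ => ?_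
    cases neg <;>
      simp [SchematicVar.val, Var.name, encodeLiteral, signed, coordName, encodeProposition, bit]
  | node t i =>
    refine ((Emittable.list [0, 0, 1]).append ((emittable_unary t).append
      ((Emittable.list (encodeProposition K (false :: List.replicate i true)))))).congr
      fun σ _ => ?_
    simp [SchematicVar.val, Var.name, encodeLiteral, encodeProposition_append]

theorem emittable_schema (φ : Schema K SchematicVar) : Emittable ord pre fun σ =>
    ((φ.map (SchematicVar.val σ)).toFormula ord Var.name).encode := by
  induction φ with
  | var a => exact emittable_var a
  | const c => exact Emittable.list _
  | eq φ ψ h1 h2 => exact (h1.append h2).append (.list [0, 1, 1])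
  | and φ ψ h1 h2 => exact (h1.append h2).append (.list [1, 0, 1])
  | or φ ψ h1 h2 => exact (h1.append h2).append (.list [1, 1, 0])
  | test φ ψ h1 h2 =>
    by_cases ho : ord.isSome
    · refine ((h1.append h2).append (.list [1, 0, 0])).congr fun σ _ => ?_
      simp [Schema.map, Schema.toFormula, ho, Formula.encode]
    · refine ((h1.append h2).append (.list [0, 1, 1])).congr fun σ _ => ?_
      simp [Schema.map, Schema.toFormula, ho, Formula.encode]

theorem emittable_code (l : List (Schema K SchematicVar)) : Emittable ord pre fun σ =>
    code ord (l.map (Schema.map (SchematicVar.val σ))) := by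
  simp only [code, List.flatMap_map]
  exact Emittable.flatMap l fun φ => (emittable_schema φ).append (.list _)

/-- A stack that may occur in a numeral. -/
def counter (r : Reg) (h : r ≠ 0 ∧ r ≠ 7 := by decide) : { r : Reg // r ≠ 0 ∧ r ≠ 7 } := ⟨r, h⟩

theorem emittable_loop {r s : Reg} {pre' : Store K → Prop} {f : Store K → List (Schema K Var)}
    {k : Store K → ℕ} {g : Store K → ℕ → List (Schema K Var)}
    (hr : r ≠ 0 ∧ r ≠ 7) (hs : s ≠ 0 ∧ s ≠ 7) (hrs : r ≠ s)
    (H : Emittable ord pre' fun σ => code ord (f σ))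
    (hpre : ∀ σ, pre σ → σ r = [] ∧ (σ s).length = k σ ∧
      ∀ j < (σ s).length, pre' (loopStore r s σ j) ∧ f (loopStore r s σ j) = g σ j) :
    Emittable ord pre fun σ => code ord ((List.range (k σ)).flatMap (g σ)) := by
  refine (Emittable.forEach hr.1 hr.2 hs.1 hs.2 hrs H fun σ hσ =>
    ⟨(hpre σ hσ).1, fun j hj => ((hpre σ hσ).2.2 j hj).1⟩).congr fun σ hσ => ?_
  obtain ⟨-, h1, h2⟩ := hpre σ hσ
  rw [code_flatMap, ← h1]
  refine List.flatMap_congr fun j hj => ?_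
  rw [(h2 j (List.mem_range.1 hj)).2]

theorem length_loopStore {r s : Reg} (hrs : r ≠ s) {σ : Store K} {j : ℕ} (hj : j < (σ s).length) :
    (loopStore r s σ j r).length = j := by
  rw [loopStore_counter hrs, List.length_reverse, List.length_take, min_eq_left hj.le]

theorem emittable_inputConstraints : Emittable ord (fun σ => σ 5 = [])
    fun σ => code ord (inputConstraints (σ 1)) := by
  refine emittable_loop (r := 5) (s := 1) (pre' := fun σ => σ 1 ≠ [])
    (f := fun σ => [.eq (.var (.cell 0 (Int.ofNat ((σ 5).length + 1)))) (.const ((σ 1).headD 0)),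
      .eq (.var (.cell 0 (Int.negSucc (σ 5).length))) (.const 1)])
    (by decide) (by decide) (by decide) ?_ fun σ hσ => ⟨hσ, rfl, fun j hj => ⟨?_, ?_⟩⟩
  · refine ((emittable_var (.cell ⟨[], 0⟩ false ⟨[counter 5], 1⟩)).append ((Emittable.list
      [0, 1, 0]).append (((Emittable.head (s := 1) (by decide)).append (Emittable.list
      [0, 1, 1, 1, 0, 1])).append (emittable_code
      [.eq (.var (.cell ⟨[], 0⟩ true ⟨[counter 5], 0⟩)) (.const 1)])))).congr fun σ _ => ?_
    simp [code, SchematicVar.val, Schema.map, Numeral.val, signed, counter, Schema.toFormula,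
      Formula.encode]
  · rw [loopStore_source]
    simpa using hj
  · rw [length_loopStore (by decide) hj, loopStore_source]
    simp [List.headD_eq_head?_getD, List.getD_eq_getElem?_getD]

theorem emittable_guessConstraints : Emittable ord (fun σ => σ 5 = [])
    fun σ => code ord (guessConstraints K (σ 2).length (σ 3).length) := by
  refine emittable_loop (r := 5) (s := 3) (pre' := fun _ => True)
    (by decide) (by decide) (by decide) (emittable_code
    [.or (.eq (.var (.cell ⟨[], 0⟩ true ⟨[counter 2, counter 5], 1⟩)) (.const 1))
      (.eq (.var (.cell ⟨[], 0⟩ true ⟨[counter 2, counter 5], 1⟩)) (.const 0)),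
    .eq (.var (.cell ⟨[], 0⟩ true ⟨[counter 2, counter 5], 2⟩))
      (.and (.var (.cell ⟨[], 0⟩ true ⟨[counter 2, counter 5], 2⟩))
        (.var (.cell ⟨[], 0⟩ true ⟨[counter 2, counter 5], 1⟩))),
    .eq (.var (.cell ⟨[], 0⟩ false ⟨[counter 2, counter 5], 1⟩))
      (.and (.var (.cell ⟨[], 0⟩ false ⟨[counter 2, counter 5], 1⟩))
        (.var (.cell ⟨[], 0⟩ true ⟨[counter 2, counter 5], 1⟩)))])
    fun σ hσ => ⟨hσ, rfl, fun j hj => ⟨trivial, ?_⟩⟩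
  simp [SchematicVar.val, Schema.map, Numeral.val, signed, counter, length_loopStore _ hj,
    loopStore_of_ne (r := 5) (s := 3) (q := 2)]

/-- The current time is the size of the stack 6. -/
def timeNumeral (k : ℕ) : Numeral := ⟨[counter 6], k⟩

theorem val_timeNumeral (σ : Store K) (k : ℕ) : (timeNumeral k).val σ = (σ 6).length + k := by
  simp [timeNumeral, Numeral.val, counter]

theorem emittable_nodeConstraints : Emittable ord pre
    fun σ => code ord (nodeConstraints M (σ 6).length) := by
  refine (emittable_code (M.nodes.map fun q => nodeStep M
    (fun q' => .node (timeNumeral 0) (M.index q')) (.fixed (timeNumeral 0))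
    (.node (timeNumeral 1) (M.index q)) q)).congr fun σ _ => ?_
  rw [List.map_map, nodeConstraints]
  congr 1
  refine List.map_congr_left fun q _ => ?_
  simp only [Function.comp_apply, map_nodeStep, SchematicVar.val_fixed,
    SchematicVar.val_node, val_timeNumeral, add_zero]

theorem emittable_nearConstraints (w : ℕ) : Emittable ord pre
    fun σ => code ord (nearConstraints M w (σ 6).length) := by
  refine (emittable_code ((nearCoords w).map fun z => cellStep M
    (fun q' => .node (timeNumeral 0) (M.index q')) (.fixed (timeNumeral 0))
    (fun i => decide (z = i)) (.fixed (timeNumeral 1) z) (.fixed (timeNumeral 0) z)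
    (.fixed (timeNumeral 0) (z + 1)) (.fixed (timeNumeral 0) (z - 1)))).congr fun σ _ => ?_
  rw [List.map_map, nearConstraints]
  congr 1
  refine List.map_congr_left fun q _ => ?_
  simp only [Function.comp_apply, map_cellStep, SchematicVar.val_fixed,
    SchematicVar.val_node, val_timeNumeral, add_zero]

theorem emittable_farConstraints (w : ℕ) : Emittable ord (fun σ => σ 5 = [])
    fun σ => code ord (farConstraints M w (σ 3).length (σ 6).length) := by
  refine emittable_loop (r := 5) (s := 3) (pre' := fun _ => True)
    (by decide) (by decide) (by decide) (emittable_code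
    [cellStep M (fun q => .node (timeNumeral 0) (M.index q)) (.fixed (timeNumeral 0))
      (fun _ => false) (.cell (timeNumeral 1) false ⟨[counter 5], w + 1⟩)
      (.cell (timeNumeral 0) false ⟨[counter 5], w + 1⟩)
      (.cell (timeNumeral 0) false ⟨[counter 5], w + 2⟩)
      (.cell (timeNumeral 0) false ⟨[counter 5], w⟩),
    cellStep M (fun q => .node (timeNumeral 0) (M.index q)) (.fixed (timeNumeral 0))
      (fun _ => false) (.cell (timeNumeral 1) true ⟨[counter 5], w⟩)
      (.cell (timeNumeral 0) true ⟨[counter 5], w⟩)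
      (.cell (timeNumeral 0) true ⟨[counter 5], w - 1⟩)
      (.cell (timeNumeral 0) true ⟨[counter 5], w + 1⟩)])
    fun σ hσ => ⟨hσ, rfl, fun j hj => ⟨trivial, ?_⟩⟩
  have h6 : loopStore 5 3 σ j 6 = σ 6 := loopStore_of_ne (by decide) (by decide) _ _
  have h5 : ∀ k, Numeral.val (loopStore 5 3 σ j) ⟨[counter 5], k⟩ = j + k := by
    intro k
    simp [Numeral.val, counter, length_loopStore _ hj]
  simp only [List.map_cons, List.map_nil, map_cellStep, SchematicVar.val_fixed,
    SchematicVar.val_cell, SchematicVar.val_node, val_timeNumeral, h6, h5, signed_false,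
    signed_true, add_zero]

theorem emittable_stepConstraints (w : ℕ) : Emittable ord (fun σ => σ 5 = [] ∧ σ 6 = [])
    fun σ => code ord ((List.range (σ 4).length).flatMap fun t =>
      nodeConstraints M t ++ nearConstraints M w t ++ farConstraints M w (σ 3).length t) := by
  refine emittable_loop (r := 6) (s := 4) (pre' := fun σ => σ 5 = [])
    (f := fun σ => nodeConstraints M (σ 6).length ++ nearConstraints M w (σ 6).length ++
      farConstraints M w (σ 3).length (σ 6).length)
    (by decide) (by decide) (by decide) ?_ fun σ hσ => ⟨hσ.2, rfl, fun j hj => ⟨?_, ?_⟩⟩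
  · simp only [code_append]
    exact (emittable_nodeConstraints.append (emittable_nearConstraints w)).append
      (emittable_farConstraints w)
  · rw [loopStore_of_ne (by decide) (by decide), hσ.1]
  · rw [length_loopStore (by decide) hj, loopStore_of_ne (by decide) (by decide)]

/-- The store is ready for writing the tableau: the stacks 2, 3 and 4 hold the unary codes of the
length of the input, of the size of the window and of the running time. -/
def TableauReady (w : ℕ) (σ : Store K) : Prop :=
  (σ 2).length = (σ 1).length ∧ (σ 3).length = (σ 4).length + w ∧ σ 5 = [] ∧ σ 6 = []

theorem emittable_tableau (M : Machine K) (w : ℕ) : Emittable ord (TableauReady w) fun σ =>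
    (Schema.conj ord Var.name (tableau M w (σ 1) (σ 4).length)).encode := by
  have h1 := (emittable_inputConstraints (ord := ord)).mono fun σ (h : TableauReady w σ) => h.2.2.1
  have h2 := emittable_code (ord := ord) (pre := TableauReady (K := K) w)
    [.eq (.var (.cell ⟨[], 0⟩ false ⟨[], 0⟩)) (.const 0),
      .eq (.var (.cell ⟨[], 0⟩ true ⟨[counter 2], 0⟩)) (.const 0)]
  have h3 := (emittable_guessConstraints (ord := ord)).mono fun σ (h : TableauReady w σ) => h.2.2.1
  have h4 := Emittable.list (ord := ord) (pre := TableauReady w) (code ord (startConstraints M))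
  have h5 := (emittable_stepConstraints (ord := ord) (M := M) w).mono
    fun σ (h : TableauReady w σ) => h.2.2
  have h6 := emittable_code (ord := ord) (pre := TableauReady (K := K) w)
    [.eq (.var (.cell ⟨[counter 4], 0⟩ true ⟨[], 0⟩)) (.const 1),
      .eq (.eq (.var (.cell ⟨[counter 4], 0⟩ true ⟨[], 1⟩)) (.const 1)) (.const 0),
      .var (.cell ⟨[counter 4], 0⟩ false ⟨[], 1⟩)]
  refine ((Emittable.list [0, 1, 0, 1]).append (((((h1.append h2).append h3).append h4).append
    h5).append h6)).congr fun σ hσ => ?_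
  obtain ⟨e2, e3, -, -⟩ := hσ
  rw [Schema.encode_conj]
  change _ = _ ++ code ord _
  simp only [tableau, code_append, ← e2, ← e3]
  simp [separatorConstraints, outputConstraints, SchematicVar.val, Schema.map, Numeral.val, signed,
    counter]

end

/-! ### The reduction -/

section
variable {K : Type u} [Semiring K]

/-- Multiply the size of the stack 4 by `n + 1`, where `n` is the size of the stack 2. -/
def raise : Cmd K := whileNonempty 4 (moveTop 8 4 ;; pushRepeated 8 2 [0]) ;; moveAll 4 8

/-- Let the stack 4 have the size `c * (n + 1) ^ d`, where `n` is the size of the stack 2. -/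
def countPower (c : ℕ) : ℕ → Cmd K
  | 0 => pushList 4 (List.replicate c 0)
  | d + 1 => countPower c d ;; raise

/-- Let the stacks 4 and 3 have the sizes `c * (n + 1) ^ d` and `c * (n + 1) ^ d + w`, where `n` is
the size of the stack 2. -/
def prepareTableau (w c d : ℕ) : Cmd K :=
  countPower c d ;; pushRepeated 3 4 [0] ;; pushList 3 (List.replicate w 0)

end

section
variable {K : Type u} [Semiring K] [Nontrivial K] {ord : Option (SemiringOrder K)}

theorem does_raise_loop (n : ℕ) : ∀ (l : List K) (σ : Store K), σ 4 = l → (σ 2).length = n →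
    σ 7 = [] → ∃ l' : List K, l'.length = l.length * (n + 1) + (σ 8).length ∧
      Does ord (whileNonempty 4 (moveTop 8 4 ;; pushRepeated 8 2 [0])) σ
        (Function.update (Function.update σ 4 []) 8 l') ((8 * n + 5) * l.length + 1)
  | [], σ, h, _, _ => ⟨σ 8, by simp, (does_whileNonempty_nil h).congr (by
      rw [← h, Function.update_eq_self, Function.update_eq_self])⟩
  | c :: l, σ, h, h2, h7 => by
      have H1 := does_moveTop (ord := ord) (r := 8) (s := 4) (by decide) h
      have H2 := does_pushRepeated (ord := ord) (r := 8) (s := 2) (by decide) (by decide)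
        (by decide) [0] (Function.update (Function.update σ 8 (c :: σ 8)) 4 l) (by simpa using h7)
      obtain ⟨l', hl', H3⟩ := does_raise_loop n l (Function.update (Function.update
        (Function.update σ 8 (c :: σ 8)) 4 l) 8 ((List.replicate (σ 2).length
        [(0 : K)]).flatten.reverse ++ c :: σ 8)) (by simp) (by simpa using h2) (by simpa using h7)
      refine ⟨l', ?_, ((does_whileNonempty_cons (by simp [h])
        ((H1.seq H2).congr (by simp)) H3).congr ?_).mono ?_⟩
      · rw [hl']
        simp only [Function.update_self, List.length_append, List.length_reverse,
          List.length_flatten, List.map_replicate, List.sum_replicate, List.length_cons,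
          List.length_nil, h2]
        simp only [smul_eq_mul]
        ring
      · funext q
        by_cases h8 : q = 8
        · subst h8; simp
        · by_cases h4 : q = 4
          · subst h4; simp
          · simp [Function.update_of_ne h8, Function.update_of_ne h4]
      · have e : (Function.update (Function.update σ 8 (c :: σ 8)) 4 l) 2 = σ 2 := by simp
        rw [e, h2]
        simp only [List.length_cons, List.length_nil]
        ring_nf
        omega

theorem does_raise {σ : Store K} (h7 : σ 7 = []) (h8 : σ 8 = []) :
    ∃ l : List K, l.length = (σ 4).length * ((σ 2).length + 1) ∧
      Does ord raise σ (Function.update σ 4 l)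
        (20 * (((σ 4).length + 1) * ((σ 2).length + 1))) := by
  obtain ⟨l, hl, H⟩ := does_raise_loop (ord := ord) _ _ σ rfl rfl h7
  rw [h8, List.length_nil, add_zero] at hl
  refine ⟨l.reverse, by rw [List.length_reverse, hl], ((H.seq (does_moveAll (by decide) l _
    (Function.update_self _ _ _))).congr ?_).mono ?_⟩
  · funext q
    by_cases hq8 : q = 8
    · subst hq8; simp [h8]
    · by_cases hq4 : q = 4
      · subst hq4; simp
      · simp [Function.update_of_ne hq8, Function.update_of_ne hq4]
  · rw [hl]
    nlinarith

theorem does_countPower (c : ℕ) {σ : Store K} (h4 : σ 4 = []) (h7 : σ 7 = []) (h8 : σ 8 = []) :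
    ∀ d, ∃ l : List K, l.length = c * ((σ 2).length + 1) ^ d ∧
      Does ord (countPower c d) σ (Function.update σ 4 l)
        ((c + 1) * (20 * d + 1) * ((σ 2).length + 1) ^ d)
  | 0 => ⟨List.replicate c 0, by simp, ((does_pushList 4 (List.replicate c 0) σ).congr
      (by simp [h4])).mono (by simp)⟩
  | d + 1 => by
      obtain ⟨l, hl, H⟩ := does_countPower c h4 h7 h8 d
      obtain ⟨l', hl', H'⟩ := does_raise (ord := ord) (σ := Function.update σ 4 l)
        (by simpa using h7) (by simpa using h8)
      have e : Function.update σ 4 l 2 = σ 2 := by simp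
      rw [Function.update_self, e, hl] at hl' H'
      refine ⟨l', by rw [hl']; ring, ((H.seq H').congr (by simp)).mono ?_⟩
      have e1 : 1 ≤ ((σ 2).length + 1) ^ d := Nat.one_le_pow _ _ (by omega)
      have e2 : (c + 1) * (20 * d + 1) * ((σ 2).length + 1) ^ d ≤
          (c + 1) * (20 * d + 1) * ((σ 2).length + 1) ^ (d + 1) := by
        gcongr <;> omega
      have e3 : (c * ((σ 2).length + 1) ^ d + 1) * ((σ 2).length + 1) ≤
          (c + 1) * ((σ 2).length + 1) ^ (d + 1) := by
        rw [pow_succ, ← mul_assoc]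
        gcongr
        linarith
      calc _ ≤ (c + 1) * (20 * d + 1) * ((σ 2).length + 1) ^ (d + 1) +
            20 * ((c + 1) * ((σ 2).length + 1) ^ (d + 1)) := by gcongr
        _ = _ := by ring

theorem does_prepareTableau (w c d : ℕ) {σ : Store K} (h3 : σ 3 = []) (h4 : σ 4 = [])
    (h7 : σ 7 = []) (h8 : σ 8 = []) :
    ∃ l l' : List K, l.length = c * ((σ 2).length + 1) ^ d ∧
      l'.length = c * ((σ 2).length + 1) ^ d + w ∧
      Does ord (prepareTableau w c d) σ (Function.update (Function.update σ 4 l) 3 l')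
        ((c + 1) * (20 * d + 9) * ((σ 2).length + 1) ^ d + w + 3) := by
  obtain ⟨l, hl, H⟩ := does_countPower (ord := ord) c h4 h7 h8 d
  have H1 := does_pushRepeated (ord := ord) (r := 3) (s := 4) (by decide) (by decide) (by decide)
    [0] (Function.update σ 4 l) (by simpa using h7)
  refine ⟨l, List.replicate w 0 ++ (List.replicate l.length [(0 : K)]).flatten.reverse, hl, ?_,
    ((H.seq (H1.seq (does_pushList 3 (List.replicate w 0) _))).congr (by simp [h3])).mono ?_⟩
  · simp [hl, add_comm]
  · rw [Function.update_self, hl]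
    simp only [List.length_replicate, List.length_cons, List.length_nil]
    have e : 0 ≤ 8 * ((σ 2).length + 1) ^ d := Nat.zero_le _
    calc _ ≤ (c + 1) * (20 * d + 1) * ((σ 2).length + 1) ^ d +
          8 * (c + 1) * ((σ 2).length + 1) ^ d + w + 3 := by linarith
      _ = _ := by ring

end

theorem eval_le_mul_pow (p : Polynomial ℕ) (n : ℕ) :
    p.eval n ≤ p.eval 1 * (n + 1) ^ p.natDegree := by
  rw [Polynomial.eval_eq_sum_range, Polynomial.eval_eq_sum_range, Finset.sum_mul]
  refine Finset.sum_le_sum fun i hi => ?_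
  rw [one_pow, mul_one]
  exact mul_le_mul_right ((Nat.pow_le_pow_left n.le_succ i).trans
    (Nat.pow_le_pow_right (by omega) (by rw [Finset.mem_range] at hi; omega))) _

section
variable {K : Type u} [Semiring K] [Nontrivial K] {ord : Option (SemiringOrder K)}

/-- The formula for a tableau of polynomial size can be written in polynomial time. -/
theorem polyTimeComputable_tableau (M : Machine K) (w c d : ℕ) : PolyTimeComputable ord fun x =>
    (Schema.conj ord Var.name (tableau M w x (c * (x.length + 1) ^ d))).encode := by
  obtain ⟨P, a, k, H⟩ := emittable_tableau (ord := ord) M w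
  refine polyTimeComputable_of_does (splitInput ;; prepareTableau w c d ;; P) 0
    (30 * (.X + 1) + ((.C ((c + 1) * (20 * d + 9)) * (.X + 1) ^ d + .C (w + 3)) +
      .C a * (.X + .C c * (.X + 1) ^ d + .C (w + 2)) ^ k)) fun x => ?_
  have H1 := does_splitInput (ord := ord) x (padTake x.length []) (length_padTake _ _)
  set σ := ((Valuation.mk (padTake x.length []) [] []).regs x).toStore with hσ
  have h2 : (σ 2).length = x.length := length_padTake _ _
  obtain ⟨l, l', hl, hl', H2⟩ := does_prepareTableau (ord := ord) (σ := σ) w c d rfl rfl rfl rfl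
  rw [h2] at hl hl' H2
  have H3 := H (Function.update (Function.update σ 4 l) 3 l')
    (x.length + c * (x.length + 1) ^ d + (w + 1)) ⟨?_, ?_, rfl, rfl⟩ rfl ?_ []
  · have e0 : Function.update (Function.update (Function.update σ 4 l) 3 l') 0 [] =
        Function.update (Function.update σ 4 l) 3 l' := Function.update_eq_self 0 _
    rw [e0] at H3
    refine ⟨_, (H1.seq (H2.seq H3)).mono ?_, ?_, by rw [Schema.encode_conj]; simp⟩
    · simp [add_assoc]
    · have e1 : Function.update (Function.update σ 4 l) 3 l' 1 = x := rfl
      have e4 : Function.update (Function.update σ 4 l) 3 l' 4 = l := rfl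
      simp only [Function.update_self, List.append_nil, e1, e4, hl]
  · exact h2
  · exact hl'.trans (by rw [← hl]; rfl)
  · intro r hr
    fin_cases r <;> simp [hσ, Valuation.regs, Regs.toStore, dictFlags, dictSymbols, reversedNames,
      hl, hl'] <;> omega

end

/-- For a machine that halts in time `p`, the tableau with `p.eval 1 * (n + 1) ^ p.natDegree` steps
is large enough for the inputs of length `n`. -/
theorem reduces_sat {K : Type u} [CommSemiring K] [Nontrivial K] (hK : IsPositive K)
    {ord : Option (SemiringOrder K)} {L : Set (List K)} (hL : L ∈ NP ord) :
    Reduces ord L (SAT ord) := by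
  obtain ⟨M, p, hM, hL⟩ := hL
  obtain ⟨w, h2, hw⟩ := M.exists_bound
  refine ⟨_, polyTimeComputable_tableau M w (p.eval 1) p.natDegree, fun x => ?_⟩
  rw [hL, ← exists_holds_tableau hw h2 x (p.eval 1 * (x.length + 1) ^ p.natDegree) fun x' => ?_]
  · refine (Schema.satisfiable_conj (ord := ord) hK Var.name_injective _).symm.trans
      ⟨fun h => ⟨_, rfl, h⟩, ?_⟩
    rintro ⟨φ, hφ, h⟩
    rwa [Formula.encode_injective hφ] at h
  · obtain ⟨t, ht, h⟩ := hM x x'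
    exact ⟨t, ht.trans (eval_le_mul_pow p _), h⟩

end CookK

theorem mainTheorem2 {K : Type u} [CommSemiring K] [Nontrivial K] (hK : CookK.IsPositive K)
    (ord : Option (CookK.SemiringOrder K)) :
    CookK.NPComplete ord (CookK.SAT ord) :=
  ⟨CookK.sat_mem_NP ord, fun _ hL => CookK.reduces_sat hK hL⟩
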